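/- Let $G=(V,E)$ be a finite simple undirected graph without isolated nodes. For an integer $k\ge 0$ (the cases of interest are $k\ge 3$), the $k$-truss $T_k(G)$ is the largest subgraph of $G$ in which every edge lies in at least $k-2$ triangles of that subgraph. For two nodes $u\neq v$, the post-merger graph $PM(u,v;G)$ is obtained by deleting $v$ and joining $u$ to every neighbour of $v$ other than $u$, without creating loops or multiple edges. Given $G$, $k$ and a budget $b$ with $1\le b<|V|$, the naive greedy algorithm starts with $P=\emptyset$ and, while $|P|<b$, does the following: it computes $f(\{p\})=|E(T_k(PM(p;G)))|$ for every pair $p$ of distinct nodes of the current graph $G$, adds a pair $p^*$ that maximizes $f(\{p\})$ to $P$, and, if still $|P|<b$, replaces $G$ by $PM(p^*;G)$; finally it returns $P$. The naive greedy algorithm takes $O(b|V|^2|E|^{1.5})$ time and $O(|E|)$ space for every $k$, where $V$ and $E$ are the node set and the edge set of the input graph. Precisely: there are a word-RAM program (unit-cost arithmetic, tests and memory access) and constants $C,c$ such that for every such $G$ with $V=\{0,\dots,n-1\}$, given as a list of its edges in any order and orientation, every integer $k\ge 0$ and every $b$ with $1\le b<n$, the program carries out the naive greedy algorithm in at most $C\,b\,|V|^2|E|^{1.5}$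 steps, using only $C|E|$ consecutive memory cells (which include the input) and words with values below $(n+k+2)^c$. Here carrying out the algorithm means that the program writes to a write-only output, iteration by iteration, the value $f(\{p\})$ of every pair $p$ of nodes of the current graph (each pair once) and then the selected pair $p^*$, and at the end the returned set $P$. -/

import Mathlib

/-! ### Simple graphs on a subset of the nodes, trusses and mergers -/

/-- A simple graph whose node set is a subset of `V` (a subgraph of the complete graph on `V`):
node set `G.verts`, adjacency `G.Adj`, edge set `G.edgeSet`.  Mergers delete nodes, so the node set
has to be part of the data. -/
abbrev NodeGraph (V : Type*) := (⊤ : SimpleGraph V).Subgraph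

namespace NodeGraph

variable {V : Type*}

/-- A simple graph on all of `V`. -/
def ofSimpleGraph (G : SimpleGraph V) : NodeGraph V := SimpleGraph.toSubgraph G le_top

/-- The support of the pair `u, v`: the number of triangles of `G` that contain `u` and `v`
(meant for adjacent `u`, `v`), i.e. the number of their common neighbours. -/
noncomputable def support (G : NodeGraph V) (u v : V) : ℕ :=
  {w : V | G.Adj u w ∧ G.Adj v w}.ncard

/-- Every edge of `H` has support at least `k - 2` within `H`. -/
def HasTrussProperty (k : ℕ) (H : NodeGraph V) : Prop :=
  ∀ u v : V, H.Adj u v → k ≤ H.support u v + 2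

/-- The `k`-truss of `G`: the largest subgraph of `G` in which every edge has support at least
`k - 2`. -/
def kTruss (k : ℕ) (G : NodeGraph V) : NodeGraph V :=
  sSup {H : NodeGraph V | H ≤ G ∧ HasTrussProperty k H}

/-- On a finite set of nodes the `k`-truss is itself one of the subgraphs in question, so it is the
largest of them. -/
theorem kTruss_isGreatest [Finite V] (k : ℕ) (G : NodeGraph V) :
    IsGreatest {H : NodeGraph V | H ≤ G ∧ HasTrussProperty k H} (kTruss k G) := by
  refine ⟨⟨sSup_le fun H hH => hH.1, ?_⟩, fun H hH => le_sSup hH⟩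
  intro u v huv
  rw [kTruss, SimpleGraph.Subgraph.sSup_adj] at huv
  obtain ⟨H, hH, hadj⟩ := huv
  have hle : H ≤ kTruss k G := le_sSup hH
  refine (hH.2 u v hadj).trans (Nat.add_le_add_right ?_ 2)
  exact Set.ncard_le_ncard (fun w hw => ⟨hle.2 hw.1, hle.2 hw.2⟩) (Set.toFinite _)

/-- The post-merger graph: `v` is merged into `u`.  The node `v` disappears, and the edges at `v`
are shifted to `u`, without creating loops or multiple edges. -/
def merge (u v : V) (G : NodeGraph V) : NodeGraph V where
  verts := G.verts \ {v}
  Adj x y := x ∈ G.verts \ {v} ∧ y ∈ G.verts \ {v} ∧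
    (G.Adj x y ∨ (x = u ∧ y ≠ u ∧ G.Adj v y) ∨ (y = u ∧ x ≠ u ∧ G.Adj v x))
  adj_sub := by
    rintro x y ⟨-, -, h | ⟨rfl, h, -⟩ | ⟨rfl, h, -⟩⟩
    · exact h.adj_sub
    · exact h.symm
    · exact h
  edge_vert := fun h => h.1
  symm := ⟨by
    rintro x y ⟨hx, hy, h | h | h⟩
    · exact ⟨hy, hx, Or.inl h.symm⟩
    · exact ⟨hy, hx, Or.inr (Or.inr h)⟩
    · exact ⟨hy, hx, Or.inr (Or.inl h)⟩⟩

/-- `f({p})`: the number of edges of the `k`-truss after the merger `p`. -/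
noncomputable def trussSizeAfter (k : ℕ) (G : NodeGraph V) (p : V × V) : ℕ :=
  (kTruss k (merge p.1 p.2 G)).edgeSet.ncard

/-- The unordered pairs of distinct nodes of `G`, each written with its smaller node first (so that
the larger node is merged into the smaller one). -/
def nodePairs [LT V] (G : NodeGraph V) : Set (V × V) :=
  {p | p.1 ∈ G.verts ∧ p.2 ∈ G.verts ∧ p.1 < p.2}

end NodeGraph

/-! ### The naive greedy algorithm -/

/-- A run of the loop of the naive greedy algorithm for the truss parameter `k` and the budget `b`.
`NaiveGreedyLoop k b P G trace R` says that the loop `while |P| < b`, entered with the set of pairs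
`P` and the graph `G`, can end with the set of pairs `R` (ties in the `arg max` are broken in some
way), and that `trace` records what is computed on the way: in every iteration first the triples
`u, v, f({(u, v)})` for all pairs `(u, v)` of nodes of the current graph, each pair once and in some
order, and then the pair `p` that is selected. -/
inductive NaiveGreedyLoop {n : ℕ} (k b : ℕ) :
    Finset (Fin n × Fin n) → NodeGraph (Fin n) → List ℕ → Finset (Fin n × Fin n) → Prop
  | exit (P : Finset (Fin n × Fin n)) (G : NodeGraph (Fin n)) (h : ¬ P.card < b) :
      NaiveGreedyLoop k b P G [] P
  | iterate (P : Finset (Fin n × Fin n)) (G : NodeGraph (Fin n)) (h : P.card < b)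
      (qs : List (Fin n × Fin n)) (nodup : qs.Nodup) (all : ∀ q, q ∈ qs ↔ q ∈ G.nodePairs)
      (p : Fin n × Fin n) (mem : p ∈ qs)
      (max : ∀ q ∈ qs, G.trussSizeAfter k q ≤ G.trussSizeAfter k p)
      (G' : NodeGraph (Fin n))
      (update : G' = if (insert p P).card < b then NodeGraph.merge p.1 p.2 G else G)
      (trace : List ℕ) (R : Finset (Fin n × Fin n))
      (rest : NaiveGreedyLoop k b (insert p P) G' trace R) :
      NaiveGreedyLoop k b P G
        (qs.flatMap (fun q => [(q.1 : ℕ), (q.2 : ℕ), G.trussSizeAfter k q]) ++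
          [(p.1 : ℕ), (p.2 : ℕ)] ++ trace) R

/-- `out` is the report of a complete run of the naive greedy algorithm on the graph `G`: the trace
of its loop, started with `P = ∅`, followed by a listing of the returned set of pairs. -/
def IsNaiveGreedyReport {n : ℕ} (G : SimpleGraph (Fin n)) (k b : ℕ) (out : List ℕ) : Prop :=
  ∃ (trace : List ℕ) (R : Finset (Fin n × Fin n)) (ps : List (Fin n × Fin n)),
    NaiveGreedyLoop k b ∅ (NodeGraph.ofSimpleGraph G) trace R ∧
    ps.Nodup ∧ ps.toFinset = R ∧
    out = trace ++ ps.flatMap (fun p => [(p.1 : ℕ), (p.2 : ℕ)])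

/-! ### A word RAM with structured programs -/

namespace RAM

/-- An operand: a register or a constant. -/
inductive Arg
  | reg (i : ℕ)
  | imm (c : ℕ)

/-- Arithmetic operations on words (`sub` is truncated at `0`). -/
inductive Op
  | add
  | sub
  | mul
  | div
  | mod

def Op.eval : Op → ℕ → ℕ → ℕ
  | .add, x, y => x + y
  | .sub, x, y => x - y
  | .mul, x, y => x * y
  | .div, x, y => x / y
  | .mod, x, y => x % y

/-- Tests. -/
inductive Test
  | lt (a b : Arg)
  | eq (a b : Arg)

/-- Programs.  A program is a finite object, so it names finitely many registers; everything else
has to be kept in the memory. -/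
inductive Prog
  | skip
  /-- `x := a o b` -/
  | set (x : ℕ) (o : Op) (a b : Arg)
  /-- `x := memory[a]` -/
  | load (x : ℕ) (a : Arg)
  /-- `memory[a] := b` -/
  | store (a b : Arg)
  /-- append `a` to the write-only output -/
  | emit (a : Arg)
  | seq (c d : Prog)
  | ite (q : Test) (c d : Prog)
  | loop (q : Test) (c : Prog)

structure State where
  reg : ℕ → ℕ
  mem : ℕ → ℕ
  out : List ℕ

def Arg.val (s : State) : Arg → ℕ
  | .reg i => s.reg i
  | .imm c => c

def Test.holds (s : State) : Test → Prop
  | .lt a b => a.val s < b.val s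
  | .eq a b => a.val s = b.val s

/-- `Exec W S c s s' t`: on a machine with `S` memory cells (addresses `0, …, S - 1`) and words
with values in `0, …, W - 1`, the program `c`, started in the state `s`, halts in the state `s'`
after `t` steps.  Every instruction and every evaluation of a test is one step.  A program that
addresses a cell outside the memory or computes a value that does not fit into a word has no
halting execution. -/
inductive Exec (W S : ℕ) : Prog → State → State → ℕ → Prop
  | skip (s : State) : Exec W S .skip s s 1
  | set (s : State) (x : ℕ) (o : Op) (a b : Arg) (h : o.eval (a.val s) (b.val s) < W) :
      Exec W S (.set x o a b) s
        { s with reg := Function.update s.reg x (o.eval (a.val s) (b.val s)) } 1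
  | load (s : State) (x : ℕ) (a : Arg) (h : a.val s < S) :
      Exec W S (.load x a) s { s with reg := Function.update s.reg x (s.mem (a.val s)) } 1
  | store (s : State) (a b : Arg) (h : a.val s < S) (hb : b.val s < W) :
      Exec W S (.store a b) s { s with mem := Function.update s.mem (a.val s) (b.val s) } 1
  | emit (s : State) (a : Arg) :
      Exec W S (.emit a) s { s with out := s.out ++ [a.val s] } 1
  | seq (c d : Prog) (s s' s'' : State) (t t' : ℕ)
      (hc : Exec W S c s s' t) (hd : Exec W S d s' s'' t') :
      Exec W S (.seq c d) s s'' (t + t')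
  | ite_true (q : Test) (c d : Prog) (s s' : State) (t : ℕ) (hq : q.holds s)
      (hc : Exec W S c s s' t) : Exec W S (.ite q c d) s s' (t + 1)
  | ite_false (q : Test) (c d : Prog) (s s' : State) (t : ℕ) (hq : ¬ q.holds s)
      (hd : Exec W S d s s' t) : Exec W S (.ite q c d) s s' (t + 1)
  | loop_true (q : Test) (c : Prog) (s s' s'' : State) (t t' : ℕ) (hq : q.holds s)
      (hc : Exec W S c s s' t) (hw : Exec W S (.loop q c) s' s'' t') :
      Exec W S (.loop q c) s s'' (t + t' + 1)
  | loop_false (q : Test) (c : Prog) (s : State) (hq : ¬ q.holds s) :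
      Exec W S (.loop q c) s s 1

/-- The initial state with the given input: the input is in the first memory cells, everything else
is `0`, and nothing has been output. -/
def initial (input : List ℕ) : State where
  reg := fun _ => 0
  mem := fun i => input.getD i 0
  out := []

end RAM

/-- `es` lists the edges of `G`, each once, in some order and each in one of its two directions. -/
def IsEdgeList {n : ℕ} (G : SimpleGraph (Fin n)) (es : List (Fin n × Fin n)) : Prop :=
  (es.map (fun e => s(e.1, e.2))).Nodup ∧
    ∀ e : Sym2 (Fin n), e ∈ es.map (fun e => s(e.1, e.2)) ↔ e ∈ G.edgeSet

/-- The input of the algorithm as it is laid out in memory: `|V|`, `|E|`, `k`, `b`, and then the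
endpoints of the listed edges. -/
def graphInput (n k b : ℕ) (es : List (Fin n × Fin n)) : List ℕ :=
  [n, es.length, k, b] ++ es.flatMap (fun e => [(e.1 : ℕ), (e.2 : ℕ)])

/-!
The program is written in a small language of expressions, variables, arrays and structured commands
(`Expr`, `Cmd`), which is compiled to the word RAM; compiled code is correct and takes no more steps
than the cost of the command (`Expr.exec_comp`, `Big.exec`).  Programs are verified with a calculus of
weakest preconditions in which time is a resource that every command consumes (`wp`, `wp_whl`): a
specification states at the same time what a command computes and how much time is left.

The program never stores a merged graph.  It keeps a root map, which sends every node of the input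
graph to the node it has been merged into, and this map together with the list of edges describes the
current graph (`Describes`, `Describes.merge`).  For each pair, the directed edges of the post-merger
graph are computed anew from the list: they are coded as numbers `x * n + y`, sorted, freed of
repetitions, and split into the rows of the nodes (`gen`, `radixSort`, `dedupe`, `findRows`).  Since no
node is isolated, `n ≤ 2 * m`, and a radix of about `√n` keeps the time for sorting within a multiple
of `m ^ (3 / 2)`, while all arrays have length of order `m`.

The truss is found by peeling (`Peel`): edges in fewer than `k - 2` triangles are removed until there
are none, and an edge that is removed belongs to no subgraph with the truss property.  The edges that
are left form the largest dense set of edges, which is the edge set of the truss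
(`Peel.isDense`, `ncard_edgeSet_kTruss`).

The triangles at an edge `xy` have to be listed twice at most, once for counting them and once for the
removal of the edge.  Let `d₁ ≤ d₂` be the degrees of its ends.  Both rows are sorted, and the longer
one is searched in jumps of length about `√(d₂ / d₁)`: this takes about `√(d₁ * d₂)` jumps in total and
`d₁` searches of blocks, each as long as a jump, hence time of order `√(d₁ * d₂)` without any
additional memory (`stepLength`, `intersect_spec`).  Summed over all edges, this is of order
`m ^ (3 / 2)`: by the inequality of Cauchy and Schwarz, the square of the sum is at most the number of
edges times the sum of the products `d₁ * d₂`, and that sum is at most the square of the number of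
directed edges, as a pair of directed edges starting at `x` and at `y` determines `xy`
(`Table.sum_mul_le`, `Table.totalWeight_le`).

There are at most `n ^ 2` pairs in an iteration.  The second node of the selected pair disappears from
the graph, so no pair is selected twice, and there are exactly `b` iterations (`Progress`,
`greedyRound_spec`).
-/

set_option linter.constructorNameAsVariable false
set_option linter.unusedSimpArgs false
set_option linter.unnecessarySeqFocus false

namespace Greedy

open Function RAM

/-! ### A language of arrays and expressions on top of the word RAM -/

/-- The variables of the program: the parameters `n`, `m`, `k`, `b`, the radix `base`, the number `it`
of finished iterations, the pair `u`, `v` with the value `f`, the best pair `bu`, `bv`, the numbers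
`cnt` and `size` of directed edges before and after the removal of repetitions, the ends `ix`, `hx`
and `jy`, `hy` of two rows, the step length `st`, the ends `qh`, `qt` of the queue, the edge `g` that
is removed; the others are auxiliary. -/
inductive Var
  | n | m | k | b | base | it | u | v | e | x | y | z | cnt | c | d | i | pw | p | qt | qh | size
  | st | w | t | te | ix | hx | jy | hy | j | e₁ | e₂ | f | bu | bv | bf | g
  deriving DecidableEq

/-- The arrays of the program.  `root` maps every node of the input graph to the node it has been
merged into; `fst`, `snd` hold the selected pairs; `key`, `buf` hold directed edges `x * n + y`;
`lo`, `hi`, `cur` hold positions of rows; `ident`, `sup`, `flag`, `queue` belong to the peeling of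
the truss, and `tri₁`, `tri₂` list the triangles at an edge. -/
inductive Arr
  | root | fst | snd | key | buf | lo | hi | cur | ident | sup | flag | queue | tri₁ | tri₂
  deriving DecidableEq

theorem Var.ctorIdx_injective : Injective Var.ctorIdx :=
  LeftInverse.injective (g := Var.ofNat) fun x => by cases x <;> rfl

theorem Arr.ctorIdx_injective : Injective Arr.ctorIdx :=
  LeftInverse.injective (g := Arr.ofNat) fun x => by cases x <;> rfl

theorem Arr.ctorIdx_lt (a : Arr) : a.ctorIdx < 16 := by cases a <;> decide

/-- Expressions; `arr a i` is the entry `i` of the array `a`, `inp i` the cell `i` of the input,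
`lt` and `eq` have the values `0` and `1`, and `cond q a b` is `b` if `q` is `0` and `a`
otherwise. -/
inductive Expr
  | lit (c : ℕ)
  | var (x : Var)
  | op (o : Op) (a b : Expr)
  | arr (a : Arr) (i : Expr)
  | inp (i : Expr)
  | lt (a b : Expr)
  | eq (a b : Expr)
  | cond (q a b : Expr)

namespace Expr

instance : Add Expr := ⟨op .add⟩
instance : Sub Expr := ⟨op .sub⟩
instance : Mul Expr := ⟨op .mul⟩
instance : Div Expr := ⟨op .div⟩
instance : Mod Expr := ⟨op .mod⟩
instance (c : ℕ) : OfNat Expr c := ⟨lit c⟩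

end Expr

/-- The parameters of a run: words are below `W`, arrays have `N` cells, and the input `inp` has
length `len`. -/
structure Ctx where
  W : ℕ
  N : ℕ
  len : ℕ
  inp : ℕ → ℕ

/-- The values of the variables and of the arrays, and the output. -/
structure Store where
  v : Var → ℕ
  a : Arr → ℕ → ℕ
  out : List ℕ

namespace Expr

variable (Γ : Ctx) (σ : Store)

/-- The value of an expression. -/
def val : Expr → ℕ
  | lit c => c
  | var x => σ.v x
  | op o a b => o.eval (val a) (val b)
  | arr a i => σ.a a (val i)
  | inp i => Γ.inp (val i)
  | lt a b => if val a < val b then 1 else 0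
  | eq a b => if val a = val b then 1 else 0
  | cond q a b => if val q = 0 then val b else val a

/-- The operations whose results may be too large for a word. -/
def opOk : Op → ℕ → ℕ → Prop
  | .add, x, y => x + y < Γ.W
  | .mul, x, y => x * y < Γ.W
  | _, _, _ => True

/-- No overflow and no access out of bounds occurs in the evaluation of an expression.  Literals are
required to be below `100`, a number that every word can hold. -/
def ok : Expr → Prop
  | lit c => c < 100
  | var _ => True
  | op o a b => ok a ∧ ok b ∧ opOk Γ o (a.val Γ σ) (b.val Γ σ)
  | arr _ i => ok i ∧ i.val Γ σ < Γ.N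
  | inp i => ok i ∧ i.val Γ σ < Γ.len
  | lt a b => ok a ∧ ok b
  | eq a b => ok a ∧ ok b
  | cond q a b => ok q ∧ (q.val Γ σ = 0 → ok b) ∧ (q.val Γ σ ≠ 0 → ok a)

/-- A bound for the number of steps that the evaluation of an expression takes. -/
def cost : Expr → ℕ
  | lit _ => 1
  | var _ => 1
  | op _ a b => cost a + cost b + 1
  | arr _ i => cost i + 4
  | inp i => cost i + 1
  | lt a b => cost a + cost b + 2
  | eq a b => cost a + cost b + 2
  | cond q a b => cost q + cost a + cost b + 1

section simp
variable (a b : Expr) (c : ℕ)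
@[simp] theorem val_add : (a + b).val Γ σ = a.val Γ σ + b.val Γ σ := rfl
@[simp] theorem val_sub : (a - b).val Γ σ = a.val Γ σ - b.val Γ σ := rfl
@[simp] theorem val_mul : (a * b).val Γ σ = a.val Γ σ * b.val Γ σ := rfl
@[simp] theorem val_div : (a / b).val Γ σ = a.val Γ σ / b.val Γ σ := rfl
@[simp] theorem val_mod : (a % b).val Γ σ = a.val Γ σ % b.val Γ σ := rfl
@[simp] theorem val_ofNat : (OfNat.ofNat c : Expr).val Γ σ = c := rfl
@[simp] theorem ok_add : (a + b).ok Γ σ ↔ a.ok Γ σ ∧ b.ok Γ σ ∧ a.val Γ σ + b.val Γ σ < Γ.W :=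
  Iff.rfl
@[simp] theorem ok_mul : (a * b).ok Γ σ ↔ a.ok Γ σ ∧ b.ok Γ σ ∧ a.val Γ σ * b.val Γ σ < Γ.W :=
  Iff.rfl
@[simp] theorem ok_sub : (a - b).ok Γ σ ↔ a.ok Γ σ ∧ b.ok Γ σ := by
  simp [show a - b = op .sub a b from rfl, ok, opOk]
@[simp] theorem ok_div : (a / b).ok Γ σ ↔ a.ok Γ σ ∧ b.ok Γ σ := by
  simp [show a / b = op .div a b from rfl, ok, opOk]
@[simp] theorem ok_mod : (a % b).ok Γ σ ↔ a.ok Γ σ ∧ b.ok Γ σ := by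
  simp [ok, opOk]
@[simp] theorem ok_ofNat : (OfNat.ofNat c : Expr).ok Γ σ ↔ c < 100 := Iff.rfl
@[simp] theorem cost_add : (a + b).cost = a.cost + b.cost + 1 := rfl
@[simp] theorem cost_sub : (a - b).cost = a.cost + b.cost + 1 := rfl
@[simp] theorem cost_mul : (a * b).cost = a.cost + b.cost + 1 := rfl
@[simp] theorem cost_div : (a / b).cost = a.cost + b.cost + 1 := rfl
@[simp] theorem cost_mod : (a % b).cost = a.cost + b.cost + 1 := rfl
@[simp] theorem cost_ofNat : (OfNat.ofNat c : Expr).cost = 1 := rfl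
end simp

/-- The register that holds a variable.  Register `0` holds the address of the first array cell, and
the odd registers hold intermediate results. -/
def regOf (x : Var) : ℕ := 2 * x.ctorIdx + 2

/-- The code that evaluates an expression into the register `2 * d + 1`, using only the odd
registers from there on. -/
def comp : Expr → ℕ → Prog
  | lit c, d => .set (2 * d + 1) .add (.imm c) (.imm 0)
  | var x, d => .set (2 * d + 1) .add (.reg (regOf x)) (.imm 0)
  | op o a b, d => .seq (comp a d) (.seq (comp b (d + 1))
      (.set (2 * d + 1) o (.reg (2 * d + 1)) (.reg (2 * d + 3))))
  | arr a i, d => .seq (comp i d) (.seq (.set (2 * d + 1) .mul (.reg (2 * d + 1)) (.imm 16))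
      (.seq (.set (2 * d + 1) .add (.reg (2 * d + 1)) (.imm a.ctorIdx))
        (.seq (.set (2 * d + 1) .add (.reg 0) (.reg (2 * d + 1)))
          (.load (2 * d + 1) (.reg (2 * d + 1))))))
  | inp i, d => .seq (comp i d) (.load (2 * d + 1) (.reg (2 * d + 1)))
  | lt a b, d => .seq (comp a d) (.seq (comp b (d + 1))
      (.ite (.lt (.reg (2 * d + 1)) (.reg (2 * d + 3)))
        (.set (2 * d + 1) .add (.imm 1) (.imm 0)) (.set (2 * d + 1) .add (.imm 0) (.imm 0))))
  | eq a b, d => .seq (comp a d) (.seq (comp b (d + 1))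
      (.ite (.eq (.reg (2 * d + 1)) (.reg (2 * d + 3)))
        (.set (2 * d + 1) .add (.imm 1) (.imm 0)) (.set (2 * d + 1) .add (.imm 0) (.imm 0))))
  | cond q a b, d => .seq (comp q d) (.ite (.eq (.reg (2 * d + 1)) (.imm 0)) (comp b d) (comp a d))

end Expr

/-- The memory of a machine in the context `Γ` can hold the input and the arrays. -/
structure Ctx.Valid (Γ : Ctx) (S : ℕ) : Prop where
  space : Γ.len + 16 * Γ.N ≤ S
  word : S ≤ Γ.W
  lit : 100 ≤ Γ.W
  inp : ∀ i < Γ.len, Γ.inp i < Γ.W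

/-- The machine state `s` represents the store `σ`: cell `i` of array `a` is at the address
`len + (16 * i + a)`.  The arrays are interleaved, so that addresses depend on no run-time quantity
other than `len`, which is in register `0`. -/
structure Rep (Γ : Ctx) (σ : Store) (s : State) : Prop where
  base : s.reg 0 = Γ.len
  var : ∀ x, s.reg (Expr.regOf x) = σ.v x
  arr : ∀ a, ∀ i < Γ.N, s.mem (Γ.len + (i * 16 + a.ctorIdx)) = σ.a a i
  inp : ∀ i < Γ.len, s.mem i = Γ.inp i
  out : s.out = σ.out
  var_lt : ∀ x, σ.v x < Γ.W
  arr_lt : ∀ a, ∀ i < Γ.N, σ.a a i < Γ.W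

theorem Rep.congr {Γ : Ctx} {σ : Store} {s s' : State} (h : Rep Γ σ s) (hm : s'.mem = s.mem)
    (ho : s'.out = s.out) (hr : ∀ r, r % 2 = 0 → s'.reg r = s.reg r) : Rep Γ σ s' where
  base := by rw [hr 0 rfl, h.base]
  var x := by rw [hr _ (by simp [Expr.regOf]), h.var]
  arr := by simpa [hm] using h.arr
  inp := by simpa [hm] using h.inp
  out := by rw [ho, h.out]
  var_lt := h.var_lt
  arr_lt := h.arr_lt

namespace Expr

variable {Γ : Ctx} {σ : Store} {S : ℕ}

theorem op_lt {o : Op} {x y : ℕ} (hx : x < Γ.W) (h : opOk Γ o x y) : o.eval x y < Γ.W := by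
  cases o
  · exact h
  · exact (Nat.sub_le _ _).trans_lt hx
  · exact h
  · exact (Nat.div_le_self _ _).trans_lt hx
  · exact (Nat.mod_le _ _).trans_lt hx

/-- Compiled expressions compute the value of the expression. -/
theorem exec_comp (hΓ : Γ.Valid S) (e : Expr) : ∀ (d : ℕ) (s : State), Rep Γ σ s → e.ok Γ σ →
    ∃ s' t, Exec Γ.W S (e.comp d) s s' t ∧ t ≤ e.cost ∧ s'.reg (2 * d + 1) = e.val Γ σ ∧
      e.val Γ σ < Γ.W ∧ s'.mem = s.mem ∧ s'.out = s.out ∧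
      ∀ r, (r % 2 = 0 ∨ r < 2 * d + 1) → s'.reg r = s.reg r := by
  have upd : ∀ (d x : ℕ) (s s' : State), (∀ r, (r % 2 = 0 ∨ r < 2 * d + 1) → s'.reg r = s.reg r) →
      ∀ r, (r % 2 = 0 ∨ r < 2 * d + 1) → update s'.reg (2 * d + 1) x r = s.reg r := by
    intro d x s s' h r hr
    rw [update_of_ne (by omega), h r hr]
  have hl := hΓ.lit
  induction e with
  | lit c =>
    intro d s hs hok
    have hok' : c < 100 := hok
    refine ⟨_, _, .set _ _ _ _ _ ?_, le_rfl, ?_, ?_, rfl, rfl, upd d _ s s fun _ _ => rfl⟩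
    · simp only [Op.eval, Arg.val]; omega
    · simp [Op.eval, Arg.val, val]
    · simp only [val]; omega
  | var x =>
    intro d s hs hok
    refine ⟨_, _, .set _ _ _ _ _ ?_, le_rfl, ?_, ?_, rfl, rfl, upd d _ s s fun _ _ => rfl⟩
    · simp only [Op.eval, Arg.val, hs.var, add_zero]; exact hs.var_lt x
    · simp [Op.eval, Arg.val, val, hs.var]
    · exact hs.var_lt x
  | op o a b iha ihb =>
    intro d s hs ⟨oka, okb, hok⟩
    obtain ⟨s₁, t₁, h₁, ht₁, hv₁, hw₁, hm₁, ho₁, hr₁⟩ := iha d s hs oka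
    obtain ⟨s₂, t₂, h₂, ht₂, hv₂, hw₂, hm₂, ho₂, hr₂⟩ := ihb (d + 1) s₁
      (hs.congr hm₁ ho₁ fun r hr => hr₁ r (.inl hr)) okb
    have hv₃ : s₂.reg (2 * d + 1) = a.val Γ σ := by rw [hr₂ _ (.inr (by omega)), hv₁]
    have hv₄ : s₂.reg (2 * d + 3) = b.val Γ σ := hv₂
    have hlt := op_lt hw₁ hok
    refine ⟨_, _, .seq _ _ _ _ _ _ _ h₁ (.seq _ _ _ _ _ _ _ h₂ (.set _ _ _ _ _ ?_)),
      ?_, ?_, hlt, ?_, ?_, upd d _ s s₂ ?_⟩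
    · simpa [Arg.val, hv₃, hv₄] using hlt
    · simp only [cost]; omega
    · simp [Arg.val, hv₃, hv₄, val]
    · exact hm₂.trans hm₁
    · exact ho₂.trans ho₁
    · intro r hr
      rw [hr₂ r (by omega), hr₁ r hr]
  | arr a i ih =>
    intro d s hs ⟨oki, hi⟩
    obtain ⟨s₁, t₁, h₁, ht₁, hv₁, hw₁, hm₁, ho₁, hr₁⟩ := ih d s hs oki
    have ha := a.ctorIdx_lt
    have hsp := hΓ.space
    have hwd := hΓ.word
    have h0 : s₁.reg 0 = Γ.len := by rw [hr₁ 0 (.inl rfl), hs.base]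
    refine ⟨_, _, .seq _ _ _ _ _ _ _ h₁ (.seq _ _ _ _ _ _ _ (.set _ _ _ _ _ ?_)
      (.seq _ _ _ _ _ _ _ (.set _ _ _ _ _ ?_) (.seq _ _ _ _ _ _ _ (.set _ _ _ _ _ ?_)
        (.load _ _ _ ?_)))), ?_, ?_, ?_, hm₁, ho₁, ?_⟩
    · simp only [Op.eval, Arg.val, hv₁]; omega
    · simp only [Op.eval, Arg.val, hv₁, update_self]; omega
    · simp only [Op.eval, Arg.val, hv₁, update_self, update_idem]
      rw [update_of_ne (by omega), h0]; omega
    · simp only [Op.eval, Arg.val, hv₁, update_self, update_idem]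
      rw [update_of_ne (by omega), h0]; omega
    · simp only [cost]; omega
    · simp only [Op.eval, Arg.val, hv₁, update_self, update_idem]
      rw [update_of_ne (by omega), h0, hm₁, hs.arr a _ hi]; rfl
    · exact hs.arr_lt a _ hi
    · simp only [update_idem]
      exact upd d _ s s₁ hr₁
  | inp i ih =>
    intro d s hs ⟨oki, hi⟩
    obtain ⟨s₁, t₁, h₁, ht₁, hv₁, hw₁, hm₁, ho₁, hr₁⟩ := ih d s hs oki
    have hsp := hΓ.space
    refine ⟨_, _, .seq _ _ _ _ _ _ _ h₁ (.load _ _ _ ?_), ?_, ?_, ?_, hm₁, ho₁, upd d _ s s₁ hr₁⟩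
    · simp only [Arg.val, hv₁]; omega
    · simp only [cost]; omega
    · simp only [Arg.val, hv₁, update_self, hm₁, val]; exact hs.inp _ hi
    · exact hΓ.inp _ hi
  | lt a b iha ihb =>
    intro d s hs ⟨oka, okb⟩
    obtain ⟨s₁, t₁, h₁, ht₁, hv₁, hw₁, hm₁, ho₁, hr₁⟩ := iha d s hs oka
    obtain ⟨s₂, t₂, h₂, ht₂, hv₂, hw₂, hm₂, ho₂, hr₂⟩ := ihb (d + 1) s₁
      (hs.congr hm₁ ho₁ fun r hr => hr₁ r (.inl hr)) okb
    have hv₃ : s₂.reg (2 * d + 1) = a.val Γ σ := by rw [hr₂ _ (.inr (by omega)), hv₁]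
    have hv₄ : s₂.reg (2 * d + 3) = b.val Γ σ := hv₂
    have hr : ∀ r, (r % 2 = 0 ∨ r < 2 * d + 1) → s₂.reg r = s.reg r := fun r hr => by
      rw [hr₂ r (by omega), hr₁ r hr]
    by_cases hlt : a.val Γ σ < b.val Γ σ
    · refine ⟨_, _, .seq _ _ _ _ _ _ _ h₁ (.seq _ _ _ _ _ _ _ h₂
        (.ite_true _ _ _ _ _ _ ?_ (.set _ _ _ _ _ ?_))), ?_, ?_, ?_, hm₂.trans hm₁,
        ho₂.trans ho₁, upd d _ s s₂ hr⟩
      · simpa [Test.holds, Arg.val, hv₃, hv₄] using hlt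
      · simp only [Op.eval, Arg.val]; omega
      · simp only [cost]; omega
      · simp [Op.eval, Arg.val, val, hlt]
      · simp only [val, hlt, if_true]; omega
    · refine ⟨_, _, .seq _ _ _ _ _ _ _ h₁ (.seq _ _ _ _ _ _ _ h₂
        (.ite_false _ _ _ _ _ _ ?_ (.set _ _ _ _ _ ?_))), ?_, ?_, ?_, hm₂.trans hm₁,
        ho₂.trans ho₁, upd d _ s s₂ hr⟩
      · simpa [Test.holds, Arg.val, hv₃, hv₄] using hlt
      · simp only [Op.eval, Arg.val]; omega
      · simp only [cost]; omega
      · simp [Op.eval, Arg.val, val, hlt]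
      · simp only [val, hlt, if_false]; omega
  | eq a b iha ihb =>
    intro d s hs ⟨oka, okb⟩
    obtain ⟨s₁, t₁, h₁, ht₁, hv₁, hw₁, hm₁, ho₁, hr₁⟩ := iha d s hs oka
    obtain ⟨s₂, t₂, h₂, ht₂, hv₂, hw₂, hm₂, ho₂, hr₂⟩ := ihb (d + 1) s₁
      (hs.congr hm₁ ho₁ fun r hr => hr₁ r (.inl hr)) okb
    have hv₃ : s₂.reg (2 * d + 1) = a.val Γ σ := by rw [hr₂ _ (.inr (by omega)), hv₁]
    have hv₄ : s₂.reg (2 * d + 3) = b.val Γ σ := hv₂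
    have hr : ∀ r, (r % 2 = 0 ∨ r < 2 * d + 1) → s₂.reg r = s.reg r := fun r hr => by
      rw [hr₂ r (by omega), hr₁ r hr]
    by_cases hlt : a.val Γ σ = b.val Γ σ
    · refine ⟨_, _, .seq _ _ _ _ _ _ _ h₁ (.seq _ _ _ _ _ _ _ h₂
        (.ite_true _ _ _ _ _ _ ?_ (.set _ _ _ _ _ ?_))), ?_, ?_, ?_, hm₂.trans hm₁,
        ho₂.trans ho₁, upd d _ s s₂ hr⟩
      · simpa [Test.holds, Arg.val, hv₃, hv₄] using hlt
      · simp only [Op.eval, Arg.val]; omega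
      · simp only [cost]; omega
      · simp [Op.eval, Arg.val, val, hlt]
      · simp only [val, hlt, if_true]; omega
    · refine ⟨_, _, .seq _ _ _ _ _ _ _ h₁ (.seq _ _ _ _ _ _ _ h₂
        (.ite_false _ _ _ _ _ _ ?_ (.set _ _ _ _ _ ?_))), ?_, ?_, ?_, hm₂.trans hm₁,
        ho₂.trans ho₁, upd d _ s s₂ hr⟩
      · simpa [Test.holds, Arg.val, hv₃, hv₄] using hlt
      · simp only [Op.eval, Arg.val]; omega
      · simp only [cost]; omega
      · simp [Op.eval, Arg.val, val, hlt]
      · simp only [val, hlt, if_false]; omega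
  | cond q a b ihq iha ihb =>
    intro d s hs ⟨okq, okb, oka⟩
    obtain ⟨s₁, t₁, h₁, ht₁, hv₁, hw₁, hm₁, ho₁, hr₁⟩ := ihq d s hs okq
    have hs₁ := hs.congr hm₁ ho₁ fun r hr => hr₁ r (.inl hr)
    by_cases hq : q.val Γ σ = 0
    · obtain ⟨s₂, t₂, h₂, ht₂, hv₂, hw₂, hm₂, ho₂, hr₂⟩ := ihb d s₁ hs₁ (okb hq)
      refine ⟨_, _, .seq _ _ _ _ _ _ _ h₁ (.ite_true _ _ _ _ _ _ ?_ h₂), ?_, ?_, ?_, hm₂.trans hm₁,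
        ho₂.trans ho₁, fun r hr => by rw [hr₂ r hr, hr₁ r hr]⟩
      · simp [Test.holds, Arg.val, hv₁, hq]
      · simp only [cost]; omega
      · simp [val, hq, hv₂]
      · simpa [val, hq] using hw₂
    · obtain ⟨s₂, t₂, h₂, ht₂, hv₂, hw₂, hm₂, ho₂, hr₂⟩ := iha d s₁ hs₁ (oka hq)
      refine ⟨_, _, .seq _ _ _ _ _ _ _ h₁ (.ite_false _ _ _ _ _ _ ?_ h₂), ?_, ?_, ?_, hm₂.trans hm₁,
        ho₂.trans ho₁, fun r hr => by rw [hr₂ r hr, hr₁ r hr]⟩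
      · simp [Test.holds, Arg.val, hv₁, hq]
      · simp only [cost]; omega
      · simp [val, hq, hv₂]
      · simpa [val, hq] using hw₂

end Expr

/-! ### Commands and their compilation -/

/-- Commands: assignments to variables and to array entries, output, sequencing, branching and loops
(a test holds if its value is not `0`). -/
inductive Cmd
  | skip
  | asg (x : Var) (e : Expr)
  | sto (a : Arr) (i e : Expr)
  | emit (e : Expr)
  | seq (c d : Cmd)
  | ite (q : Expr) (c d : Cmd)
  | whl (q : Expr) (c : Cmd)

namespace Cmd

scoped infixr:30 " ;; " => Cmd.seq

/-- The variables that a command may assign. -/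
def modV : Cmd → Var → Bool
  | skip, _ => false
  | asg x _, y => decide (x = y)
  | sto _ _ _, _ => false
  | emit _, _ => false
  | seq c d, y => modV c y || modV d y
  | ite _ c d, y => modV c y || modV d y
  | whl _ c, y => modV c y

/-- The arrays that a command may change. -/
def modA : Cmd → Arr → Bool
  | skip, _ => false
  | asg _ _, _ => false
  | sto a _ _, b => decide (a = b)
  | emit _, _ => false
  | seq c d, y => modA c y || modA d y
  | ite _ c d, y => modA c y || modA d y
  | whl _ c, y => modA c y

/-- Whether a command may produce output. -/
def emits : Cmd → Bool
  | skip => false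
  | asg _ _ => false
  | sto _ _ _ => false
  | emit _ => true
  | seq c d => emits c || emits d
  | ite _ c d => emits c || emits d
  | whl _ c => emits c

/-- The code for a command. -/
def comp : Cmd → Prog
  | skip => .skip
  | asg x e => .seq (e.comp 0) (.set (Expr.regOf x) .add (.reg 1) (.imm 0))
  | sto a i e => .seq (i.comp 0) (.seq (e.comp 1) (.seq (.set 1 .mul (.reg 1) (.imm 16))
      (.seq (.set 1 .add (.reg 1) (.imm a.ctorIdx)) (.seq (.set 1 .add (.reg 0) (.reg 1))
        (.store (.reg 1) (.reg 3))))))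
  | emit e => .seq (e.comp 0) (.emit (.reg 1))
  | seq c d => .seq (comp c) (comp d)
  | ite q c d => .seq (q.comp 0) (.ite (.eq (.reg 1) (.imm 0)) (comp d) (comp c))
  | whl q c => .seq (q.comp 0) (.loop (.lt (.imm 0) (.reg 1)) (.seq (comp c) (q.comp 0)))

end Cmd

namespace Store

/-- Assign the value `z` to the variable `x`. -/
def setV (σ : Store) (x : Var) (z : ℕ) : Store := { σ with v := update σ.v x z }

/-- Assign the value `z` to entry `i` of the array `a`. -/
def setA (σ : Store) (a : Arr) (i z : ℕ) : Store :=
  { σ with a := update σ.a a (update (σ.a a) i z) }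

/-- Append `z` to the output. -/
def put (σ : Store) (z : ℕ) : Store := { σ with out := σ.out ++ [z] }

variable (σ : Store) (x y : Var) (a b : Arr) (i j z : ℕ)

@[simp] theorem setV_v_self : (σ.setV x z).v x = z := update_self ..
@[simp] theorem setV_v_of_ne (h : y ≠ x) : (σ.setV x z).v y = σ.v y := update_of_ne h ..
@[simp] theorem setV_a : (σ.setV x z).a = σ.a := rfl
@[simp] theorem setV_out : (σ.setV x z).out = σ.out := rfl
@[simp] theorem setA_v : (σ.setA a i z).v = σ.v := rfl
@[simp] theorem setA_a_self : (σ.setA a i z).a a = update (σ.a a) i z := update_self ..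
@[simp] theorem setA_a_of_ne (h : b ≠ a) : (σ.setA a i z).a b = σ.a b := update_of_ne h ..
@[simp] theorem setA_out : (σ.setA a i z).out = σ.out := rfl
@[simp] theorem put_v : (σ.put z).v = σ.v := rfl
@[simp] theorem put_a : (σ.put z).a = σ.a := rfl
@[simp] theorem put_out : (σ.put z).out = σ.out ++ [z] := rfl

end Store

/-- `Big Γ c σ σ' t`: the command `c`, started in `σ`, ends in `σ'`, with cost `t`. -/
inductive Big (Γ : Ctx) : Cmd → Store → Store → ℕ → Prop
  | skip (σ : Store) : Big Γ .skip σ σ 1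
  | asg (σ : Store) (x : Var) (e : Expr) (h : e.ok Γ σ) :
      Big Γ (.asg x e) σ (σ.setV x (e.val Γ σ)) (e.cost + 1)
  | sto (σ : Store) (a : Arr) (i e : Expr) (hi : i.ok Γ σ) (he : e.ok Γ σ) (h : i.val Γ σ < Γ.N) :
      Big Γ (.sto a i e) σ
        (σ.setA a (i.val Γ σ) (e.val Γ σ)) (i.cost + e.cost + 4)
  | emit (σ : Store) (e : Expr) (h : e.ok Γ σ) :
      Big Γ (.emit e) σ (σ.put (e.val Γ σ)) (e.cost + 1)
  | seq (c d : Cmd) (σ σ' σ'' : Store) (t t' : ℕ) (hc : Big Γ c σ σ' t) (hd : Big Γ d σ' σ'' t') :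
      Big Γ (.seq c d) σ σ'' (t + t')
  | ite_true (q : Expr) (c d : Cmd) (σ σ' : Store) (t : ℕ) (hq : q.ok Γ σ) (h : q.val Γ σ ≠ 0)
      (hc : Big Γ c σ σ' t) : Big Γ (.ite q c d) σ σ' (q.cost + 1 + t)
  | ite_false (q : Expr) (c d : Cmd) (σ σ' : Store) (t : ℕ) (hq : q.ok Γ σ) (h : q.val Γ σ = 0)
      (hd : Big Γ d σ σ' t) : Big Γ (.ite q c d) σ σ' (q.cost + 1 + t)
  | whl_true (q : Expr) (c : Cmd) (σ σ' σ'' : Store) (t t' : ℕ) (hq : q.ok Γ σ)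
      (h : q.val Γ σ ≠ 0) (hc : Big Γ c σ σ' t) (hw : Big Γ (.whl q c) σ' σ'' t') :
      Big Γ (.whl q c) σ σ'' (q.cost + 1 + (t + t'))
  | whl_false (q : Expr) (c : Cmd) (σ : Store) (hq : q.ok Γ σ) (h : q.val Γ σ = 0) :
      Big Γ (.whl q c) σ σ (q.cost + 1)

/-- `σ'` differs from `σ` at most in what the command `c` may change. -/
structure Frame (c : Cmd) (σ σ' : Store) : Prop where
  v : ∀ x, c.modV x = false → σ'.v x = σ.v x
  a : ∀ x, c.modA x = false → σ'.a x = σ.a x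
  out : c.emits = false → σ'.out = σ.out

theorem Frame.refl (c : Cmd) (σ : Store) : Frame c σ σ :=
  ⟨fun _ _ => rfl, fun _ _ => rfl, fun _ => rfl⟩

theorem Frame.trans {c : Cmd} {σ σ' σ'' : Store} (h : Frame c σ σ') (h' : Frame c σ' σ'') :
    Frame c σ σ'' :=
  ⟨fun x hx => (h'.v x hx).trans (h.v x hx), fun x hx => (h'.a x hx).trans (h.a x hx),
    fun hx => (h'.out hx).trans (h.out hx)⟩

section

variable {Γ : Ctx} {σ σ' : Store} {c d : Cmd} {t : ℕ}

/-- The static sets of assigned variables and arrays are correct; this is what keeps the invariants of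
loops short. -/
theorem Big.frame (h : Big Γ c σ σ' t) : Frame c σ σ' := by
  induction h with
  | skip σ => exact .refl _ _
  | asg σ x e h =>
    refine ⟨fun y hy => update_of_ne ?_ _ _, fun _ _ => rfl, fun _ => rfl⟩
    rintro rfl
    simp [Cmd.modV] at hy
  | sto σ a i e hi he h =>
    refine ⟨fun _ _ => rfl, fun y hy => update_of_ne ?_ _ _, fun _ => rfl⟩
    rintro rfl
    simp [Cmd.modA] at hy
  | emit σ e h => exact ⟨fun _ _ => rfl, fun _ _ => rfl, fun h => by simp [Cmd.emits] at h⟩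
  | seq c d σ σ' σ'' t t' hc hd ihc ihd =>
    refine ⟨fun x hx => ?_, fun x hx => ?_, fun hx => ?_⟩
    · simp only [Cmd.modV, Bool.or_eq_false_iff] at hx
      rw [ihd.v x hx.2, ihc.v x hx.1]
    · simp only [Cmd.modA, Bool.or_eq_false_iff] at hx
      rw [ihd.a x hx.2, ihc.a x hx.1]
    · simp only [Cmd.emits, Bool.or_eq_false_iff] at hx
      rw [ihd.out hx.2, ihc.out hx.1]
  | ite_true q c d σ σ' t hq h hc ih =>
    refine ⟨fun x hx => ?_, fun x hx => ?_, fun hx => ?_⟩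
    · simp only [Cmd.modV, Bool.or_eq_false_iff] at hx
      rw [ih.v x hx.1]
    · simp only [Cmd.modA, Bool.or_eq_false_iff] at hx
      rw [ih.a x hx.1]
    · simp only [Cmd.emits, Bool.or_eq_false_iff] at hx
      rw [ih.out hx.1]
  | ite_false q c d σ σ' t hq h hc ih =>
    refine ⟨fun x hx => ?_, fun x hx => ?_, fun hx => ?_⟩
    · simp only [Cmd.modV, Bool.or_eq_false_iff] at hx
      rw [ih.v x hx.2]
    · simp only [Cmd.modA, Bool.or_eq_false_iff] at hx
      rw [ih.a x hx.2]
    · simp only [Cmd.emits, Bool.or_eq_false_iff] at hx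
      rw [ih.out hx.2]
  | whl_true q c σ σ' σ'' t t' hq h hc hw ihc ihw =>
    exact Frame.trans ⟨ihc.v, ihc.a, ihc.out⟩ ihw
  | whl_false q c σ hq h => exact .refl _ _

/-- Compiled commands do what the command does, within the cost of the command. -/
theorem Big.exec {S : ℕ} (hΓ : Γ.Valid S) (h : Big Γ c σ σ' t) (s : State) (hs : Rep Γ σ s) :
    ∃ s' t', Exec Γ.W S c.comp s s' t' ∧ t' ≤ t ∧ Rep Γ σ' s' := by
  induction h generalizing s with
  | skip σ => exact ⟨s, 1, .skip s, le_rfl, hs⟩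
  | asg σ x e h =>
    obtain ⟨s₁, t₁, h₁, ht₁, hv₁, hw₁, hm₁, ho₁, hr₁⟩ := e.exec_comp hΓ 0 s hs h
    have hs₁ := hs.congr hm₁ ho₁ fun r hr => hr₁ r (.inl hr)
    refine ⟨_, _, .seq _ _ _ _ _ _ _ h₁ (.set _ _ _ _ _ ?_), by omega, ?_⟩
    · simpa [Op.eval, Arg.val, hv₁] using hw₁
    · have hv : s₁.reg 1 = e.val Γ σ := hv₁
      simp only [Op.eval, Arg.val, hv, add_zero]
      refine ⟨?_, fun y => ?_, hs₁.arr, hs₁.inp, hs₁.out, fun y => ?_, hs.arr_lt⟩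
      · simp [Expr.regOf, update_of_ne, hs₁.base]
      · by_cases hy : y = x
        · subst hy; simp
        · have := Var.ctorIdx_injective.ne hy
          dsimp only
          rw [Store.setV_v_of_ne _ _ _ _ hy, update_of_ne (by simp only [Expr.regOf]; omega), hs₁.var y]
      · by_cases hy : y = x
        · subst hy; simpa using hw₁
        · simpa [hy] using hs.var_lt y
  | sto σ a i e hi he h =>
    obtain ⟨s₁, t₁, h₁, ht₁, hv₁, hw₁, hm₁, ho₁, hr₁⟩ := i.exec_comp hΓ 0 s hs hi
    have hs₁ := hs.congr hm₁ ho₁ fun r hr => hr₁ r (.inl hr)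
    obtain ⟨s₂, t₂, h₂, ht₂, hv₂, hw₂, hm₂, ho₂, hr₂⟩ := e.exec_comp hΓ 1 s₁ hs₁ he
    have hs₂ := hs₁.congr hm₂ ho₂ fun r hr => hr₂ r (.inl hr)
    have hi₂ : s₂.reg 1 = i.val Γ σ := by rw [hr₂ 1 (.inr (by omega)), ← hv₁]
    have ha := a.ctorIdx_lt
    have hsp := hΓ.space
    have hwd := hΓ.word
    refine ⟨_, _, .seq _ _ _ _ _ _ _ h₁ (.seq _ _ _ _ _ _ _ h₂ (.seq _ _ _ _ _ _ _
      (.set _ _ _ _ _ ?_) (.seq _ _ _ _ _ _ _ (.set _ _ _ _ _ ?_) (.seq _ _ _ _ _ _ _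
        (.set _ _ _ _ _ ?_) (.store _ _ _ ?_ ?_))))), by omega, ?_⟩
    · simp only [Op.eval, Arg.val, hi₂]; omega
    · simp only [Op.eval, Arg.val, hi₂, update_self]; omega
    · simp [Op.eval, Arg.val, hi₂, hs₂.base]; omega
    · simp [Op.eval, Arg.val, hi₂, hs₂.base]; omega
    · simpa [Arg.val, hv₂] using hw₂
    · refine ⟨?_, fun y => ?_, fun b r hr => ?_, fun r hr => ?_, hs₂.out, hs.var_lt,
        fun b r hr => ?_⟩
      · simp [hs₂.base]
      · simp only [update_idem]
        rw [update_of_ne (by simp only [Expr.regOf]; omega), hs₂.var, Store.setA_v]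
      · have hb := b.ctorIdx_lt
        simp only [Op.eval, Arg.val, hi₂, update_self, update_idem, ne_eq, zero_ne_one,
          not_false_eq_true, update_of_ne, OfNat.ofNat_ne_one]
        by_cases hab : b = a
        · subst hab
          rw [Store.setA_a_self]
          by_cases hri : r = i.val Γ σ
          · subst hri
            rw [hs₂.base, update_self, update_self]
            exact hv₂
          · rw [update_of_ne hri, update_of_ne (by rw [hs₂.base]; omega), hs₂.arr _ _ hr]
        · have := Arr.ctorIdx_injective.ne hab
          rw [Store.setA_a_of_ne _ _ _ _ _ hab, update_of_ne (by rw [hs₂.base]; omega), hs₂.arr _ _ hr]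
      · simp only [Op.eval, Arg.val, hi₂, update_self, update_idem, ne_eq, zero_ne_one,
          not_false_eq_true, update_of_ne, OfNat.ofNat_ne_one]
        rw [update_of_ne (by rw [hs₂.base]; omega), hs₂.inp _ hr]
      · by_cases hab : b = a
        · subst hab
          rw [Store.setA_a_self]
          by_cases hri : r = i.val Γ σ
          · subst hri; rwa [update_self]
          · rw [update_of_ne hri]; exact hs.arr_lt _ _ hr
        · rw [Store.setA_a_of_ne _ _ _ _ _ hab]; exact hs.arr_lt _ _ hr
  | emit σ e h =>
    obtain ⟨s₁, t₁, h₁, ht₁, hv₁, hw₁, hm₁, ho₁, hr₁⟩ := e.exec_comp hΓ 0 s hs h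
    have hs₁ := hs.congr hm₁ ho₁ fun r hr => hr₁ r (.inl hr)
    refine ⟨_, _, .seq _ _ _ _ _ _ _ h₁ (.emit _ _), by omega, ?_⟩
    refine ⟨hs₁.base, hs₁.var, hs₁.arr, hs₁.inp, ?_, hs.var_lt, hs.arr_lt⟩
    have hv : s₁.reg 1 = e.val Γ σ := hv₁
    simp [Arg.val, hs₁.out, hv]
  | seq c d σ σ' σ'' t t' hc hd ihc ihd =>
    obtain ⟨s₁, t₁, h₁, ht₁, hs₁⟩ := ihc s hs
    obtain ⟨s₂, t₂, h₂, ht₂, hs₂⟩ := ihd s₁ hs₁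
    exact ⟨_, _, .seq _ _ _ _ _ _ _ h₁ h₂, by omega, hs₂⟩
  | ite_true q c d σ σ' t hq h hc ih =>
    obtain ⟨s₁, t₁, h₁, ht₁, hv₁, hw₁, hm₁, ho₁, hr₁⟩ := q.exec_comp hΓ 0 s hs hq
    have hs₁ := hs.congr hm₁ ho₁ fun r hr => hr₁ r (.inl hr)
    obtain ⟨s₂, t₂, h₂, ht₂, hs₂⟩ := ih s₁ hs₁
    refine ⟨_, _, .seq _ _ _ _ _ _ _ h₁ (.ite_false _ _ _ _ _ _ ?_ h₂), by omega, hs₂⟩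
    simpa [Test.holds, Arg.val, ← hv₁] using h
  | ite_false q c d σ σ' t hq h hc ih =>
    obtain ⟨s₁, t₁, h₁, ht₁, hv₁, hw₁, hm₁, ho₁, hr₁⟩ := q.exec_comp hΓ 0 s hs hq
    have hs₁ := hs.congr hm₁ ho₁ fun r hr => hr₁ r (.inl hr)
    obtain ⟨s₂, t₂, h₂, ht₂, hs₂⟩ := ih s₁ hs₁
    refine ⟨_, _, .seq _ _ _ _ _ _ _ h₁ (.ite_true _ _ _ _ _ _ ?_ h₂), by omega, hs₂⟩
    simpa [Test.holds, Arg.val, ← hv₁] using h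
  | whl_true q c σ σ' σ'' t t' hq h hc hw ihc ihw =>
    obtain ⟨s₁, t₁, h₁, ht₁, hv₁, hw₁, hm₁, ho₁, hr₁⟩ := q.exec_comp hΓ 0 s hs hq
    have hs₁ := hs.congr hm₁ ho₁ fun r hr => hr₁ r (.inl hr)
    obtain ⟨s₂, t₂, h₂, ht₂, hs₂⟩ := ihc s₁ hs₁
    obtain ⟨s₃, t₃, h₃, ht₃, hs₃⟩ := ihw s₂ hs₂
    cases h₃ with
    | seq _ _ _ s₄ _ t₄ t₅ h₄ h₅ =>
      refine ⟨_, _, .seq _ _ _ _ _ _ _ h₁ (.loop_true _ _ _ _ _ _ _ ?_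
        (.seq _ _ _ _ _ _ _ h₂ h₄) h₅), by omega, hs₃⟩
      simp only [Test.holds, Arg.val]
      simp only [mul_zero, zero_add] at hv₁
      rw [hv₁]; omega
  | whl_false q c σ hq h =>
    obtain ⟨s₁, t₁, h₁, ht₁, hv₁, hw₁, hm₁, ho₁, hr₁⟩ := q.exec_comp hΓ 0 s hs hq
    have hs₁ := hs.congr hm₁ ho₁ fun r hr => hr₁ r (.inl hr)
    refine ⟨_, _, .seq _ _ _ _ _ _ _ h₁ (.loop_false _ _ _ ?_), by omega, hs₁⟩
    simp only [Test.holds, Arg.val]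
    simp only [mul_zero, zero_add] at hv₁
    rw [hv₁]; omega

/-! ### Verification with time credits -/

/-- With `T` units of time, the command `c`, started in `σ`, comes to an end, and the store and the
units that are left then satisfy `Q`. -/
def wp (Γ : Ctx) (c : Cmd) (Q : Store → ℕ → Prop) (σ : Store) (T : ℕ) : Prop :=
  ∃ σ' t, Big Γ c σ σ' t ∧ t ≤ T ∧ Q σ' (T - t)

variable {Q R : Store → ℕ → Prop} {T : ℕ} {q : Expr}

/-- Consequence, where the frame condition comes for free. -/
theorem wp_mono (h : wp Γ c Q σ T) (hQ : ∀ σ' T', Frame c σ σ' → Q σ' T' → R σ' T') :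
    wp Γ c R σ T := by
  obtain ⟨σ', t, hb, ht, hq⟩ := h
  exact ⟨σ', t, hb, ht, hQ _ _ hb.frame hq⟩

attribute [simp] Op.eval Expr.opOk Expr.val Expr.ok Expr.cost

theorem wp_skip (hT : 1 ≤ T) (h : Q σ (T - 1)) : wp Γ .skip Q σ T := ⟨_, _, .skip σ, hT, h⟩

theorem wp_asg {x : Var} {e : Expr} (z : ℕ)
    (hz : e.ok Γ σ ∧ e.val Γ σ = z ∧ e.cost + 1 ≤ T)
    (h : Q (σ.setV x z) (T - (e.cost + 1))) :
    wp Γ (.asg x e) Q σ T := by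
  obtain ⟨hok, rfl, hT⟩ := hz
  exact ⟨_, _, .asg σ x e hok, hT, h⟩

theorem wp_sto {a : Arr} {i e : Expr} (l z : ℕ)
    (hz : i.ok Γ σ ∧ e.ok Γ σ ∧ i.val Γ σ = l ∧ e.val Γ σ = z ∧ l < Γ.N ∧
      i.cost + e.cost + 4 ≤ T)
    (h : Q (σ.setA a l z) (T - (i.cost + e.cost + 4))) :
    wp Γ (.sto a i e) Q σ T := by
  obtain ⟨hi, he, rfl, rfl, hN, hT⟩ := hz
  exact ⟨_, _, .sto σ a i e hi he hN, hT, h⟩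

theorem wp_emit {e : Expr} (z : ℕ) (hz : e.ok Γ σ ∧ e.val Γ σ = z ∧ e.cost + 1 ≤ T)
    (h : Q (σ.put z) (T - (e.cost + 1))) :
    wp Γ (.emit e) Q σ T := by
  obtain ⟨hok, rfl, hT⟩ := hz
  exact ⟨_, _, .emit σ e hok, hT, h⟩

theorem wp_seq (h : wp Γ c (fun σ' T' => wp Γ d Q σ' T') σ T) : wp Γ (.seq c d) Q σ T := by
  obtain ⟨σ', t, hb, ht, σ'', t', hb', ht', hq⟩ := h
  exact ⟨σ'', t + t', .seq _ _ _ _ _ _ _ hb hb', by omega, by rwa [← Nat.sub_sub]⟩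

theorem wp_ite (hz : q.ok Γ σ ∧ q.cost + 1 ≤ T)
    (h₁ : q.val Γ σ ≠ 0 → wp Γ c Q σ (T - (q.cost + 1)))
    (h₂ : q.val Γ σ = 0 → wp Γ d Q σ (T - (q.cost + 1))) : wp Γ (.ite q c d) Q σ T := by
  obtain ⟨hok, hT⟩ := hz
  by_cases hq : q.val Γ σ = 0
  · obtain ⟨σ', t, hb, ht, h⟩ := h₂ hq
    exact ⟨σ', _, .ite_false _ _ _ _ _ _ hok hq hb, by omega, by rwa [← Nat.sub_sub]⟩
  · obtain ⟨σ', t, hb, ht, h⟩ := h₁ hq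
    exact ⟨σ', _, .ite_true _ _ _ _ _ _ hok hq hb, by omega, by rwa [← Nat.sub_sub]⟩

/-- The rule for loops.  Every test consumes time, so no further argument for termination is
needed; the invariant need not mention what the body cannot change. -/
theorem wp_whl (I : Store → ℕ → Prop) (h₀ : I σ T)
    (h : ∀ σ' T', Frame c σ σ' → I σ' T' → (q.ok Γ σ' ∧ q.cost + 1 ≤ T') ∧
      (q.val Γ σ' ≠ 0 → wp Γ c I σ' (T' - (q.cost + 1))) ∧
      (q.val Γ σ' = 0 → Q σ' (T' - (q.cost + 1)))) :
    wp Γ (.whl q c) Q σ T := by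
  suffices ∀ T' σ', Frame c σ σ' → I σ' T' → wp Γ (.whl q c) Q σ' T' from
    this T σ (.refl _ _) h₀
  intro T'
  induction T' using Nat.strong_induction_on with
  | _ T' ih =>
    intro σ' hf hI
    obtain ⟨⟨hok, hT⟩, hbody, hexit⟩ := h σ' T' hf hI
    by_cases hq : q.val Γ σ' = 0
    · exact ⟨σ', _, .whl_false _ _ _ hok hq, hT, hexit hq⟩
    · obtain ⟨σ₁, t₁, hb₁, ht₁, hI₁⟩ := hbody hq
      obtain ⟨σ₂, t₂, hb₂, ht₂, hQ⟩ := ih _ (by omega) σ₁ (hf.trans hb₁.frame) hI₁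
      refine ⟨σ₂, _, .whl_true _ _ _ _ _ _ _ hok hq hb₁ hb₂, by omega, ?_⟩
      rwa [← Nat.sub_sub, ← Nat.sub_sub]

end

open Cmd
open Greedy.Expr (arr inp)

-- The value of a variable as an expression.
scoped prefix:max "§" => Expr.var

/-! ### The input -/

/-- An instance of the problem: numbers of nodes and edges, `k`, the budget, and the ends of the
listed edges. -/
structure Inst where
  n : ℕ
  m : ℕ
  k : ℕ
  b : ℕ
  pa : ℕ → ℕ
  pb : ℕ → ℕ

/-- The context `Γ` holds the instance `P`, and its words are large enough for it. -/
structure Inst.Fits (P : Inst) (Γ : Ctx) : Prop where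
  pa_lt : ∀ e < P.m, P.pa e < P.n
  pb_lt : ∀ e < P.m, P.pb e < P.n
  m_pos : 1 ≤ P.m
  n_le : P.n ≤ 2 * P.m
  b_lt : P.b < P.n
  N : Γ.N = 2 * P.m + 2
  len : Γ.len = 4 + 2 * P.m
  inp_n : Γ.inp 0 = P.n
  inp_m : Γ.inp 1 = P.m
  inp_k : Γ.inp 2 = P.k
  inp_b : Γ.inp 3 = P.b
  inp_pa : ∀ e < P.m, Γ.inp (4 + 2 * e) = P.pa e
  inp_pb : ∀ e < P.m, Γ.inp (5 + 2 * e) = P.pb e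
  big : (4 * P.m + P.k + 16) ^ 4 < Γ.W

/-- The variables that are set once and for all; `base` is a radix `s` with `n ≤ s * s`. -/
structure Env (P : Inst) (s : ℕ) (σ : Store) : Prop where
  n : σ.v .n = P.n
  m : σ.v .m = P.m
  k : σ.v .k = P.k
  b : σ.v .b = P.b
  base : σ.v .base = s

theorem Env.frame {P : Inst} {s : ℕ} {σ σ' : Store} {c : Cmd} (h : Env P s σ) (hf : Frame c σ σ')
    (hc : (c.modV .n || c.modV .m || c.modV .k || c.modV .b || c.modV .base) = false) :
    Env P s σ' := by
  simp only [Bool.or_eq_false_iff] at hc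
  exact ⟨by rw [hf.v _ hc.1.1.1.1, h.n], by rw [hf.v _ hc.1.1.1.2, h.m],
    by rw [hf.v _ hc.1.1.2, h.k], by rw [hf.v _ hc.1.2, h.b], by rw [hf.v _ hc.2, h.base]⟩

/-- A product of two numbers of the size of the input fits into a word. -/
theorem Inst.Fits.mul_lt {P : Inst} {Γ : Ctx} (hP : P.Fits Γ) {x y : ℕ}
    (hx : x ≤ 4 * P.m + P.k + 16) (hy : y ≤ 4 * P.m + P.k + 16) :
    100 * (x * y + x + y) < Γ.W := by
  have := hP.big
  have h0 := hP.m_pos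
  generalize hB : 4 * P.m + P.k + 16 = B at *
  have h1 : x * y ≤ B * B := Nat.mul_le_mul hx hy
  have h3 : B * 20 ≤ B * B := Nat.mul_le_mul le_rfl (by omega)
  have h2 : B * B * (20 * 20) ≤ B * B * (B * B) :=
    Nat.mul_le_mul le_rfl (Nat.mul_le_mul (by omega) (by omega))
  have h4 : B ^ 4 = B * B * (B * B) := by ring
  omega

/-- The linear bounds on the size of words. -/
theorem Inst.Fits.lin {P : Inst} {Γ : Ctx} (hP : P.Fits Γ) :
    100 * (4 * P.m + P.k + 16) < Γ.W := by
  have := hP.mul_lt (Nat.zero_le _) le_rfl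
  simpa using this

/-- The first `c` entries of an array. -/
def pre (A : ℕ → ℕ) (c : ℕ) : List ℕ := (List.range c).map A

theorem mem_pre {A : ℕ → ℕ} {c z : ℕ} : z ∈ pre A c ↔ ∃ i < c, A i = z := by simp [pre]

@[simp] theorem pre_zero (A : ℕ → ℕ) : pre A 0 = [] := rfl

@[simp] theorem length_pre (A : ℕ → ℕ) (c : ℕ) : (pre A c).length = c := by simp [pre]

theorem pre_succ (A : ℕ → ℕ) (c : ℕ) : pre A (c + 1) = pre A c ++ [A c] := by
  simp [pre, List.range_succ]

theorem pre_congr {A B : ℕ → ℕ} {c : ℕ} (h : ∀ i < c, A i = B i) : pre A c = pre B c :=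
  List.map_congr_left fun i hi => h i (List.mem_range.1 hi)

theorem pre_update_of_le (A : ℕ → ℕ) {c i : ℕ} (z : ℕ) (h : c ≤ i) :
    pre (update A i z) c = pre A c :=
  pre_congr fun _ hj => update_of_ne (by omega) _ _

@[simp] theorem pre_update_succ (A : ℕ → ℕ) (c z : ℕ) :
    pre (update A c z) (c + 1) = pre A c ++ [z] := by
  rw [pre_succ, pre_update_of_le _ _ le_rfl, update_self]

theorem Env.setV {P : Inst} {s : ℕ} {σ : Store} (h : Env P s σ) {x : Var} {z : ℕ}
    (hx : (x = .n ∨ x = .m ∨ x = .k ∨ x = .b ∨ x = .base) = False) : Env P s (σ.setV x z) := by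
  simp only [eq_iff_iff, iff_false, not_or] at hx
  exact ⟨by rw [σ.setV_v_of_ne _ _ _ (Ne.symm hx.1), h.n],
    by rw [σ.setV_v_of_ne _ _ _ (Ne.symm hx.2.1), h.m],
    by rw [σ.setV_v_of_ne _ _ _ (Ne.symm hx.2.2.1), h.k],
    by rw [σ.setV_v_of_ne _ _ _ (Ne.symm hx.2.2.2.1), h.b],
    by rw [σ.setV_v_of_ne _ _ _ (Ne.symm hx.2.2.2.2), h.base]⟩

theorem Env.setA {P : Inst} {s : ℕ} {σ : Store} (h : Env P s σ) {a : Arr} {i z : ℕ} :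
    Env P s (σ.setA a i z) := ⟨h.n, h.m, h.k, h.b, h.base⟩

/-! ### The directed edges of the merged graph -/

/-- The root map after the merger of `v` into `u`. -/
def mergeRoot (r : ℕ → ℕ) (u v : ℕ) : ℕ → ℕ := fun z => if r z = v then u else r z

/-- The adjacency that results from the listed edges if every node is replaced by its root. -/
def Inst.Rel (P : Inst) (r : ℕ → ℕ) (x y : ℕ) : Prop :=
  x ≠ y ∧ ∃ e < P.m, (r (P.pa e) = x ∧ r (P.pb e) = y) ∨ (r (P.pa e) = y ∧ r (P.pb e) = x)

/-- Write all directed edges of the graph after the merger of `v` into `u`, as numbers `x * n + y`,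
possibly with repetitions. -/
def gen : Cmd :=
  .asg .cnt 0 ;; .asg .e 0 ;;
  .whl (.lt §.e §.m) (
    .asg .x (arr .root (inp (4 + 2 * §.e))) ;;
    .asg .x (.cond (.eq §.x §.v) §.u §.x) ;;
    .asg .y (arr .root (inp (5 + 2 * §.e))) ;;
    .asg .y (.cond (.eq §.y §.v) §.u §.y) ;;
    .ite (.eq §.x §.y) .skip (
      .sto .key §.cnt (§.x * §.n + §.y) ;;
      .sto .key (§.cnt + 1) (§.y * §.n + §.x) ;;
      .asg .cnt (§.cnt + 2)) ;;
    .asg .e (§.e + 1))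

theorem gen_spec {P : Inst} {Γ : Ctx} (hP : P.Fits Γ) {s : ℕ} {σ : Store} (hE : Env P s σ)
    {r : ℕ → ℕ} {u v : ℕ} (hr : σ.a .root = r) (hu : σ.v .u = u) (hv : σ.v .v = v)
    (hR : ∀ z < P.n, r z < P.n) (hun : u < P.n) {T : ℕ} (hT : 100 * (P.m + 1) ≤ T) :
    wp Γ gen (fun σ' T' => T ≤ T' + 100 * (P.m + 1) ∧ σ'.v .cnt ≤ 2 * P.m ∧
      ∀ z, z ∈ pre (σ'.a .key) (σ'.v .cnt) ↔
        ∃ x y, z = x * P.n + y ∧ P.Rel (mergeRoot r u v) x y) σ T := by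
  have hlin := hP.lin
  refine wp_seq <| wp_asg 0 ?_ <| wp_seq <| wp_asg 0 ?_ <|
    wp_whl (fun σ' T' => T ≤ T' + 100 * σ'.v .e + 20 ∧ σ'.v .e ≤ P.m ∧ σ'.v .cnt ≤ 2 * σ'.v .e ∧
      ∀ z, z ∈ pre (σ'.a .key) (σ'.v .cnt) ↔ ∃ x y, z = x * P.n + y ∧ x ≠ y ∧ ∃ e < σ'.v .e,
        (mergeRoot r u v (P.pa e) = x ∧ mergeRoot r u v (P.pb e) = y) ∨
        (mergeRoot r u v (P.pa e) = y ∧ mergeRoot r u v (P.pb e) = x)) ?_ ?_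
  · simp; omega
  · simp; omega
  · simp; omega
  · rintro σ' T' hf ⟨h1, h2, h3, h4⟩
    have hE' : Env P s σ' := ((hE.setV (by simp)).setV (by simp)).frame hf rfl
    have hr' : σ'.a .root = r := by simpa [hr] using hf.a .root rfl
    have hu' : σ'.v .u = u := by simpa [hu] using hf.v .u rfl
    have hv' : σ'.v .v = v := by simpa [hv] using hf.v .v rfl
    have hN := hP.N
    have hlen := hP.len
    have hnm := hP.n_le
    generalize hge : σ'.v .e = e at *
    generalize hgc : σ'.v .cnt = c at *
    refine ⟨by simp; omega, fun hq => ?_, fun hq => ?_⟩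
    · have he : e < P.m := by simpa [hE'.m, hge] using hq
      have ha := hP.inp_pa _ he
      have hb := hP.inp_pb _ he
      have ha' := hP.pa_lt _ he
      have hb' := hP.pb_lt _ he
      have hx' : mergeRoot r u v (P.pa e) < P.n := by
        simp only [mergeRoot]; split_ifs; exacts [hun, hR _ ha']
      have hy' : mergeRoot r u v (P.pb e) < P.n := by
        simp only [mergeRoot]; split_ifs; exacts [hun, hR _ hb']
      have hm := hP.mul_lt (x := mergeRoot r u v (P.pa e)) (y := P.n) (by omega) (by omega)
      have hm' := hP.mul_lt (x := mergeRoot r u v (P.pb e)) (y := P.n) (by omega) (by omega)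
      have hX : (if r (P.pa e) = v then u else r (P.pa e)) = mergeRoot r u v (P.pa e) := rfl
      have hY : (if r (P.pb e) = v then u else r (P.pb e)) = mergeRoot r u v (P.pb e) := rfl
      have h4' : ∀ z, (∃ x y, z = x * P.n + y ∧ x ≠ y ∧ ∃ e' < e + 1,
          (mergeRoot r u v (P.pa e') = x ∧ mergeRoot r u v (P.pb e') = y) ∨
          (mergeRoot r u v (P.pa e') = y ∧ mergeRoot r u v (P.pb e') = x)) ↔
          z ∈ pre (σ'.a .key) c ∨ mergeRoot r u v (P.pa e) ≠ mergeRoot r u v (P.pb e) ∧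
            (z = mergeRoot r u v (P.pa e) * P.n + mergeRoot r u v (P.pb e) ∨
             z = mergeRoot r u v (P.pb e) * P.n + mergeRoot r u v (P.pa e)) := by
        intro z
        rw [h4]
        constructor
        · rintro ⟨x, y, rfl, hxy, e', he', h⟩
          rcases Nat.lt_succ_iff_lt_or_eq.1 he' with he' | rfl
          · exact .inl ⟨x, y, rfl, hxy, e', he', h⟩
          · rcases h with ⟨rfl, rfl⟩ | ⟨rfl, rfl⟩
            · exact .inr ⟨hxy, .inl rfl⟩
            · exact .inr ⟨hxy.symm, .inr rfl⟩
        · rintro (⟨x, y, rfl, hxy, e', he', h⟩ | ⟨hne, rfl | rfl⟩)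
          · exact ⟨x, y, rfl, hxy, e', by omega, h⟩
          · exact ⟨_, _, rfl, hne, e, by omega, .inl ⟨rfl, rfl⟩⟩
          · exact ⟨_, _, rfl, hne.symm, e, by omega, .inr ⟨rfl, rfl⟩⟩
      generalize hgX : mergeRoot r u v (P.pa e) = X at hx' hy' hm hm' hX hY h4'
      generalize hgY : mergeRoot r u v (P.pb e) = Y at hx' hy' hm hm' hX hY h4'
      refine wp_seq <| wp_asg (r (P.pa e)) ?_ <| wp_seq <| wp_asg X ?_ <|
        wp_seq <| wp_asg (r (P.pb e)) ?_ <| wp_seq <| wp_asg Y ?_ <|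
        wp_seq <| wp_ite ?_ (fun hXY => wp_skip ?_ <| wp_asg (e + 1) ?_ ?_)
        (fun hXY => wp_seq <| wp_sto c (X * P.n + Y) ?_ <| wp_seq <| wp_sto (c + 1) (Y * P.n + X) ?_ <|
          wp_asg (c + 2) ?_ <| wp_asg (e + 1) ?_ ?_)
      any_goals
        simp [hge, hgc, hE'.n, hr', hu', hv', ha, hb, hX, hY] <;> omega
      · have hXY : X = Y := by simpa using hXY
        simp only [Store.setV_v_self, ne_eq, reduceCtorEq, not_false_eq_true, Store.setV_v_of_ne,
          Store.setV_a, h4', hgc, hXY]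
        simp; omega
      · have hXY : X ≠ Y := by simpa using hXY
        simp only [Store.setV_v_self, ne_eq, reduceCtorEq, not_false_eq_true, Store.setV_v_of_ne,
          Store.setV_a, h4', hgc, hXY, Store.setA_v, Store.setA_a_self]
        rw [show c + 2 = c + 1 + 1 from rfl]
        simp [or_assoc]; omega
    · have he : e = P.m := by have := by simpa [hE'.m, hge] using hq
                              omega
      refine ⟨by simp; omega, by omega, ?_⟩
      subst he
      simpa [Inst.Rel] using h4

/-! ### Radix sort -/

/-- The entries of `L` with `f`-value below `d`, by increasing `f`-value, otherwise in their old
order. -/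
def bucket (L : List ℕ) (f : ℕ → ℕ) (d : ℕ) : List ℕ :=
  (List.range d).flatMap fun d' => L.filter fun z => f z = d'

theorem bucket_succ (L : List ℕ) (f : ℕ → ℕ) (d : ℕ) :
    bucket L f (d + 1) = bucket L f d ++ L.filter fun z => f z = d := by
  simp [bucket, List.range_succ]

theorem mem_bucket {L : List ℕ} {f : ℕ → ℕ} {d z : ℕ} : z ∈ bucket L f d ↔ z ∈ L ∧ f z < d := by
  simp [bucket, and_comm]

theorem length_bucket (L : List ℕ) (f : ℕ → ℕ) (d : ℕ) :
    (bucket L f d).length = L.countP fun z => f z < d := by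
  induction d with
  | zero => simp [bucket]
  | succ d ih =>
    rw [bucket_succ, List.length_append, ih, ← List.countP_eq_length_filter]
    clear ih
    induction L with
    | nil => rfl
    | cons a L ih =>
      simp only [List.countP_cons, ← ih, decide_eq_true_eq]
      split_ifs <;> omega

/-- Stability: sorting by the next digit keeps the order by the lower digits. -/
theorem pairwise_bucket {L : List ℕ} {D s : ℕ} (hD : 0 < D) (h : L.Pairwise fun z z' => z % D ≤ z' % D) (d : ℕ) :
    (bucket L (fun z => z / D % s) d).Pairwise fun z z' => z % (D * s) ≤ z' % (D * s) := by
  induction d with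
  | zero => simp [bucket]
  | succ d ih =>
    rw [bucket_succ, List.pairwise_append]
    refine ⟨ih, (h.filter _).imp_of_mem ?_, ?_⟩
    · intro z z' hz hz' hzz
      simp only [List.mem_filter, decide_eq_true_eq] at hz hz'
      rw [Nat.mod_mul, Nat.mod_mul, hz.2, hz'.2]
      omega
    · intro z hz z' hz'
      simp only [List.mem_filter, decide_eq_true_eq] at hz'
      rw [mem_bucket] at hz
      rw [Nat.mod_mul, Nat.mod_mul, hz'.2]
      have := Nat.mod_lt z hD
      have h1 : D * (z / D % s + 1) ≤ D * d := Nat.mul_le_mul le_rfl hz.2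
      rw [mul_add] at h1
      omega

/-- Append the keys with digit `d` to the buffer. -/
def digitScan : Cmd :=
  .asg .i 0 ;; .whl (.lt §.i §.cnt) (
    .asg .z (arr .key §.i) ;;
    .ite (.eq (§.z / §.pw % §.base) §.d) (.sto .buf §.c §.z ;; .asg .c (§.c + 1)) .skip ;;
    .asg .i (§.i + 1))

/-- Copy the buffer back. -/
def copyBack : Cmd :=
  .asg .i 0 ;; .whl (.lt §.i §.cnt) (.sto .key §.i (arr .buf §.i) ;; .asg .i (§.i + 1))

/-- Sort the keys by one digit.  There are no counters for the digits: all keys are scanned once for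
each of the `base` many values of the digit. -/
def digitPass : Cmd :=
  .asg .c 0 ;; .asg .d 0 ;; .whl (.lt §.d §.base) (digitScan ;; .asg .d (§.d + 1)) ;; copyBack

/-- Sort the keys by four digits, from the lowest to the highest.  Keys are below `n ^ 2`, and
`n ≤ base ^ 2`, so four digits are enough. -/
def radixSort : Cmd :=
  .asg .p 0 ;; .asg .pw 1 ;;
  .whl (.lt §.p 4) (digitPass ;; .asg .pw (§.pw * §.base) ;; .asg .p (§.p + 1))

section

variable {P : Inst} {Γ : Ctx} {s M D T : ℕ} {σ : Store} {A : ℕ → ℕ}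

theorem digitScan_spec (hP : P.Fits Γ) (hE : Env P s σ) (hM : σ.v .cnt = M) (hM' : M ≤ 2 * P.m)
    (hD : σ.v .pw = D) {d : ℕ} (hd : σ.v .d = d) (hA : σ.a .key = A) {B : List ℕ}
    (hB : pre (σ.a .buf) (σ.v .c) = B)
    (hl : B.length + ((pre A M).filter fun z => z / D % s = d).length ≤ M)
    (hT : 40 * (M + 1) ≤ T) :
    wp Γ digitScan (fun σ' T' => T ≤ T' + 40 * (M + 1) ∧
      pre (σ'.a .buf) (σ'.v .c) = B ++ (pre A M).filter fun z => z / D % s = d) σ T := by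
  have hlin := hP.lin
  refine wp_seq <| wp_asg 0 ?_ <| wp_whl (fun σ' T' => T ≤ T' + 40 * σ'.v .i + 10 ∧ σ'.v .i ≤ M ∧
    pre (σ'.a .buf) (σ'.v .c) = B ++ (pre A (σ'.v .i)).filter fun z => z / D % s = d) ?_ ?_
  · simp; omega
  · simp [hB]; omega
  · rintro σ' T' hf ⟨h1, h2, h3⟩
    have hE' : Env P s σ' := (hE.setV (by simp)).frame hf rfl
    have hM₁ : σ'.v .cnt = M := by simpa [hM] using hf.v .cnt rfl
    have hD₁ : σ'.v .pw = D := by simpa [hD] using hf.v .pw rfl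
    have hd₁ : σ'.v .d = d := by simpa [hd] using hf.v .d rfl
    have hA₁ : σ'.a .key = A := by simpa [hA] using hf.a .key rfl
    have hN := hP.N
    generalize hgi : σ'.v .i = i at *
    generalize hgc : σ'.v .c = c at *
    refine ⟨by simp; omega, fun hq => ?_, fun hq => ?_⟩
    · have hi : i < M := by simpa [hM₁, hgi] using hq
      have hc : c = (B ++ (pre A i).filter fun z => z / D % s = d).length := by
        rw [← h3, length_pre]
      rw [List.length_append] at hc
      have hle : ((pre A (i + 1)).filter fun z => z / D % s = d).length ≤
          ((pre A M).filter fun z => z / D % s = d).length := by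
        refine (List.Sublist.filter _ ?_).length_le
        exact (List.range_sublist.2 (by omega)).map A
      rw [pre_succ, List.filter_append, List.length_append] at hle
      have hle' : A i / D % s = d → c + 1 ≤ M := fun hz => by
        rw [List.filter_cons_of_pos (by simpa using hz), List.length_cons] at hle; omega
      refine wp_seq <| wp_asg (A i) ?_ <| wp_seq <| wp_ite ?_
        (fun hz => wp_seq <| wp_sto c (A i) ?_ <| wp_asg (c + 1) ?_ <| wp_asg (i + 1) ?_ ?_)
        (fun hz => wp_skip ?_ <| wp_asg (i + 1) ?_ ?_)
      all_goals try have hz' : A i / D % s = d := by simpa [hE'.base, hD₁, hd₁] using hz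
      all_goals try have hc1 := hle' hz'
      all_goals try have hz' : ¬ A i / D % s = d := by simpa [hE'.base, hD₁, hd₁] using hz
      any_goals
        simp [hgi, hgc, hA₁, hM₁, hE'.base, hD₁, hd₁]; omega
      · simp [hz', pre_update_of_le, h3, pre_succ]; omega
      · simp [hz', hgc, h3, pre_succ]; omega
    · have hi : i = M := by
        have : ¬ i < M := by simpa [hM₁, hgi] using hq
        omega
      subst hi
      exact ⟨by simp; omega, h3⟩

theorem copyBack_spec (hP : P.Fits Γ) (hM : σ.v .cnt = M) (hM' : M ≤ 2 * P.m)
    (hT : 40 * (M + 1) ≤ T) :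
    wp Γ copyBack (fun σ' T' => T ≤ T' + 40 * (M + 1) ∧ pre (σ'.a .key) M = pre (σ.a .buf) M)
      σ T := by
  have hlin := hP.lin
  refine wp_seq <| wp_asg 0 ?_ <| wp_whl (fun σ' T' => T ≤ T' + 40 * σ'.v .i + 10 ∧ σ'.v .i ≤ M ∧
    ∀ i < σ'.v .i, σ'.a .key i = σ.a .buf i) ?_ ?_
  · simp; omega
  · simp; omega
  · rintro σ' T' hf ⟨h1, h2, h3⟩
    have hM₁ : σ'.v .cnt = M := by simpa [hM] using hf.v .cnt rfl
    have hA₁ : σ'.a .buf = σ.a .buf := by simpa using hf.a .buf rfl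
    have hN := hP.N
    generalize hgi : σ'.v .i = i at *
    refine ⟨by simp; omega, fun hq => ?_, fun hq => ?_⟩
    · have hi : i < M := by simpa [hM₁, hgi] using hq
      refine wp_seq <| wp_sto i (σ.a .buf i) ?_ <| wp_asg (i + 1) ?_ ?_
      · simp [hgi, hA₁]; omega
      · simp [hgi]; omega
      · refine ⟨by simp; omega, by simpa using hi, fun j hj => ?_⟩
        have hj : j < i + 1 := by simpa using hj
        rcases Nat.lt_succ_iff_lt_or_eq.1 hj with hj | rfl
        · simpa [update_of_ne hj.ne] using h3 j hj
        · simp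
    · have hi : i = M := by
        have : ¬ i < M := by simpa [hM₁, hgi] using hq
        omega
      subst hi
      exact ⟨by simp; omega, pre_congr h3⟩

theorem digitPass_spec (hP : P.Fits Γ) (hE : Env P s σ) (hM : σ.v .cnt = M) (hM' : M ≤ 2 * P.m)
    (hs : 1 ≤ s) (hs' : s ≤ P.n) (hD : σ.v .pw = D) (hA : σ.a .key = A)
    (hT : 100 * (M + 1) * (s + 1) ≤ T) :
    wp Γ digitPass (fun σ' T' => T ≤ T' + 100 * (M + 1) * (s + 1) ∧
      pre (σ'.a .key) M = bucket (pre A M) (fun z => z / D % s) s) σ T := by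
  have hlin := hP.lin
  have hnm := hP.n_le
  have hlb : (bucket (pre A M) (fun z => z / D % s) s).length = M := by
    rw [length_bucket]
    conv_rhs => rw [← length_pre A M]
    rw [List.countP_eq_length]
    intro z _
    simpa using Nat.mod_lt _ (by omega)
  have hT1 : 100 * (M + 1) * (s + 1) = 50 * ((M + 1) * s) + 50 * ((M + 1) * s) + 100 * (M + 1) := by
    ring
  have hs2 : 1 * s ≤ (M + 1) * s := Nat.mul_le_mul (by omega) le_rfl
  have hs3 : (M + 1) * 1 ≤ (M + 1) * s := Nat.mul_le_mul le_rfl hs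
  obtain ⟨K, hK⟩ : ∃ K, K = 40 * (M + 1) + 20 := ⟨_, rfl⟩
  refine wp_seq <| wp_asg 0 ?_ <| wp_seq <| wp_asg 0 ?_ <| wp_seq <|
    wp_whl (fun σ' T' => T ≤ T' + K * σ'.v .d + 10 ∧ σ'.v .d ≤ s ∧
      pre (σ'.a .buf) (σ'.v .c) = bucket (pre A M) (fun z => z / D % s) (σ'.v .d)) ?_ ?_
  · simp; omega
  · simp; omega
  · simp [bucket]; omega
  · rintro σ' T' hf ⟨h1, h2, h3⟩
    have hE' : Env P s σ' := ((hE.setV (by simp)).setV (by simp)).frame hf rfl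
    have hM₁ : σ'.v .cnt = M := by simpa [hM] using hf.v .cnt rfl
    have hD₁ : σ'.v .pw = D := by simpa [hD] using hf.v .pw rfl
    have hA₁ : σ'.a .key = A := by simpa [hA] using hf.a .key rfl
    generalize hgd : σ'.v .d = d at *
    have hdd : K * d ≤ 50 * ((M + 1) * s) + 50 * ((M + 1) * s) := by
      calc K * d ≤ K * s := Nat.mul_le_mul le_rfl h2
        _ = 40 * ((M + 1) * s) + 20 * s := by rw [hK]; ring
        _ ≤ _ := by omega
    refine ⟨by simp; omega, fun hq => ?_, fun hq => ?_⟩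
    · have hd : d < s := by simpa [hE'.base, hgd] using hq
      have hdd' : K * (d + 1) ≤ 50 * ((M + 1) * s) + 50 * ((M + 1) * s) := by
        calc K * (d + 1) ≤ K * s := Nat.mul_le_mul le_rfl hd
          _ = 40 * ((M + 1) * s) + 20 * s := by rw [hK]; ring
          _ ≤ _ := by omega
      rw [mul_add] at hdd'
      refine wp_seq <| wp_mono (digitScan_spec hP hE' hM₁ hM' hD₁ hgd hA₁ h3 ?_ ?_) ?_
      · rw [← List.length_append]
        have := bucket_succ (pre A M) (fun z => z / D % s) d
        rw [← this, length_bucket]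
        exact List.countP_le_length.trans (length_pre A M).le
      · simp; omega
      · rintro σ₂ T₂ hf₂ ⟨h4, h5⟩
        have hd₂ : σ₂.v .d = d := by rw [hf₂.v .d rfl, hgd]
        simp at h4
        refine wp_asg (d + 1) ?_ ?_
        · simp [hd₂]; omega
        · refine ⟨?_, by simpa using hd, ?_⟩
          · simp [mul_add]; omega
          · simp [h5, bucket_succ]
    · have hd : d = s := by
        have : ¬ d < s := by simpa [hE'.base, hgd] using hq
        omega
      refine wp_mono (copyBack_spec hP hM₁ hM' ?_) ?_
      · simp; omega
      · rintro σ₂ T₂ hf₂ ⟨h4, h5⟩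
        simp at h4
        refine ⟨by omega, ?_⟩
        rw [hd] at h3
        have hc : σ'.v .c = M := by rw [← hlb, ← h3, length_pre]
        rw [h5, ← h3, hc]

theorem radixSort_spec (hP : P.Fits Γ) (hE : Env P s σ) (hM : σ.v .cnt = M) (hM' : M ≤ 2 * P.m)
    (hs : 1 ≤ s) (hs' : s ≤ P.n) (hns : P.n ≤ s * s)
    (hA : ∀ z ∈ pre (σ.a .key) M, z < P.n * P.n) (hT : 500 * (M + 1) * (s + 1) ≤ T) :
    wp Γ radixSort (fun σ' T' => T ≤ T' + 500 * (M + 1) * (s + 1) ∧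
      (pre (σ'.a .key) M).Pairwise (· ≤ ·) ∧
      ∀ z, z ∈ pre (σ'.a .key) M ↔ z ∈ pre (σ.a .key) M) σ T := by
  have hlin := hP.lin
  have hnm := hP.n_le
  have hT1 : 500 * (M + 1) * (s + 1) = 500 * ((M + 1) * (s + 1)) := by ring
  have hT2 : 100 * (M + 1) * (s + 1) = 100 * ((M + 1) * (s + 1)) := by ring
  have hT3 : 1 * (1 + 1) ≤ (M + 1) * (s + 1) := Nat.mul_le_mul (by omega) (by omega)
  refine wp_seq <| wp_asg 0 ?_ <| wp_seq <| wp_asg 1 ?_ <|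
    wp_whl (fun σ' T' => T ≤ T' + (100 * ((M + 1) * (s + 1)) + 20) * σ'.v .p + 10 ∧ σ'.v .p ≤ 4 ∧
      σ'.v .pw = s ^ σ'.v .p ∧
      (pre (σ'.a .key) M).Pairwise (fun z z' => z % s ^ σ'.v .p ≤ z' % s ^ σ'.v .p) ∧
      ∀ z, z ∈ pre (σ'.a .key) M ↔ z ∈ pre (σ.a .key) M) ?_ ?_
  · simp; omega
  · simp; omega
  · simp [Nat.mod_one, List.pairwise_iff_forall_sublist]; omega
  · rintro σ' T' hf ⟨h1, h2, h3, h4, h5⟩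
    have hE' : Env P s σ' := ((hE.setV (by simp)).setV (by simp)).frame hf rfl
    have hM₁ : σ'.v .cnt = M := by simpa [hM] using hf.v .cnt rfl
    generalize hgp : σ'.v .p = p at *
    generalize hX : (M + 1) * (s + 1) = X at *
    have hXp : (100 * X + 20) * p ≤ (100 * X + 20) * 4 := Nat.mul_le_mul le_rfl h2
    refine ⟨by simp; omega, fun hq => ?_, fun hq => ?_⟩
    · have hp : p < 4 := by simpa [hgp] using hq
      have hXp' : (100 * X + 20) * (p + 1) ≤ (100 * X + 20) * 4 := Nat.mul_le_mul le_rfl hp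
      rw [mul_add] at hXp'
      have hW : s ^ p * s < Γ.W := by
        calc s ^ p * s = s ^ (p + 1) := (pow_succ _ _).symm
          _ ≤ s ^ 4 := Nat.pow_le_pow_right hs hp
          _ ≤ (4 * P.m + P.k + 16) ^ 4 := Nat.pow_le_pow_left (by omega) _
          _ < _ := hP.big
      refine wp_seq <| wp_mono (digitPass_spec hP hE' hM₁ hM' hs hs' h3 rfl ?_) ?_
      · simp; omega
      · rintro σ₂ T₂ hf₂ ⟨h6, h7⟩
        have hp₂ : σ₂.v .p = p := by rw [hf₂.v .p rfl, hgp]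
        have hpw₂ : σ₂.v .pw = s ^ p := by rw [hf₂.v .pw rfl, h3]
        have hE₂ := hE'.frame hf₂ rfl
        simp at h6
        refine wp_seq <| wp_asg (s ^ p * s) ?_ <| wp_asg (p + 1) ?_ ?_
        · simp [hpw₂, hE₂.base]; omega
        · simp [hp₂]; omega
        · refine ⟨?_, by simpa using hp, by simp [pow_succ], ?_, ?_⟩
          · simp [mul_add]; omega
          · simpa [h7, pow_succ] using pairwise_bucket (Nat.pow_pos hs) h4 s
          · intro z
            rw [← h5]
            simp only [Store.setV_a, h7, mem_bucket, and_iff_left_iff_imp]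
            exact fun _ => Nat.mod_lt _ hs
    · have hp : p = 4 := by
        have : ¬ p < 4 := by simpa [hgp] using hq
        omega
      refine ⟨by simp; omega, ?_, h5⟩
      subst hp
      refine h4.imp_of_mem fun {z z'} hz hz' hzz => ?_
      have hlt : ∀ z ∈ pre (σ'.a .key) M, z < s ^ 4 := fun z hz => by
        calc z < P.n * P.n := hA z ((h5 z).1 hz)
          _ ≤ (s * s) * (s * s) := Nat.mul_le_mul hns hns
          _ = s ^ 4 := by ring
      rwa [Nat.mod_eq_of_lt (hlt z hz), Nat.mod_eq_of_lt (hlt z' hz')] at hzz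

end

/-! ### Sorted adjacency lists -/

/-- The first `M` entries of `Y` are the directed edges `x * n + y` of a graph on the nodes below `n`
with adjacency `Adj`, in increasing order.  A position below `M` is called a slot. -/
structure Keys (n M : ℕ) (Y : ℕ → ℕ) (Adj : ℕ → ℕ → Prop) : Prop where
  mono : ∀ i j, i < j → j < M → Y i < Y j
  mem : ∀ z, (∃ i < M, Y i = z) ↔ ∃ x y, z = x * n + y ∧ Adj x y
  symm : ∀ x y, Adj x y → Adj y x
  irrefl : ∀ x, ¬ Adj x x
  lt : ∀ x y, Adj x y → x < n

/-- The key of the reversed edge. -/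
def swapKey (n z : ℕ) : ℕ := z % n * n + z / n

namespace Keys

variable {n M : ℕ} {Y : ℕ → ℕ} {Adj : ℕ → ℕ → Prop}

theorem lt' (h : Keys n M Y Adj) {x y : ℕ} (hxy : Adj x y) : y < n := h.lt y x (h.symm x y hxy)

theorem div_eq (h : Keys n M Y Adj) {x y : ℕ} (hxy : Adj x y) : (x * n + y) / n = x := by
  have := h.lt' hxy
  rw [mul_comm, Nat.mul_add_div (by omega), Nat.div_eq_of_lt this, add_zero]

theorem mod_eq (h : Keys n M Y Adj) {x y : ℕ} (hxy : Adj x y) : (x * n + y) % n = y := by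
  rw [mul_comm, Nat.mul_add_mod, Nat.mod_eq_of_lt (h.lt' hxy)]

theorem adj (h : Keys n M Y Adj) {p : ℕ} (hp : p < M) : Adj (Y p / n) (Y p % n) := by
  obtain ⟨x, y, he, hxy⟩ := (h.mem _).1 ⟨p, hp, rfl⟩
  rwa [he, h.div_eq hxy, h.mod_eq hxy]

theorem eq_key (n z : ℕ) : z = z / n * n + z % n := by rw [mul_comm, Nat.div_add_mod]

theorem exists_slot (h : Keys n M Y Adj) {x y : ℕ} (hxy : Adj x y) :
    ∃ p < M, Y p = x * n + y ∧ Y p / n = x ∧ Y p % n = y := by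
  obtain ⟨p, hp, he⟩ := (h.mem _).2 ⟨x, y, rfl, hxy⟩
  exact ⟨p, hp, he, by rw [he, h.div_eq hxy], by rw [he, h.mod_eq hxy]⟩

theorem le (h : Keys n M Y Adj) {p q : ℕ} (hpq : p ≤ q) (hq : q < M) : Y p ≤ Y q := by
  rcases hpq.lt_or_eq with hpq | rfl
  exacts [(h.mono p q hpq hq).le, le_rfl]

theorem lt_iff (h : Keys n M Y Adj) {p q : ℕ} (hp : p < M) (hq : q < M) : Y p < Y q ↔ p < q :=
  ⟨fun hpq => by by_contra hle; exact absurd (h.le (not_lt.1 hle) hp) (by omega),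
    fun hpq => h.mono p q hpq hq⟩

theorem inj (h : Keys n M Y Adj) {p q : ℕ} (hp : p < M) (hq : q < M) (he : Y p = Y q) : p = q := by
  rcases lt_trichotomy p q with hlt | rfl | hlt
  · exact absurd (h.mono p q hlt hq) (by omega)
  · rfl
  · exact absurd (h.mono q p hlt hp) (by omega)

theorem exists_swap (h : Keys n M Y Adj) {p : ℕ} (hp : p < M) :
    ∃ q < M, Y q = swapKey n (Y p) ∧ Y q / n = Y p % n ∧ Y q % n = Y p / n :=
  h.exists_slot (h.symm _ _ (h.adj hp))

theorem swapKey_swapKey (h : Keys n M Y Adj) {p : ℕ} (hp : p < M) :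
    swapKey n (swapKey n (Y p)) = Y p := by
  have h1 := h.symm _ _ (h.adj hp)
  rw [swapKey, swapKey, h.div_eq h1, h.mod_eq h1, ← eq_key]

end Keys

/-- `lo x` and `hi x` are the ends of the row of `x`, the interval of the slots of edges that start
at `x`, for every `x` that has such slots. -/
structure Rows (n M : ℕ) (Y lo hi : ℕ → ℕ) : Prop where
  lo_le : ∀ p < M, lo (Y p / n) ≤ p
  lt_hi : ∀ p < M, p < hi (Y p / n)
  hi_le : ∀ p < M, hi (Y p / n) ≤ M
  row : ∀ p < M, ∀ q, lo (Y p / n) ≤ q → q < hi (Y p / n) → Y q / n = Y p / n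

/-- Remove the repetitions from the sorted keys. -/
def dedupe : Cmd :=
  .asg .c 0 ;; .asg .i 0 ;; .whl (.lt §.i §.cnt) (
    .asg .z (arr .key §.i) ;;
    .ite (.cond (.eq §.c 0) 1 (.lt (arr .buf (§.c - 1)) §.z))
      (.sto .buf §.c §.z ;; .asg .c (§.c + 1)) .skip ;;
    .asg .i (§.i + 1)) ;;
  .asg .size §.c

/-- Find the ends of the rows, and set the cursors to their first slots. -/
def findRows : Cmd :=
  .asg .p 0 ;; .whl (.lt §.p §.size) (
    .asg .x (arr .buf §.p / §.n) ;;
    .ite (.cond (.eq §.p 0) 0 (.eq (arr .buf (§.p - 1) / §.n) §.x)) .skip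
      (.sto .lo §.x §.p ;; .sto .cur §.x §.p) ;;
    .sto .hi §.x (§.p + 1) ;;
    .asg .p (§.p + 1))

/-- Assign to every slot the slot of the same edge in the direction from the smaller to the larger
node.  The reversed edges turn up in the rows in increasing order, so a cursor in every row finds
them. -/
def identify : Cmd :=
  .asg .p 0 ;; .whl (.lt §.p §.size) (
    .asg .x (arr .buf §.p / §.n) ;;
    .asg .y (arr .buf §.p % §.n) ;;
    .asg .z (arr .cur §.y) ;;
    .sto .cur §.y (§.z + 1) ;;
    .sto .ident §.p (.cond (.lt §.x §.y) §.p §.z) ;;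
    .asg .p (§.p + 1))

section

variable {P : Inst} {Γ : Ctx} {s M D T : ℕ} {σ : Store} {A : ℕ → ℕ}

theorem dedupe_spec (hP : P.Fits Γ) (hM : σ.v .cnt = M) (hM' : M ≤ 2 * P.m) (hA : σ.a .key = A)
    (hsort : (pre A M).Pairwise (· ≤ ·)) (hT : 60 * (M + 1) ≤ T) :
    wp Γ dedupe (fun σ' T' => T ≤ T' + 60 * (M + 1) ∧ σ'.v .size ≤ M ∧
      (∀ i j, i < j → j < σ'.v .size → σ'.a .buf i < σ'.a .buf j) ∧
      ∀ z, (∃ i < σ'.v .size, σ'.a .buf i = z) ↔ z ∈ pre A M) σ T := by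
  have hlin := hP.lin
  have hsort' : ∀ i j, i < j → j < M → A i ≤ A j := fun i j hij hj => by
    have := List.pairwise_iff_getElem.1 hsort i j (by simp; omega) (by simpa using hj) hij
    simpa [pre] using this
  refine wp_seq <| wp_asg 0 ?_ <| wp_seq <| wp_asg 0 ?_ <| wp_seq <|
    wp_whl (fun σ' T' => T ≤ T' + 50 * σ'.v .i + 10 ∧ σ'.v .i ≤ M ∧ σ'.v .c ≤ σ'.v .i ∧
      (∀ i j, i < j → j < σ'.v .c → σ'.a .buf i < σ'.a .buf j) ∧
      ∀ z, (∃ i < σ'.v .c, σ'.a .buf i = z) ↔ ∃ i < σ'.v .i, A i = z) ?_ ?_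
  · simp; omega
  · simp; omega
  · simp; omega
  · rintro σ' T' hf ⟨h1, h2, h3, h4, h5⟩
    have hM₁ : σ'.v .cnt = M := by simpa [hM] using hf.v .cnt rfl
    have hA₁ : σ'.a .key = A := by simpa [hA] using hf.a .key rfl
    have hN := hP.N
    generalize hgi : σ'.v .i = i at *
    generalize hgc : σ'.v .c = c at *
    generalize hgb : σ'.a .buf = Y at *
    refine ⟨by simp; omega, fun hq => ?_, fun hq => ?_⟩
    · have hi : i < M := by simpa [hM₁, hgi] using hq
      refine wp_seq <| wp_asg (A i) ?_ <| wp_seq <| wp_ite ?_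
        (fun hz => wp_seq <| wp_sto c (A i) ?_ <| wp_asg (c + 1) ?_ <| wp_asg (i + 1) ?_ ?_)
        (fun hz => wp_skip ?_ <| wp_asg (i + 1) ?_ ?_)
      any_goals
        simp [hgi, hgc, hgb, hA₁, hM₁]; omega
      · have hz' : c = 0 ∨ Y (c - 1) < A i := by
          by_contra! hcon
          simp [hgb, hgc, hcon] at hz
        have hY : ∀ j < c, Y j < A i := fun j hj => by
          rcases hz' with rfl | hz'
          · omega
          · rcases Nat.lt_or_ge j (c - 1) with hlt | hge
            · exact (h4 _ _ hlt (by omega)).trans hz'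
            · rwa [show j = c - 1 by omega]
        refine ⟨by simp; omega, by simpa using hi, by simpa using h3, ?_, ?_⟩
        · intro j l hjl hl
          have hl : l < c + 1 := by simpa using hl
          rcases Nat.lt_succ_iff_lt_or_eq.1 hl with hl | rfl
          · simpa [hgb, update_of_ne, show j ≠ c by omega, show l ≠ c by omega] using h4 j l hjl hl
          · simpa [hgb, update_of_ne, hjl.ne] using hY j hjl
        · intro z
          have h6 : ∀ B : ℕ → ℕ, ∀ c, (∃ i < c + 1, B i = z) ↔ (∃ i < c, B i = z) ∨ B c = z := by
            intro B c
            simp only [Nat.lt_succ_iff_lt_or_eq, or_and_right, exists_or, exists_eq_left]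
          simp only [Store.setV_v_self, ne_eq, reduceCtorEq, not_false_eq_true, Store.setV_v_of_ne,
            Store.setV_a, Store.setA_v, Store.setA_a_self, h6, update_self, ← h5, hgb]
          refine or_congr_left ⟨fun ⟨j, hj, he⟩ => ⟨j, hj, ?_⟩, fun ⟨j, hj, he⟩ => ⟨j, hj, ?_⟩⟩
          · rwa [update_of_ne hj.ne] at he
          · rwa [update_of_ne hj.ne]
      · have hz' : c ≠ 0 ∧ A i ≤ Y (c - 1) := by
          constructor
          · rintro rfl
            simp [hgc] at hz
          · by_contra! hcon
            by_cases hc : c = 0 <;> simp [hgb, hgc, hcon, hc] at hz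
        refine ⟨by simp; omega, by simpa using hi, by simp; omega, ?_, ?_⟩
        · simpa [hgb, hgc] using h4
        · intro z
          simp only [Store.setV_v_self, ne_eq, reduceCtorEq, not_false_eq_true, Store.setV_v_of_ne,
            Store.setV_a, h5, hgb, hgc]
          constructor
          · rintro ⟨j, hj, he⟩
            exact ⟨j, by omega, he⟩
          · rintro ⟨j, hj, he⟩
            rcases Nat.lt_succ_iff_lt_or_eq.1 hj with hj | rfl
            · exact ⟨j, hj, he⟩
            · obtain ⟨l, hl, hle⟩ := (h5 (Y (c - 1))).1 ⟨c - 1, by omega, rfl⟩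
              exact ⟨l, hl, by have := hsort' _ _ hl hi; omega⟩
    · have hi : i = M := by
        have : ¬ i < M := by simpa [hM₁, hgi] using hq
        omega
      subst hi
      refine wp_asg c ?_ ⟨?_, ?_, ?_, ?_⟩
      · simp [hgc]; omega
      · simp; omega
      · simpa using h3
      · simpa [hgb] using h4
      · simpa [hgb, mem_pre] using h5

theorem findRows_spec (hP : P.Fits Γ) (hE : Env P s σ) {Y : ℕ → ℕ} {Adj : ℕ → ℕ → Prop}
    (hK : Keys P.n M Y Adj) (hM : σ.v .size = M) (hM' : M ≤ 2 * P.m) (hY : σ.a .buf = Y)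
    (hT : 80 * (M + 1) ≤ T) :
    wp Γ findRows (fun σ' T' => T ≤ T' + 80 * (M + 1) ∧ Rows P.n M Y (σ'.a .lo) (σ'.a .hi) ∧
      ∀ p < M, σ'.a .cur (Y p / P.n) = σ'.a .lo (Y p / P.n)) σ T := by
  have hlin := hP.lin
  have hnm := hP.n_le
  refine wp_seq <| wp_asg 0 ?_ <| wp_whl (fun σ' T' => T ≤ T' + 70 * σ'.v .p + 10 ∧ σ'.v .p ≤ M ∧
    ∀ q < σ'.v .p, σ'.a .lo (Y q / P.n) ≤ q ∧ q < σ'.a .hi (Y q / P.n) ∧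
      σ'.a .hi (Y q / P.n) ≤ σ'.v .p ∧ σ'.a .cur (Y q / P.n) = σ'.a .lo (Y q / P.n) ∧
      ∀ r, σ'.a .lo (Y q / P.n) ≤ r → r < σ'.a .hi (Y q / P.n) → Y r / P.n = Y q / P.n) ?_ ?_
  · simp; omega
  · simp; omega
  · rintro σ' T' hf ⟨h1, h2, h3⟩
    have hE' : Env P s σ' := (hE.setV (by simp)).frame hf rfl
    have hM₁ : σ'.v .size = M := by simpa [hM] using hf.v .size rfl
    have hY₁ : σ'.a .buf = Y := by simpa [hY] using hf.a .buf rfl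
    have hN := hP.N
    generalize hgp : σ'.v .p = p at *
    generalize hgl : σ'.a .lo = lo at *
    generalize hgh : σ'.a .hi = hi at *
    generalize hgc : σ'.a .cur = cur at *
    refine ⟨by simp; omega, fun hq => ?_, fun hq => ?_⟩
    · have hp : p < M := by simpa [hM₁, hgp] using hq
      have hx : Y p / P.n < P.n := hK.lt _ _ (hK.adj hp)
      refine wp_seq <| wp_asg (Y p / P.n) ?_ <| wp_seq <| wp_ite ?_
        (fun hz => wp_skip ?_ <| wp_seq <| wp_sto (Y p / P.n) (p + 1) ?_ <| wp_asg (p + 1) ?_ ?_)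
        (fun hz => wp_seq <| wp_sto (Y p / P.n) p ?_ <| wp_sto (Y p / P.n) p ?_ <|
          wp_seq <| wp_sto (Y p / P.n) (p + 1) ?_ <| wp_asg (p + 1) ?_ ?_)
      any_goals
        simp [hgp, hgl, hgh, hgc, hY₁, hM₁, hE'.n]; omega
      · have hz' : p ≠ 0 ∧ Y (p - 1) / P.n = Y p / P.n := by
          constructor
          · rintro rfl
            simp [hgp] at hz
          · by_contra hcon
            by_cases hc : p = 0 <;> simp [hgp, hY₁, hE'.n, hcon, hc] at hz
        obtain ⟨hp0, hrow⟩ := hz'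
        obtain ⟨i1, i2, i3, i4, i5⟩ := h3 (p - 1) (by omega)
        rw [hrow] at i1 i2 i3 i4 i5
        refine ⟨by simp; omega, by simpa using hp, fun q hq => ?_⟩
        have hq : q < p + 1 := by simpa using hq
        simp only [Store.setV_v_self, ne_eq, reduceCtorEq, not_false_eq_true, Store.setV_v_of_ne,
          Store.setV_a, Store.setA_v, Store.setA_a_self, Store.setA_a_of_ne, hgl, hgh, hgc]
        by_cases hqx : Y q / P.n = Y p / P.n
        · rw [hqx, update_self]
          refine ⟨?_, hq, le_rfl, i4, fun r hr hr' => ?_⟩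
          · rcases Nat.lt_succ_iff_lt_or_eq.1 hq with hq | rfl
            · rw [← hqx]; exact (h3 q hq).1
            · omega
          · rcases Nat.lt_succ_iff_lt_or_eq.1 hr' with hr' | rfl
            · exact i5 r hr (by omega)
            · rfl
        · rw [update_of_ne hqx]
          have hq : q < p := by
            rcases Nat.lt_succ_iff_lt_or_eq.1 hq with hq | rfl
            exacts [hq, absurd rfl hqx]
          obtain ⟨j1, j2, j3, j4, j5⟩ := h3 q hq
          exact ⟨j1, j2, by omega, j4, j5⟩
      · have hz' : p = 0 ∨ Y (p - 1) / P.n ≠ Y p / P.n := by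
          by_contra! hcon
          simp [hgp, hY₁, hE'.n, hcon] at hz
        have hne : ∀ q < p, Y q / P.n ≠ Y p / P.n := fun q hq he => by
          rcases hz' with rfl | hz'
          · omega
          · have a1 := Nat.div_le_div_right (c := P.n)
              (hK.le (show q ≤ p - 1 by omega) (by omega))
            have a2 := Nat.div_le_div_right (c := P.n) (hK.le (show p - 1 ≤ p by omega) hp)
            omega
        refine ⟨by simp; omega, by simpa using hp, fun q hq => ?_⟩
        have hq : q < p + 1 := by simpa using hq
        simp only [Store.setV_v_self, ne_eq, reduceCtorEq, not_false_eq_true, Store.setV_v_of_ne,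
          Store.setV_a, Store.setA_v, Store.setA_a_self, Store.setA_a_of_ne, hgl, hgh, hgc]
        rcases Nat.lt_succ_iff_lt_or_eq.1 hq with hq | rfl
        · rw [update_of_ne (hne q hq), update_of_ne (hne q hq), update_of_ne (hne q hq)]
          obtain ⟨j1, j2, j3, j4, j5⟩ := h3 q hq
          exact ⟨j1, j2, by omega, j4, j5⟩
        · simp only [update_self]
          refine ⟨le_rfl, by omega, le_rfl, trivial, fun r hr hr' => ?_⟩
          rw [show r = q by omega]
    · have hp : p = M := by
        have : ¬ p < M := by simpa [hM₁, hgp] using hq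
        omega
      subst hp
      refine ⟨by simp; omega, ⟨fun q hq => (h3 q hq).1, fun q hq => (h3 q hq).2.1,
        fun q hq => (h3 q hq).2.2.1, fun q hq => (h3 q hq).2.2.2.2⟩, fun q hq => ?_⟩
      exact (h3 q hq).2.2.2.1

theorem identify_spec (hP : P.Fits Γ) (hE : Env P s σ) {Y lo hi : ℕ → ℕ} {Adj : ℕ → ℕ → Prop}
    (hK : Keys P.n M Y Adj) (hR : Rows P.n M Y lo hi) (hM : σ.v .size = M) (hM' : M ≤ 2 * P.m)
    (hY : σ.a .buf = Y) (hcur : ∀ p < M, σ.a .cur (Y p / P.n) = lo (Y p / P.n))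
    (hT : 80 * (M + 1) ≤ T) :
    wp Γ identify (fun σ' T' => T ≤ T' + 80 * (M + 1) ∧ ∀ p < M, σ'.a .ident p < M ∧
      Y (σ'.a .ident p) = if Y p / P.n < Y p % P.n then Y p else swapKey P.n (Y p)) σ T := by
  have hlin := hP.lin
  have hnm := hP.n_le
  refine wp_seq <| wp_asg 0 ?_ <| wp_whl (fun σ' T' => T ≤ T' + 70 * σ'.v .p + 10 ∧ σ'.v .p ≤ M ∧
    (∀ q < M, lo (Y q / P.n) ≤ σ'.a .cur (Y q / P.n) ∧
      (q < σ'.a .cur (Y q / P.n) ↔ ∃ p < σ'.v .p, Y p = swapKey P.n (Y q))) ∧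
    ∀ p < σ'.v .p, σ'.a .ident p < M ∧
      Y (σ'.a .ident p) = if Y p / P.n < Y p % P.n then Y p else swapKey P.n (Y p)) ?_ ?_
  · simp; omega
  · simp only [Store.setV_v_self, Store.setV_a]
    refine ⟨by simp; omega, by omega, fun q hq => ?_, by omega⟩
    rw [hcur q hq]
    refine ⟨le_rfl, ?_⟩
    have := hR.lo_le q hq
    simp; omega
  · rintro σ' T' hf ⟨h1, h2, h3, h4⟩
    have hE' : Env P s σ' := (hE.setV (by simp)).frame hf rfl
    have hM₁ : σ'.v .size = M := by simpa [hM] using hf.v .size rfl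
    have hY₁ : σ'.a .buf = Y := by simpa [hY] using hf.a .buf rfl
    have hN := hP.N
    generalize hgp : σ'.v .p = p at *
    generalize hgi : σ'.a .ident = ident at *
    generalize hgc : σ'.a .cur = cur at *
    refine ⟨by simp; omega, fun hq => ?_, fun hq => ?_⟩
    · have hp : p < M := by simpa [hM₁, hgp] using hq
      have hx : Y p / P.n < P.n := hK.lt _ _ (hK.adj hp)
      have hy : Y p % P.n < P.n := hK.lt' (hK.adj hp)
      obtain ⟨r, hr, hr1, hr2, hr3⟩ := hK.exists_swap hp
      have hr4 : swapKey P.n (Y r) = Y p := by rw [hr1, hK.swapKey_swapKey hp]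
      -- The cursor of the row of the reversed edge points to the reversed edge: the edges before it
      -- in that row have been met, and it has not.
      have hcr : cur (Y p % P.n) = r := by
        obtain ⟨h5, h6⟩ := h3 r hr
        rw [hr2] at h5 h6
        have h7 : ¬ r < cur (Y p % P.n) := by
          rw [h6]
          rintro ⟨p', hp', he⟩
          rw [hr4] at he
          have := hK.inj (by omega) hp he
          omega
        by_contra hne
        have hlt : cur (Y p % P.n) < r := by omega
        have h8 : Y (cur (Y p % P.n)) / P.n = Y p % P.n := by
          have := hR.row r hr (cur (Y p % P.n)) (by rw [hr2]; exact h5)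
            (hlt.trans (hR.lt_hi r hr))
          rwa [hr2] at this
        generalize hcq : cur (Y p % P.n) = q at *
        have hqM : q < M := hlt.trans hr
        obtain ⟨p', hp', e1, e2, e3⟩ := hK.exists_swap hqM
        have h9 : p' < p := by
          rw [← hK.lt_iff hp' hp, Keys.eq_key P.n (Y p'), Keys.eq_key P.n (Y p), e2, e3, h8]
          have h10 := hK.mono q r hlt hr
          rw [Keys.eq_key P.n (Y q), Keys.eq_key P.n (Y r), h8, hr2, hr3] at h10
          have h11 : (Y q % P.n + 1) * P.n ≤ Y p / P.n * P.n :=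
            Nat.mul_le_mul (by omega) le_rfl
          rw [add_mul] at h11
          omega
        have h12 := (h3 q hqM).2
        rw [h8, hcq] at h12
        exact absurd (h12.2 ⟨p', h9, e1⟩) (lt_irrefl _)
      refine wp_seq <| wp_asg (Y p / P.n) ?_ <| wp_seq <| wp_asg (Y p % P.n) ?_ <| wp_seq <|
        wp_asg r ?_ <| wp_seq <| wp_sto (Y p % P.n) (r + 1) ?_ <| wp_seq <|
        wp_sto p (if Y p / P.n < Y p % P.n then p else r) ?_ <| wp_asg (p + 1) ?_ ?_
      any_goals
        simp [hgp, hgi, hgc, hY₁, hM₁, hE'.n, hcr]; omega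
      · by_cases hlt : Y p / P.n < Y p % P.n <;> simp [hgp, hlt] <;> omega
      refine ⟨by simp; omega, by simpa using hp, fun q hq => ?_, fun q hq => ?_⟩
      · simp only [Store.setV_v_self, ne_eq, reduceCtorEq, not_false_eq_true, Store.setV_v_of_ne,
          Store.setV_a, Store.setA_v, Store.setA_a_self, Store.setA_a_of_ne, hgc]
        obtain ⟨h5, h6⟩ := h3 q hq
        have h7 : (∃ p' < p + 1, Y p' = swapKey P.n (Y q)) ↔
            (∃ p' < p, Y p' = swapKey P.n (Y q)) ∨ Y p = swapKey P.n (Y q) := by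
          simp only [Nat.lt_succ_iff_lt_or_eq, or_and_right, exists_or, exists_eq_left]
        have h8 : Y p = swapKey P.n (Y q) ↔ q = r := by
          constructor
          · intro he
            exact hK.inj hq hr (by rw [hr1, he, hK.swapKey_swapKey hq])
          · rintro rfl
            exact hr4.symm
        rw [h7, h8, ← h6]
        by_cases hqy : Y q / P.n = Y p % P.n
        · rw [hqy, update_self, hcr]
          rw [hqy, hcr] at h5
          omega
        · rw [update_of_ne hqy]
          refine ⟨h5, ?_⟩
          have : q ≠ r := by rintro rfl; exact hqy hr2
          simp [this]
      · have hq : q < p + 1 := by simpa using hq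
        simp only [Store.setV_v_self, ne_eq, reduceCtorEq, not_false_eq_true, Store.setV_v_of_ne,
          Store.setV_a, Store.setA_v, Store.setA_a_self, Store.setA_a_of_ne, hgi]
        rcases Nat.lt_succ_iff_lt_or_eq.1 hq with hq | rfl
        · rw [update_of_ne hq.ne]
          exact h4 q hq
        · rw [update_self]
          split_ifs
          · exact ⟨hp, rfl⟩
          · exact ⟨hr, hr1⟩
    · have hp : p = M := by
        have : ¬ p < M := by simpa [hM₁, hgp] using hq
        omega
      subst hp
      exact ⟨by simp; omega, h4⟩

end

/-! ### Common neighbours by jump search -/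

/-- Advance in the second row in steps of length `st`, as long as this does not pass an entry that is
at least `w`. -/
def jump : Cmd :=
  .whl (.cond (.lt §.hy (§.jy + §.st)) 0 (.lt (arr .buf (§.jy + §.st - 1) % §.n) §.w))
    (.asg .jy (§.jy + §.st))

/-- Search a block of the second row for `w`. -/
def searchBlock : Cmd :=
  .whl (.lt §.t §.te) (
    .ite (.eq (arr .buf §.t % §.n) §.w)
      (.sto .tri₁ §.c (arr .ident §.ix) ;; .sto .tri₂ §.c (arr .ident §.t) ;; .asg .c (§.c + 1))
      .skip ;;
    .asg .t (§.t + 1))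

/-- List the pairs of slots in the two rows that have the same end.  Every entry of the first row is
searched in a single block of length `st` of the second row, which is found by jumps; the jumps never
go back. -/
def intersect : Cmd :=
  .asg .c 0 ;; .whl (.lt §.ix §.hx) (
    .asg .w (arr .buf §.ix % §.n) ;;
    jump ;;
    .asg .t §.jy ;;
    .asg .te (.cond (.lt §.hy (§.jy + §.st)) §.hy (§.jy + §.st)) ;;
    searchBlock ;;
    .asg .ix (§.ix + 1))

/-- `l` lists the pairs of slots in the rows `[a, _)` and `[b, b')` with equal values of `N`, as far
as the first slot is below `i`, or equal to `i` with the second one below `t`. -/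
structure Found (N : ℕ → ℕ) (a b b' i t : ℕ) (l : List (ℕ × ℕ)) : Prop where
  nodup : l.Nodup
  mem : ∀ p q, (p, q) ∈ l ↔ a ≤ p ∧ b ≤ q ∧ q < b' ∧ N p = N q ∧ (p < i ∨ p = i ∧ q < t)

/-- Every slot of the first row has at most one partner, so the lists of triangles fit into the
arrays. -/
theorem Found.length_le {N : ℕ → ℕ} {a a' b b' i t : ℕ} {l : List (ℕ × ℕ)}
    (h : Found N a b b' i t l) (hi : i < a')
    (hN : ∀ p q, b ≤ p → p < q → q < b' → N p < N q) : l.length ≤ a' - a := by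
  have h1 : (l.map Prod.fst).Nodup := by
    refine h.nodup.map_on ?_
    rintro ⟨p, q⟩ hpq ⟨p', q'⟩ hpq' (rfl : p = p')
    rw [h.mem] at hpq hpq'
    rcases lt_trichotomy q q' with hlt | rfl | hlt
    · have := hN _ _ hpq.2.1 hlt hpq'.2.2.1; omega
    · rfl
    · have := hN _ _ hpq'.2.1 hlt hpq.2.2.1; omega
  rw [← List.length_map (f := Prod.fst), ← List.toFinset_card_of_nodup h1, ← Nat.card_Ico]
  refine Finset.card_le_card fun p hp => ?_
  simp only [List.mem_toFinset, List.mem_map, Prod.exists, exists_and_right, exists_eq_right] at hp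
  obtain ⟨q, hq⟩ := hp
  rw [h.mem] at hq
  rw [Finset.mem_Ico]
  omega

section

variable {P : Inst} {Γ : Ctx} {s M T n : ℕ} {σ : Store} {Y ident : ℕ → ℕ}

/-- The number `g` bounds the jumps that are still possible; those that are not made are handed on as
`g'`, so that the time for all jumps into one row is bounded at once. -/
theorem jump_spec (hP : P.Fits Γ) (hE : Env P s σ) {b b' j₀ st w g : ℕ}
    (hY : σ.a .buf = Y) (hb : σ.v .hy = b') (hst : σ.v .st = st) (hw : σ.v .w = w)
    (hj : σ.v .jy = j₀) (hbm : b' ≤ 2 * P.m) (hs1 : 1 ≤ st) (hs2 : st ≤ 2 * P.m + 1)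
    (hbj : b ≤ j₀) (hjb : j₀ ≤ b')
    (hN : ∀ p q, b ≤ p → p < q → q < b' → Y p % P.n < Y q % P.n)
    (hlow : ∀ q, b ≤ q → q < j₀ → Y q % P.n < w) (hg : b' ≤ j₀ + g * st) (hT : 40 * g + 40 ≤ T) :
    wp Γ jump (fun σ' T' => ∃ g', T + 40 * g' ≤ T' + 40 * g + 40 ∧ b ≤ σ'.v .jy ∧ σ'.v .jy ≤ b' ∧
      b' ≤ σ'.v .jy + g' * st ∧ (∀ q, b ≤ q → q < σ'.v .jy → Y q % P.n < w) ∧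
      (b' < σ'.v .jy + st ∨ w ≤ Y (σ'.v .jy + st - 1) % P.n)) σ T := by
  have hlin := hP.lin
  refine wp_whl (fun σ' T' => ∃ g', T + 40 * g' ≤ T' + 40 * g ∧ b ≤ σ'.v .jy ∧ σ'.v .jy ≤ b' ∧
      b' ≤ σ'.v .jy + g' * st ∧ ∀ q, b ≤ q → q < σ'.v .jy → Y q % P.n < w) ?_ ?_
  · subst hj
    exact ⟨g, le_rfl, hbj, hjb, hg, hlow⟩
  · rintro σ' T' hf ⟨g', h1, h2, h3, h4, h5⟩
    have hE' : Env P s σ' := hE.frame hf rfl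
    have hY₁ : σ'.a .buf = Y := by rw [hf.a .buf rfl, hY]
    have hb₁ : σ'.v .hy = b' := by rw [hf.v .hy rfl, hb]
    have hst₁ : σ'.v .st = st := by rw [hf.v .st rfl, hst]
    have hw₁ : σ'.v .w = w := by rw [hf.v .w rfl, hw]
    have hN' := hP.N
    generalize hgj : σ'.v .jy = j at *
    refine ⟨by simp [hgj, hY₁, hb₁, hst₁, hw₁]; omega, fun hq => ?_, fun hq => ?_⟩
    · have hq' : j + st ≤ b' ∧ Y (j + st - 1) % P.n < w := by
        by_contra hcon
        by_cases hc : b' < j + st <;>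
          simp [hgj, hY₁, hb₁, hst₁, hw₁, hE'.n, hc] at hq hcon <;> omega
      refine wp_asg (j + st) ?_ ?_
      · simp [hgj, hst₁]; omega
      · cases g' with
        | zero => omega
        | succ g' =>
          rw [add_mul] at h4
          refine ⟨g', by simp; omega, by simp; omega, by simp; omega, by simp; omega, ?_⟩
          intro q hq1 hq2
          have hq2 : q < j + st := by simpa using hq2
          rcases Nat.lt_or_ge q (j + st - 1) with hlt | hge
          · exact (hN _ _ hq1 hlt (by omega)).trans hq'.2
          · rw [show q = j + st - 1 by omega]; exact hq'.2
    · refine ⟨g', by simp; omega, h2, h3, h4, h5, ?_⟩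
      by_contra! hcon
      simp [hgj, hY₁, hb₁, hst₁, hw₁, hE'.n, hcon] at hq

theorem searchBlock_spec (hP : P.Fits Γ) (hE : Env P s σ) {a a' b b' i t₀ te w : ℕ}
    {l : List (ℕ × ℕ)} (hY : σ.a .buf = Y) (hid : σ.a .ident = ident) (ht : σ.v .t = t₀)
    (hte : σ.v .te = te) (hw : σ.v .w = w) (hix : σ.v .ix = i) (hai : a ≤ i) (hia : i < a')
    (ham : a' ≤ 2 * P.m) (hbm : b' ≤ 2 * P.m) (hwi : Y i % P.n = w) (hbt : b ≤ t₀) (htt : t₀ ≤ te)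
    (hteb : te ≤ b') (hN : ∀ p q, b ≤ p → p < q → q < b' → Y p % P.n < Y q % P.n)
    (hl : Found (fun q => Y q % P.n) a b b' i t₀ l)
    (hl₁ : pre (σ.a .tri₁) (σ.v .c) = l.map fun pq => ident pq.1)
    (hl₂ : pre (σ.a .tri₂) (σ.v .c) = l.map fun pq => ident pq.2)
    (hT : 50 * (te - t₀) + 10 ≤ T) :
    wp Γ searchBlock (fun σ' T' => T ≤ T' + 50 * (te - t₀) + 10 ∧ ∃ l,
      Found (fun q => Y q % P.n) a b b' i te l ∧
      pre (σ'.a .tri₁) (σ'.v .c) = l.map (fun pq => ident pq.1) ∧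
      pre (σ'.a .tri₂) (σ'.v .c) = l.map fun pq => ident pq.2) σ T := by
  have hlin := hP.lin
  refine wp_whl (fun σ' T' => T ≤ T' + 50 * (σ'.v .t - t₀) ∧ t₀ ≤ σ'.v .t ∧ σ'.v .t ≤ te ∧ ∃ l,
      Found (fun q => Y q % P.n) a b b' i (σ'.v .t) l ∧
      pre (σ'.a .tri₁) (σ'.v .c) = l.map (fun pq => ident pq.1) ∧
      pre (σ'.a .tri₂) (σ'.v .c) = l.map fun pq => ident pq.2) ?_ ?_
  · subst ht
    exact ⟨by omega, le_rfl, htt, l, hl, hl₁, hl₂⟩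
  · clear hl hl₁ hl₂ l
    rintro σ' T' hf ⟨h1, h2, h3, l, h4, h5, h6⟩
    have hE' : Env P s σ' := hE.frame hf rfl
    have hY₁ : σ'.a .buf = Y := by rw [hf.a .buf rfl, hY]
    have hid₁ : σ'.a .ident = ident := by rw [hf.a .ident rfl, hid]
    have hte₁ : σ'.v .te = te := by rw [hf.v .te rfl, hte]
    have hw₁ : σ'.v .w = w := by rw [hf.v .w rfl, hw]
    have hix₁ : σ'.v .ix = i := by rw [hf.v .ix rfl, hix]
    have hN' := hP.N
    generalize hgt : σ'.v .t = t at *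
    generalize hgc : σ'.v .c = c at *
    refine ⟨by simp; omega, fun hq => ?_, fun hq => ?_⟩
    · have ht' : t < te := by simpa [hgt, hte₁] using hq
      have hcl : c = l.length := by rw [← length_pre (σ'.a .tri₁) c, h5, List.length_map]
      have hlen := h4.length_le hia hN
      refine wp_seq <| wp_ite ?_ (fun hz => wp_seq <| wp_sto c (ident i) ?_ <| wp_seq <|
        wp_sto c (ident t) ?_ <| wp_asg (c + 1) ?_ <| wp_asg (t + 1) ?_ ?_)
        (fun hz => wp_skip ?_ <| wp_asg (t + 1) ?_ ?_)
      any_goals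
        simp [hgt, hgc, hY₁, hte₁, hw₁, hix₁, hid₁]; omega
      · have hz : Y t % P.n = w := by simpa [hgt, hY₁, hw₁, hE'.n] using hz
        refine ⟨by simp; omega, by simp; omega, by simpa using ht', l ++ [(i, t)], ⟨?_, ?_⟩, ?_, ?_⟩
        · rw [List.nodup_append]
          refine ⟨h4.nodup, by simp, ?_⟩
          rintro ⟨p, q⟩ hpq _ ht rfl
          simp only [List.mem_singleton, Prod.mk.injEq] at ht
          rw [h4.mem] at hpq
          omega
        · intro p q
          simp only [List.mem_append, h4.mem, List.mem_singleton, Prod.mk.injEq, Store.setV_v_self]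
          constructor
          · rintro (⟨h7, h8, h9, h10, h11⟩ | ⟨rfl, rfl⟩)
            · exact ⟨h7, h8, h9, h10, by omega⟩
            · exact ⟨hai, by omega, by omega, by omega, by omega⟩
          · rintro ⟨h7, h8, h9, h10, h11⟩
            by_cases hpq : p = i ∧ q = t
            · exact .inr hpq
            · exact .inl ⟨h7, h8, h9, h10, by omega⟩
        · simp [h5]
        · simp [h6]
      · have hz : Y t % P.n ≠ w := by simpa [hgt, hY₁, hw₁, hE'.n] using hz
        refine ⟨by simp; omega, by simp; omega, by simpa using ht', l, ⟨h4.nodup, fun p q => ?_⟩,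
          by simpa [hgc] using h5, by simpa [hgc] using h6⟩
        rw [h4.mem, Store.setV_v_self]
        refine and_congr_right fun _ => and_congr_right fun _ => and_congr_right fun _ =>
          and_congr_right fun he => ?_
        have : ¬ (p = i ∧ q = t) := by
          rintro ⟨rfl, rfl⟩
          exact hz (he ▸ hwi)
        omega
    · have ht' : t = te := by
        have : ¬ t < te := by simpa [hgt, hte₁] using hq
        omega
      subst ht'
      exact ⟨by simp; omega, l, h4, h5, h6⟩

/-- With `d₁ = a' - a` and `d₂ = b' - b`, there are `d₁` blocks of length `st` to be searched, and at
most `d₂ / st ≤ st * d₁` jumps. -/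
theorem intersect_spec (hP : P.Fits Γ) (hE : Env P s σ) {a a' b b' st : ℕ}
    (hY : σ.a .buf = Y) (hid : σ.a .ident = ident)
    (ha : σ.v .ix = a) (ha' : σ.v .hx = a') (hb : σ.v .jy = b) (hb' : σ.v .hy = b')
    (hst : σ.v .st = st) (haa : a ≤ a') (hbb : b ≤ b') (ham : a' ≤ 2 * P.m) (hbm : b' ≤ 2 * P.m)
    (hs1 : 1 ≤ st) (hs2 : st ≤ 2 * P.m + 1) (hbst : b' - b ≤ st * st * (a' - a))
    (hNa : ∀ p q, a ≤ p → p < q → q < a' → Y p % P.n < Y q % P.n)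
    (hN : ∀ p q, b ≤ p → p < q → q < b' → Y p % P.n < Y q % P.n)
    (hT : 200 * (st * (a' - a) + 1) ≤ T) :
    wp Γ intersect (fun σ' T' => T ≤ T' + 200 * (st * (a' - a) + 1) ∧
      σ'.v .c ≤ st * (a' - a) ∧ ∃ l : List (ℕ × ℕ), l.Nodup ∧
      (∀ p q, (p, q) ∈ l ↔ a ≤ p ∧ p < a' ∧ b ≤ q ∧ q < b' ∧ Y p % P.n = Y q % P.n) ∧
      pre (σ'.a .tri₁) (σ'.v .c) = l.map (fun pq => ident pq.1) ∧
      pre (σ'.a .tri₂) (σ'.v .c) = l.map fun pq => ident pq.2) σ T := by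
  have hlin := hP.lin
  obtain ⟨K, hK⟩ : ∃ K, K = 50 * st + 100 := ⟨_, rfl⟩
  refine wp_seq <| wp_asg 0 ?_ <| wp_whl (fun σ' T' => ∃ r g, σ'.v .ix + r = a' ∧ a ≤ σ'.v .ix ∧
      T + K * r + 40 * g ≤ T' + K * (a' - a) + 40 * (st * (a' - a)) + 10 ∧
      b ≤ σ'.v .jy ∧ σ'.v .jy ≤ b' ∧ b' ≤ σ'.v .jy + g * st ∧
      (∀ q, b ≤ q → q < σ'.v .jy → ∀ p, σ'.v .ix ≤ p → p < a' → Y q % P.n < Y p % P.n) ∧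
      ∃ l : List (ℕ × ℕ), Found (fun q => Y q % P.n) a b b' (σ'.v .ix) b l ∧
      pre (σ'.a .tri₁) (σ'.v .c) = l.map (fun pq => ident pq.1) ∧
      pre (σ'.a .tri₂) (σ'.v .c) = l.map fun pq => ident pq.2) ?_ ?_
  · simp; omega
  · refine ⟨a' - a, st * (a' - a), by simp [ha]; omega, by simp [ha], by simp; omega, by simp [hb],
      by simp [hb, hbb], ?_, ?_, [], ⟨by simp, fun p q => ?_⟩, by simp, by simp⟩
    · have : st * (a' - a) * st = st * st * (a' - a) := by ring
      simp [hb]; omega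
    · intro q hq1 hq2
      simp [hb] at hq2
      omega
    · simp [ha]; omega
  · rintro σ' T' hf ⟨r, g, h1, h2, h3, h4, h5, h6, h7, l, h8, h9, h10⟩
    have hE' : Env P s σ' := (hE.setV (by simp)).frame hf rfl
    have hY₁ : σ'.a .buf = Y := by simpa [hY] using hf.a .buf rfl
    have hid₁ : σ'.a .ident = ident := by simpa [hid] using hf.a .ident rfl
    have ha₁ : σ'.v .hx = a' := by simpa [ha'] using hf.v .hx rfl
    have hb₁ : σ'.v .hy = b' := by simpa [hb'] using hf.v .hy rfl
    have hst₁ : σ'.v .st = st := by simpa [hst] using hf.v .st rfl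
    have hN' := hP.N
    have hKst : K * (a' - a) = 50 * (st * (a' - a)) + 100 * (a' - a) := by rw [hK]; ring
    have hle : 1 * (a' - a) ≤ st * (a' - a) := Nat.mul_le_mul hs1 le_rfl
    generalize hgi : σ'.v .ix = i at *
    generalize hgj : σ'.v .jy = j at *
    refine ⟨by simp; omega, fun hq => ?_, fun hq => ?_⟩
    · have hia : i < a' := by simpa [hgi, ha₁] using hq
      obtain ⟨r, rfl⟩ : ∃ r', r = r' + 1 := ⟨r - 1, by omega⟩
      rw [mul_add] at h3
      refine wp_seq <| wp_asg (Y i % P.n) ?_ <| wp_seq <| wp_mono (jump_spec (b := b) (b' := b')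
        (st := st) (w := Y i % P.n) (g := g) (j₀ := j) hP (hE'.setV (by simp)) (by simpa using hY₁)
        (by simpa using hb₁) (by simpa using hst₁) (by simp) (by simpa using hgj) hbm hs1 hs2 h4 h5
        hN (fun q hq1 hq2 => h7 q hq1 hq2 i le_rfl hia) h6 ?_) ?_
      · simp [hgi, hY₁, hE'.n]; omega
      · simp; omega
      rintro σ₂ T₂ hf₂ ⟨g', j1, j2, j3, j4, j5, j6⟩
      have hE₂ : Env P s σ₂ := (hE'.setV (by simp)).frame hf₂ rfl
      have hY₂ : σ₂.a .buf = Y := by simpa [hY₁] using hf₂.a .buf rfl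
      have hid₂ : σ₂.a .ident = ident := by simpa [hid₁] using hf₂.a .ident rfl
      have ha₂ : σ₂.v .hx = a' := by simpa [ha₁] using hf₂.v .hx rfl
      have hb₂ : σ₂.v .hy = b' := by simpa [hb₁] using hf₂.v .hy rfl
      have hst₂ : σ₂.v .st = st := by simpa [hst₁] using hf₂.v .st rfl
      have hi₂ : σ₂.v .ix = i := by simpa [hgi] using hf₂.v .ix rfl
      have hw₂ : σ₂.v .w = Y i % P.n := by simpa using hf₂.v .w rfl
      have hc₂ : σ₂.v .c = σ'.v .c := by simpa using hf₂.v .c rfl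
      have ht1₂ : σ₂.a .tri₁ = σ'.a .tri₁ := by simpa using hf₂.a .tri₁ rfl
      have ht2₂ : σ₂.a .tri₂ = σ'.a .tri₂ := by simpa using hf₂.a .tri₂ rfl
      simp at j1
      generalize hgj' : σ₂.v .jy = j' at *
      obtain ⟨te, hte⟩ : ∃ te, te = if b' < j' + st then b' else j' + st := ⟨_, rfl⟩
      have hte1 : te ≤ b' ∧ te ≤ j' + st ∧ j' ≤ te := by rw [hte]; split_ifs <;> omega
      -- Entries of the second row beyond the block are too large.
      have hte2 : ∀ q, te ≤ q → q < b' → Y i % P.n < Y q % P.n := fun q hq1 hq2 => by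
        rw [hte] at hq1
        split_ifs at hq1 with hc
        · omega
        · have := hN (j' + st - 1) q (by omega) (by omega) hq2
          omega
      have h8' : Found (fun q => Y q % P.n) a b b' i j' l := by
        refine ⟨h8.nodup, fun p q => ?_⟩
        rw [h8.mem]
        refine and_congr_right fun _ => and_congr_right fun hbq => and_congr_right fun _ =>
          and_congr_right fun he => ?_
        have : ¬ (p = i ∧ q < j') := by
          rintro ⟨rfl, hq⟩
          have := j5 q hbq hq
          omega
        omega
      refine wp_seq <| wp_asg j' ?_ <| wp_seq <| wp_asg te ?_ <| wp_seq <| wp_mono (searchBlock_spec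
        (a := a) (a' := a') (b := b) (b' := b') (i := i) (t₀ := j') (te := te) (w := Y i % P.n)
        (l := l) (Y := Y) (ident := ident) hP ((hE₂.setV (by simp)).setV (by simp))
        (by simpa using hY₂) (by simpa using hid₂) (by simp) (by simp) (by simpa using hw₂)
        (by simpa using hi₂) h2 hia ham hbm rfl j2 hte1.2.2 hte1.1 hN h8' (by simp [ht1₂, hc₂, h9])
        (by simp [ht2₂, hc₂, h10]) ?_) ?_
      · simp [hgj']; omega
      · rw [hte]
        by_cases hc : b' < j' + st <;> simp [hb₂, hgj', hst₂, hc] <;> omega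
      · simp; omega
      rintro σ₃ T₃ hf₃ ⟨k1, l', k2, k3, k4⟩
      have hi₃ : σ₃.v .ix = i := by simpa [hi₂] using hf₃.v .ix rfl
      have hj₃ : σ₃.v .jy = j' := by simpa [hgj'] using hf₃.v .jy rfl
      simp at k1
      refine wp_asg (i + 1) ?_ ?_
      · simp [hi₃]; omega
      refine ⟨r, g', by simp; omega, by simp; omega, by simp; omega, by simp [hj₃, j2],
        by simp [hj₃, j3], by simp [hj₃, j4], ?_, l', ⟨k2.nodup, fun p q => ?_⟩,
        by simpa using k3, by simpa using k4⟩
      · intro q hq1 hq2 p hp1 hp2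
        simp [hj₃] at hq2 hp1
        exact (j5 q hq1 hq2).trans (hNa i p h2 (by omega) hp2)
      · rw [k2.mem, Store.setV_v_self]
        refine and_congr_right fun _ => and_congr_right fun hbq => and_congr_right fun hqb =>
          and_congr_right fun he => ?_
        have : p = i → q < te := by
          rintro rfl
          by_contra hq
          have := hte2 q (by omega) hqb
          omega
        omega
    · have hi : i = a' := by
        have : ¬ i < a' := by simpa [hgi, ha₁] using hq
        omega
      subst hi
      have hcl : σ'.v .c = l.length := by
        rw [← length_pre (σ'.a .tri₁) (σ'.v .c), h9, List.length_map]
      refine ⟨by simp; omega, ?_, l, h8.nodup, fun p q => ?_, h9, h10⟩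
      -- If the first row is not empty, then its last slot may be taken as the current one.
      · rcases haa.lt_or_eq with hlt | rfl
        · have h8' : Found (fun q => Y q % P.n) a b b' (i - 1) b' l := by
            refine ⟨h8.nodup, fun p q => ?_⟩
            rw [h8.mem]
            refine and_congr_right fun _ => and_congr_right fun hbq => and_congr_right fun _ =>
              and_congr_right fun he => ?_
            omega
          have := h8'.length_le (a' := i) (by omega) hN
          omega
        · rcases l with _ | ⟨⟨p, q⟩, l⟩
          · simp [hcl]
          · have := (h8.mem p q).1 (by simp)
            omega
      · rw [h8.mem]
        refine and_congr_right fun _ => ?_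
        omega

end

/-! ### Peeling -/

/-- A set `B` of edges each of which lies in at least `k - 2` of the triangles `𝒯` (sets of edges)
inside of `B`. -/
def IsDense (𝒯 : Finset (Finset ℕ)) (k : ℕ) (B : Finset ℕ) : Prop :=
  ∀ e ∈ B, k ≤ (𝒯.filter fun τ => τ ⊆ B ∧ e ∈ τ).card + 2

/-- The state of the peeling process.  The flag of an edge of `E` is `0`, or `1` if the edge waits in
the queue for its removal, or `2` if it has been removed; `Q` is the queue, including the removed
edges.  `𝒜` is the set of the remaining triangles: those without removed edges, except for the set
`done`, which is non-empty only during the removal of an edge.  The counter `sup` is up to date,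
except that it is too large by one on `D`. -/
structure Peel (E : Finset ℕ) (𝒯 : Finset (Finset ℕ)) (k : ℕ) (𝒜 done : Finset (Finset ℕ))
    (D : Finset ℕ) (sup flag : ℕ → ℕ) (Q : List ℕ) : Prop where
  mem : ∀ τ, τ ∈ 𝒜 ↔ τ ∈ 𝒯 ∧ (∀ e ∈ τ, flag e ≠ 2) ∧ τ ∉ done
  sup_eq : ∀ e ∈ E, flag e ≠ 2 → sup e = (𝒜.filter fun τ => e ∈ τ).card + if e ∈ D then 1 else 0
  enough : ∀ e ∈ E, flag e = 0 → k ≤ sup e + 2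
  dense : ∀ B ⊆ E, IsDense 𝒯 k B → ∀ e ∈ B, flag e = 0
  nodup : Q.Nodup
  mem_queue : ∀ e, e ∈ Q ↔ e ∈ E ∧ flag e ≠ 0
  done_flag : ∀ τ ∈ done, ∃ e ∈ τ, flag e ≠ 0

namespace Peel

variable {E : Finset ℕ} {𝒯 𝒜 done : Finset (Finset ℕ)} {k : ℕ} {D : Finset ℕ} {sup flag : ℕ → ℕ}
  {Q : List ℕ}

/-- Removal of a triangle; the counters of its edges are now outdated. -/
theorem erase (h : Peel E 𝒯 k 𝒜 done ∅ sup flag Q) {τ : Finset ℕ} (hτ : τ ∈ 𝒜)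
    (hf : ∃ e ∈ τ, flag e ≠ 0) : Peel E 𝒯 k (𝒜.erase τ) (insert τ done) τ sup flag Q where
  mem τ' := by
    rw [Finset.mem_erase, h.mem, Finset.mem_insert]
    tauto
  sup_eq e he hfe := by
    rw [h.sup_eq e he hfe, Finset.filter_erase]
    by_cases heτ : e ∈ τ
    · have h1 : τ ∈ 𝒜.filter fun τ => e ∈ τ := Finset.mem_filter.2 ⟨hτ, heτ⟩
      rw [if_pos heτ, if_neg (Finset.notMem_empty _), Finset.card_erase_add_one h1, add_zero]
    · rw [if_neg heτ, if_neg (Finset.notMem_empty _), Finset.erase_eq_of_notMem]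
      simp [heτ]
  enough := h.enough
  dense := h.dense
  nodup := h.nodup
  mem_queue := h.mem_queue
  done_flag τ' hτ' := by
    rcases Finset.mem_insert.1 hτ' with rfl | hτ'
    exacts [hf, h.done_flag _ hτ']

/-- Triangles inside of a dense set remain. -/
theorem mem_of_dense (h : Peel E 𝒯 k 𝒜 done D sup flag Q) {B : Finset ℕ} (hBE : B ⊆ E)
    (hB : IsDense 𝒯 k B) {τ : Finset ℕ} (hτ : τ ∈ 𝒯) (hτB : τ ⊆ B) : τ ∈ 𝒜 := by
  rw [h.mem]
  refine ⟨hτ, fun e he => by rw [h.dense B hBE hB e (hτB he)]; decide, fun hd => ?_⟩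
  obtain ⟨e, he, hf⟩ := h.done_flag τ hd
  exact hf (h.dense B hBE hB e (hτB he))

/-- An edge with too small a counter does not belong to any dense set. -/
theorem notMem_of_lt (h : Peel E 𝒯 k 𝒜 done D sup flag Q) {B : Finset ℕ} (hBE : B ⊆ E)
    (hB : IsDense 𝒯 k B) {e s : ℕ} (hs : (𝒜.filter fun τ => e ∈ τ).card ≤ s) (hk : s + 2 < k) :
    e ∉ B := by
  intro he
  have h1 := hB e he
  have h2 : (𝒯.filter fun τ => τ ⊆ B ∧ e ∈ τ).card ≤ (𝒜.filter fun τ => e ∈ τ).card := by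
    refine Finset.card_le_card fun τ hτ => ?_
    simp only [Finset.mem_filter] at hτ ⊢
    exact ⟨h.mem_of_dense hBE hB hτ.1 hτ.2.1, hτ.2.2⟩
  omega

/-- An outdated counter is corrected, and need not be acted upon. -/
theorem decr_of_ok (h : Peel E 𝒯 k 𝒜 done D sup flag Q) {z : ℕ} (hz : z ∈ D) (hzE : z ∈ E)
    (hf : flag z ≠ 2) (hok : flag z = 0 → k ≤ sup z - 1 + 2) :
    Peel E 𝒯 k 𝒜 done (D.erase z) (update sup z (sup z - 1)) flag Q where
  mem := h.mem
  sup_eq e he hfe := by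
    by_cases hez : e = z
    · subst hez
      simp [h.sup_eq e he hfe, hz]
    · simp [update_of_ne hez, h.sup_eq e he hfe, hez]
  enough e he hfe := by
    by_cases hez : e = z
    · subst hez
      simpa using hok hfe
    · simpa [update_of_ne hez] using h.enough e he hfe
  dense := h.dense
  nodup := h.nodup
  mem_queue := h.mem_queue
  done_flag := h.done_flag

/-- An outdated counter is corrected, and the edge is put into the queue. -/
theorem decr_of_lt (h : Peel E 𝒯 k 𝒜 done D sup flag Q) {z : ℕ} (hz : z ∈ D) (hzE : z ∈ E)
    (hf : flag z = 0) (hlt : sup z - 1 + 2 < k) :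
    Peel E 𝒯 k 𝒜 done (D.erase z) (update sup z (sup z - 1)) (update flag z 1) (Q ++ [z]) where
  mem τ := by
    rw [h.mem]
    have : ∀ e, update flag z 1 e ≠ 2 ↔ flag e ≠ 2 := fun e => by
      by_cases hez : e = z
      · subst hez; simp [hf]
      · simp [update_of_ne hez]
    simp only [this]
  sup_eq e he hfe := by
    by_cases hez : e = z
    · subst hez
      simp [h.sup_eq e he (by simp [hf]), hz]
    · rw [update_of_ne hez] at hfe ⊢
      simp [h.sup_eq e he hfe, hez]
  enough e he hfe := by
    by_cases hez : e = z
    · subst hez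
      simp at hfe
    · rw [update_of_ne hez] at hfe ⊢
      exact h.enough e he hfe
  dense B hBE hB e he := by
    by_cases hez : e = z
    · subst hez
      refine absurd he (h.notMem_of_lt hBE hB ?_ hlt)
      simp [h.sup_eq e hzE (by simp [hf]), hz]
    · rw [update_of_ne hez]
      exact h.dense B hBE hB e he
  nodup := by
    rw [List.nodup_append]
    refine ⟨h.nodup, by simp, ?_⟩
    rintro e he _ hz rfl
    rw [List.mem_singleton] at hz
    exact ((h.mem_queue e).1 he).2 (hz ▸ hf)
  mem_queue e := by
    rw [List.mem_append, h.mem_queue, List.mem_singleton]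
    by_cases hez : e = z
    · subst hez; simp [hzE]
    · simp [update_of_ne hez, hez]
  done_flag τ hτ := by
    obtain ⟨e, he, hfe⟩ := h.done_flag τ hτ
    refine ⟨e, he, ?_⟩
    rwa [update_of_ne]
    rintro rfl
    exact hfe hf

/-- The removal of an edge is completed when none of its triangles is left. -/
theorem finish (h : Peel E 𝒯 k 𝒜 done ∅ sup flag Q) {g : ℕ} (hg : flag g = 1) (hgE : g ∈ E)
    (hd : ∀ τ ∈ done, g ∈ τ) (h𝒜 : ∀ τ ∈ 𝒜, g ∉ τ) :
    Peel E 𝒯 k 𝒜 ∅ ∅ sup (update flag g 2) Q where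
  mem τ := by
    constructor
    · intro hτ
      have h1 := (h.mem τ).1 hτ
      refine ⟨h1.1, fun e he => ?_, Finset.notMem_empty _⟩
      rw [update_of_ne]
      · exact h1.2.1 e he
      · rintro rfl
        exact h𝒜 τ hτ he
    · rintro ⟨h1, h2, -⟩
      have h3 : g ∉ τ := fun hgτ => h2 g hgτ (update_self ..)
      refine (h.mem τ).2 ⟨h1, fun e he => ?_, fun hdτ => h3 (hd τ hdτ)⟩
      have := h2 e he
      rwa [update_of_ne] at this
      rintro rfl
      exact h3 he
  sup_eq e he hfe := by
    by_cases heg : e = g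
    · subst heg; simp at hfe
    · rw [update_of_ne heg] at hfe
      exact h.sup_eq e he hfe
  enough e he hfe := by
    by_cases heg : e = g
    · subst heg; simp at hfe
    · rw [update_of_ne heg] at hfe
      exact h.enough e he hfe
  dense B hBE hB e he := by
    have h1 := h.dense B hBE hB e he
    rwa [update_of_ne]
    rintro rfl
    omega
  nodup := h.nodup
  mem_queue e := by
    rw [h.mem_queue]
    by_cases heg : e = g
    · subst heg; simp [hg]
    · rw [update_of_ne heg]
  done_flag := by simp

/-- When no edge waits in the queue, the edges that are left form the largest dense set. -/
theorem isDense (h : Peel E 𝒯 k 𝒜 ∅ ∅ sup flag Q) (hE : ∀ τ ∈ 𝒯, τ ⊆ E)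
    (hQ : ∀ e ∈ Q, flag e = 2) : IsDense 𝒯 k (E.filter fun e => flag e = 0) := by
  intro e he
  rw [Finset.mem_filter] at he
  have h1 := h.enough e he.1 he.2
  rw [h.sup_eq e he.1 (by rw [he.2]; decide), if_neg (Finset.notMem_empty _), add_zero] at h1
  refine h1.trans (Nat.add_le_add_right (Finset.card_le_card fun τ hτ => ?_) 2)
  rw [Finset.mem_filter] at hτ ⊢
  have h2 := (h.mem τ).1 hτ.1
  refine ⟨h2.1, fun e' he' => ?_, hτ.2⟩
  rw [Finset.mem_filter]
  have h3 := hE τ h2.1 he'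
  refine ⟨h3, ?_⟩
  by_contra h4
  exact h2.2.1 e' he' (hQ e' ((h.mem_queue e').2 ⟨h3, h4⟩))

theorem card_add_length (h : Peel E 𝒯 k 𝒜 done D sup flag Q) :
    (E.filter fun e => flag e = 0).card + Q.length = E.card := by
  have h1 : Q.toFinset = E.filter fun e => ¬ flag e = 0 := by
    ext e
    rw [List.mem_toFinset, h.mem_queue, Finset.mem_filter]
  rw [← List.toFinset_card_of_nodup h.nodup, h1]
  exact Finset.card_filter_add_card_filter_not _

end Peel

/-! ### Edges and triangles -/

section edges

variable (n M : ℕ) (Y : ℕ → ℕ) (Adj : ℕ → ℕ → Prop)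

/-- The slot of the edge between `x` and `y` in the direction from the smaller to the larger node,
which stands for the undirected edge. -/
noncomputable def edgeId (x y : ℕ) : ℕ := sInf {p | p < M ∧ Y p = min x y * n + max x y}

/-- The slots that stand for undirected edges. -/
def edgeIds : Finset ℕ := (Finset.range M).filter fun p => Y p / n < Y p % n

open Classical in
/-- The triangles of the graph, as sets of (slots that stand for) edges. -/
noncomputable def triangles : Finset (Finset ℕ) :=
  ((Finset.range n ×ˢ Finset.range n ×ˢ Finset.range n).filter fun t =>
    Adj t.1 t.2.1 ∧ Adj t.1 t.2.2 ∧ Adj t.2.1 t.2.2).image fun t =>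
      {edgeId n M Y t.1 t.2.1, edgeId n M Y t.1 t.2.2, edgeId n M Y t.2.1 t.2.2}

/-- `ident` assigns to a slot the slot that stands for its undirected edge. -/
def IsIdent (ident : ℕ → ℕ) : Prop := ∀ p < M, ident p < M ∧
  Y (ident p) = if Y p / n < Y p % n then Y p else swapKey n (Y p)

end edges

/-- The triangle with the edges `e`, `q.1` and `q.2`. -/
def tri (e : ℕ) (q : ℕ × ℕ) : Finset ℕ := {e, q.1, q.2}

/-- `l` lists the triangles at the edge `e`, each by its two other edges. -/
structure Star (E : Finset ℕ) (𝒯 : Finset (Finset ℕ)) (e : ℕ) (l : List (ℕ × ℕ)) : Prop where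
  ne : ∀ q ∈ l, q.1 ≠ e ∧ q.2 ≠ e ∧ q.1 ≠ q.2
  mem_edges : ∀ q ∈ l, q.1 ∈ E ∧ q.2 ∈ E
  nodup : (l.map (tri e)).Nodup
  mem : ∀ τ, τ ∈ 𝒯 ∧ e ∈ τ ↔ ∃ q ∈ l, tri e q = τ

theorem Star.card {E : Finset ℕ} {𝒯 : Finset (Finset ℕ)} {e : ℕ} {l : List (ℕ × ℕ)}
    (h : Star E 𝒯 e l) : (𝒯.filter fun τ => e ∈ τ).card = l.length := by
  rw [← List.length_map (f := tri e), ← List.toFinset_card_of_nodup h.nodup]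
  congr 1
  ext τ
  rw [Finset.mem_filter, h.mem, List.mem_toFinset, List.mem_map]

theorem edgeId_comm (n M : ℕ) (Y : ℕ → ℕ) (x y : ℕ) : edgeId n M Y x y = edgeId n M Y y x := by
  rw [edgeId, edgeId, min_comm, max_comm]

theorem mem_triangles {n M : ℕ} {Y : ℕ → ℕ} {Adj : ℕ → ℕ → Prop} (h : Keys n M Y Adj)
    {τ : Finset ℕ} : τ ∈ triangles n M Y Adj ↔ ∃ x y w, Adj x y ∧ Adj x w ∧ Adj y w ∧
      τ = {edgeId n M Y x y, edgeId n M Y x w, edgeId n M Y y w} := by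
  simp only [triangles, Finset.mem_image, Finset.mem_filter, Finset.mem_product, Finset.mem_range,
    Prod.exists]
  constructor
  · rintro ⟨x, y, w, ⟨-, h1, h2, h3⟩, rfl⟩
    exact ⟨x, y, w, h1, h2, h3, rfl⟩
  · rintro ⟨x, y, w, h1, h2, h3, rfl⟩
    exact ⟨x, y, w, ⟨⟨h.lt _ _ h1, h.lt' h1, h.lt' h2⟩, h1, h2, h3⟩, rfl⟩

namespace Keys

variable {n M : ℕ} {Y : ℕ → ℕ} {Adj : ℕ → ℕ → Prop} (h : Keys n M Y Adj)
include h

theorem adj_min_max {x y : ℕ} (hxy : Adj x y) : Adj (min x y) (max x y) := by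
  rcases le_total x y with hle | hle
  · rwa [min_eq_left hle, max_eq_right hle]
  · rw [min_eq_right hle, max_eq_left hle]; exact h.symm _ _ hxy

theorem edgeId_spec {x y : ℕ} (hxy : Adj x y) :
    edgeId n M Y x y < M ∧ Y (edgeId n M Y x y) = min x y * n + max x y := by
  obtain ⟨p, hp, he, -⟩ := h.exists_slot (h.adj_min_max hxy)
  exact Nat.sInf_mem (s := {p | p < M ∧ Y p = min x y * n + max x y}) ⟨p, hp, he⟩

theorem ne {x y : ℕ} (hxy : Adj x y) : x ≠ y := by rintro rfl; exact h.irrefl _ hxy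

theorem edgeId_mem {x y : ℕ} (hxy : Adj x y) : edgeId n M Y x y ∈ edgeIds n M Y := by
  obtain ⟨h1, h2⟩ := h.edgeId_spec hxy
  have h3 := h.adj_min_max hxy
  rw [edgeIds, Finset.mem_filter, Finset.mem_range, h2, h.div_eq h3, h.mod_eq h3]
  exact ⟨h1, by have := h.ne hxy; omega⟩

theorem edgeId_eq {p : ℕ} (hp : p ∈ edgeIds n M Y) : edgeId n M Y (Y p / n) (Y p % n) = p := by
  rw [edgeIds, Finset.mem_filter, Finset.mem_range] at hp
  obtain ⟨h1, h2⟩ := h.edgeId_spec (h.adj hp.1)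
  refine h.inj h1 hp.1 ?_
  rw [h2, min_eq_left hp.2.le, max_eq_right hp.2.le, ← eq_key]

theorem edgeId_inj {x y x' y' : ℕ} (hxy : Adj x y) (hxy' : Adj x' y')
    (he : edgeId n M Y x y = edgeId n M Y x' y') : x = x' ∧ y = y' ∨ x = y' ∧ y = x' := by
  have h1 := (h.edgeId_spec hxy).2
  rw [he, (h.edgeId_spec hxy').2] at h1
  have h2 := congrArg (· / n) h1
  have h3 := congrArg (· % n) h1
  simp only [h.div_eq (h.adj_min_max hxy), h.div_eq (h.adj_min_max hxy'),
    h.mod_eq (h.adj_min_max hxy), h.mod_eq (h.adj_min_max hxy')] at h2 h3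
  omega

theorem ident_eq {ident : ℕ → ℕ} (hI : IsIdent n M Y ident) {p : ℕ} (hp : p < M) :
    ident p = edgeId n M Y (Y p / n) (Y p % n) := by
  obtain ⟨h1, h2⟩ := hI p hp
  obtain ⟨h3, h4⟩ := h.edgeId_spec (h.adj hp)
  refine h.inj h1 h3 ?_
  rw [h2, h4]
  split_ifs with hlt
  · rw [min_eq_left hlt.le, max_eq_right hlt.le, ← eq_key]
  · rw [min_eq_right (by omega), max_eq_left (by omega), swapKey]

theorem ident_eq_self {ident : ℕ → ℕ} (hI : IsIdent n M Y ident) {p : ℕ} (hp : p < M) :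
    ident p = p ↔ p ∈ edgeIds n M Y := by
  rw [h.ident_eq hI hp]
  constructor
  · intro he
    rw [← he]
    exact h.edgeId_mem (h.adj hp)
  · exact h.edgeId_eq

theorem triangles_subset {τ : Finset ℕ} (hτ : τ ∈ triangles n M Y Adj) : τ ⊆ edgeIds n M Y := by
  obtain ⟨x, y, w, h1, h2, h3, rfl⟩ := (mem_triangles h).1 hτ
  intro e he
  simp only [Finset.mem_insert, Finset.mem_singleton] at he
  rcases he with rfl | rfl | rfl
  exacts [h.edgeId_mem h1, h.edgeId_mem h2, h.edgeId_mem h3]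

/-- The triangles at an edge correspond to the common neighbours of its ends. -/
theorem mem_triangles_edge {x y : ℕ} (hxy : Adj x y) {τ : Finset ℕ} :
    τ ∈ triangles n M Y Adj ∧ edgeId n M Y x y ∈ τ ↔ ∃ w, Adj x w ∧ Adj y w ∧
      τ = {edgeId n M Y x y, edgeId n M Y x w, edgeId n M Y y w} := by
  constructor
  · rintro ⟨hτ, he⟩
    obtain ⟨a, b, c, h1, h2, h3, rfl⟩ := (mem_triangles h).1 hτ
    simp only [Finset.mem_insert, Finset.mem_singleton] at he
    rcases he with he | he | he
    · rcases h.edgeId_inj hxy h1 he with ⟨rfl, rfl⟩ | ⟨rfl, rfl⟩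
      · exact ⟨c, h2, h3, rfl⟩
      · refine ⟨c, h3, h2, ?_⟩
        rw [edgeId_comm n M Y y x]; ext e; simp only [Finset.mem_insert, Finset.mem_singleton]; tauto
    · rcases h.edgeId_inj hxy h2 he with ⟨rfl, rfl⟩ | ⟨rfl, rfl⟩
      · refine ⟨b, h1, h.symm _ _ h3, ?_⟩
        rw [edgeId_comm n M Y b y]; ext e; simp only [Finset.mem_insert, Finset.mem_singleton]; tauto
      · refine ⟨b, h.symm _ _ h3, h1, ?_⟩
        rw [edgeId_comm n M Y b x, edgeId_comm n M Y y x]; ext e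
        simp only [Finset.mem_insert, Finset.mem_singleton]; tauto
    · rcases h.edgeId_inj hxy h3 he with ⟨rfl, rfl⟩ | ⟨rfl, rfl⟩
      · refine ⟨a, h.symm _ _ h1, h.symm _ _ h2, ?_⟩
        rw [edgeId_comm n M Y a x, edgeId_comm n M Y a y]; ext e
        simp only [Finset.mem_insert, Finset.mem_singleton]; tauto
      · refine ⟨a, h.symm _ _ h2, h.symm _ _ h1, ?_⟩
        rw [edgeId_comm n M Y a x, edgeId_comm n M Y a y, edgeId_comm n M Y y x]; ext e
        simp only [Finset.mem_insert, Finset.mem_singleton]; tauto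
  · rintro ⟨w, h1, h2, rfl⟩
    exact ⟨(mem_triangles h).2 ⟨x, y, w, hxy, h1, h2, rfl⟩, by simp⟩

theorem triangle_inj {x y w w' : ℕ} (hxy : Adj x y) (h1 : Adj x w) (h2 : Adj y w) (h3 : Adj x w')
    (h4 : Adj y w') (he : ({edgeId n M Y x y, edgeId n M Y x w, edgeId n M Y y w} : Finset ℕ) =
      {edgeId n M Y x y, edgeId n M Y x w', edgeId n M Y y w'}) : w = w' := by
  have hw : edgeId n M Y x w ∈
      ({edgeId n M Y x y, edgeId n M Y x w', edgeId n M Y y w'} : Finset ℕ) := by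
    rw [← he]; simp
  have n1 := h.ne hxy
  have n2 := h.ne h1
  have n3 := h.ne h2
  have n4 := h.ne h3
  simp only [Finset.mem_insert, Finset.mem_singleton] at hw
  rcases hw with hw | hw | hw
  · have := h.edgeId_inj h1 hxy hw; omega
  · have := h.edgeId_inj h1 h3 hw; omega
  · have := h.edgeId_inj h1 h4 hw; omega

/-- The pairs of slots at `x` and `y` with the same end `w` correspond to the triangles at the edge
between `x` and `y`. -/
theorem star_of_slots {ident : ℕ → ℕ} (hI : IsIdent n M Y ident) {x y : ℕ} (hxy : Adj x y)
    {l : List (ℕ × ℕ)} (hl : l.Nodup) (hmem : ∀ q r, (q, r) ∈ l ↔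
      (q < M ∧ Y q / n = x) ∧ (r < M ∧ Y r / n = y) ∧ Y q % n = Y r % n) :
    Star (edgeIds n M Y) (triangles n M Y Adj) (edgeId n M Y x y)
      (l.map fun qr => (ident qr.1, ident qr.2)) := by
  have key : ∀ q r, (q, r) ∈ l → Adj x (Y q % n) ∧ Adj y (Y q % n) ∧
      ident q = edgeId n M Y x (Y q % n) ∧ ident r = edgeId n M Y y (Y q % n) := by
    intro q r hqr
    obtain ⟨⟨hq, hqx⟩, ⟨hr, hry⟩, hqr⟩ := (hmem q r).1 hqr
    have h1 := h.adj hq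
    have h2 := h.adj hr
    have h3 := h.ident_eq hI hq
    have h4 := h.ident_eq hI hr
    rw [hqx] at h1 h3
    rw [hry, ← hqr] at h2 h4
    exact ⟨h1, h2, h3, h4⟩
  have n1 := h.ne hxy
  refine ⟨?_, ?_, ?_, ?_⟩
  · simp only [List.mem_map, Prod.exists, forall_exists_index, and_imp]
    rintro _ q r hqr rfl
    obtain ⟨h1, h2, h3, h4⟩ := key q r hqr
    have n2 := h.ne h1
    have n3 := h.ne h2
    rw [h3, h4]
    refine ⟨fun he => ?_, fun he => ?_, fun he => ?_⟩
    · have := h.edgeId_inj h1 hxy he; omega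
    · have := h.edgeId_inj h2 hxy he; omega
    · have := h.edgeId_inj h1 h2 he; omega
  · simp only [List.mem_map, Prod.exists, forall_exists_index, and_imp]
    rintro _ q r hqr rfl
    obtain ⟨h1, h2, h3, h4⟩ := key q r hqr
    rw [h3, h4]
    exact ⟨h.edgeId_mem h1, h.edgeId_mem h2⟩
  · rw [List.map_map]
    refine hl.map_on ?_
    rintro ⟨q, r⟩ hqr ⟨q', r'⟩ hqr' he
    obtain ⟨h1, h2, h3, h4⟩ := key q r hqr
    obtain ⟨h1', h2', h3', h4'⟩ := key q' r' hqr'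
    simp only [comp_apply, tri, h3, h4, h3', h4'] at he
    have hw := h.triangle_inj hxy h1 h2 h1' h2' he
    obtain ⟨⟨a1, a2⟩, ⟨a3, a4⟩, a5⟩ := (hmem q r).1 hqr
    obtain ⟨⟨b1, b2⟩, ⟨b3, b4⟩, b5⟩ := (hmem q' r').1 hqr'
    rw [Prod.mk.injEq]
    constructor
    · refine h.inj a1 b1 ?_
      rw [eq_key n (Y q), eq_key n (Y q'), a2, b2, hw]
    · refine h.inj a3 b3 ?_
      rw [eq_key n (Y r), eq_key n (Y r'), a4, b4, ← a5, ← b5, hw]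
  · intro τ
    rw [h.mem_triangles_edge hxy]
    simp only [List.mem_map, Prod.exists]
    constructor
    · rintro ⟨w, h1, h2, rfl⟩
      obtain ⟨q, hq, -, hq1, hq2⟩ := h.exists_slot h1
      obtain ⟨r, hr, -, hr1, hr2⟩ := h.exists_slot h2
      have hqr : (q, r) ∈ l := (hmem q r).2 ⟨⟨hq, hq1⟩, ⟨hr, hr1⟩, by rw [hq2, hr2]⟩
      obtain ⟨-, -, h3, h4⟩ := key q r hqr
      exact ⟨_, _, ⟨q, r, hqr, rfl⟩, by rw [tri, h3, h4, hq2]⟩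
    · rintro ⟨_, _, ⟨q, r, hqr, he⟩, rfl⟩
      obtain ⟨h1, h2, h3, h4⟩ := key q r hqr
      simp only [Prod.mk.injEq] at he
      exact ⟨Y q % n, h1, h2, by rw [tri, ← he.1, ← he.2, h3, h4]⟩

end Keys

/-! ### The triangles at an edge -/

/-- The smallest step length `st` for which `st` squared times the length of the first row is at
least the length of the second row. -/
def stepLength : Cmd :=
  .asg .st 1 ;; .whl (.lt (§.st * §.st * (§.hx - §.ix)) (§.hy - §.jy)) (.asg .st (§.st + 1))

/-- List the triangles at the edge between `x` and `y`, where `x` has the shorter row. -/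
def starRows : Cmd :=
  .asg .ix (arr .lo §.x) ;; .asg .hx (arr .hi §.x) ;;
  .asg .jy (arr .lo §.y) ;; .asg .hy (arr .hi §.y) ;;
  stepLength ;; intersect

/-- List the triangles at the edge `g`. -/
def star : Cmd :=
  .asg .x (arr .buf §.g / §.n) ;; .asg .y (arr .buf §.g % §.n) ;;
  .ite (.lt (arr .hi §.y - arr .lo §.y) (arr .hi §.x - arr .lo §.x))
    (.asg .t §.x ;; .asg .x §.y ;; .asg .y §.t) .skip ;;
  starRows

/-- The bound on the time for listing the triangles at the edge of a slot: essentially the geometric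
mean of the degrees of its ends. -/
def weight (n : ℕ) (Y lo hi : ℕ → ℕ) (p : ℕ) : ℕ :=
  Nat.sqrt (4 * ((hi (Y p / n) - lo (Y p / n)) * (hi (Y p % n) - lo (Y p % n))))

section

variable {P : Inst} {Γ : Ctx} {s M T n : ℕ} {σ : Store} {Y ident lo hi : ℕ → ℕ}

/-- The step length `st` satisfies `(st - 1) ^ 2 * d₁ < d₂` unless it is `1`, and `st ≤ 2 * (st - 1)`, so
that `st * d₁` is at most the square root of `4 * d₁ * d₂`. -/
theorem stepLength_spec (hP : P.Fits Γ) {d₁ d₂ : ℕ} (h₁ : σ.v .hx - σ.v .ix = d₁)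
    (h₂ : σ.v .hy - σ.v .jy = d₂) (hd₁ : 1 ≤ d₁) (hd : d₁ ≤ d₂) (hd₂ : d₂ ≤ 2 * P.m)
    (hT : 30 * (Nat.sqrt (4 * (d₁ * d₂)) + 1) ≤ T) :
    wp Γ stepLength (fun σ' T' => T ≤ T' + 30 * (Nat.sqrt (4 * (d₁ * d₂)) + 1) ∧
      1 ≤ σ'.v .st ∧ σ'.v .st ≤ 2 * P.m + 1 ∧ d₂ ≤ σ'.v .st * σ'.v .st * d₁ ∧
      σ'.v .st * d₁ ≤ Nat.sqrt (4 * (d₁ * d₂))) σ T := by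
  have hlin := hP.lin
  have hsq : ∀ r, (r + 1) * (r + 1) * d₁ < d₂ → (r + 2) * d₁ ≤ Nat.sqrt (4 * (d₁ * d₂)) := by
    intro r hr
    rw [Nat.le_sqrt]
    calc (r + 2) * d₁ * ((r + 2) * d₁)
        ≤ (2 * (r + 1)) * d₁ * ((2 * (r + 1)) * d₁) := by gcongr <;> omega
      _ = 4 * (d₁ * ((r + 1) * (r + 1) * d₁)) := by ring
      _ ≤ 4 * (d₁ * d₂) := by gcongr
  have hsq0 : 1 * d₁ ≤ Nat.sqrt (4 * (d₁ * d₂)) := by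
    rw [Nat.le_sqrt]
    have : d₁ * d₁ ≤ d₁ * d₂ := Nat.mul_le_mul le_rfl hd
    rw [one_mul]; omega
  refine wp_seq <| wp_asg 1 ?_ <| wp_whl (fun σ' T' => ∃ r, σ'.v .st = r + 1 ∧
    T ≤ T' + 30 * r + 2 ∧ (r = 0 ∨ r * r * d₁ < d₂)) ?_ ?_
  · simp; omega
  · exact ⟨0, by simp, by simp; omega, .inl rfl⟩
  · rintro σ' T' hf ⟨r, h3, h4, h5⟩
    have h₁' : σ'.v .hx - σ'.v .ix = d₁ := by
      rw [← h₁, hf.v .hx rfl, hf.v .ix rfl]; simp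
    have h₂' : σ'.v .hy - σ'.v .jy = d₂ := by
      rw [← h₂, hf.v .hy rfl, hf.v .jy rfl]; simp
    have hr1 : (r + 1) * d₁ ≤ Nat.sqrt (4 * (d₁ * d₂)) ∧ r ≤ 2 * P.m ∧
        (r + 1) * (r + 1) * d₁ ≤ 4 * (4 * P.m) := by
      rcases h5 with rfl | h5
      · exact ⟨hsq0, by omega, by omega⟩
      · obtain ⟨r, rfl⟩ | rfl : (∃ r', r = r' + 1) ∨ r = 0 := by
          rcases r with _ | r
          exacts [.inr rfl, .inl ⟨r, rfl⟩]
        · have a1 : (r + 1) * (r + 1) * 1 ≤ (r + 1) * (r + 1) * d₁ := Nat.mul_le_mul le_rfl hd₁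
          have a2 : (r + 1) * 1 ≤ (r + 1) * (r + 1) := Nat.mul_le_mul le_rfl (by omega)
          refine ⟨hsq r h5, by omega, ?_⟩
          calc (r + 1 + 1) * (r + 1 + 1) * d₁ ≤ (2 * (r + 1)) * (2 * (r + 1)) * d₁ := by
                gcongr <;> omega
            _ = 4 * ((r + 1) * (r + 1) * d₁) := by ring
            _ ≤ 4 * (4 * P.m) := by omega
        · exact ⟨hsq0, by omega, by omega⟩
    obtain ⟨hr1, hr2, hr3⟩ := hr1
    have hr4 : (r + 1) * 1 ≤ (r + 1) * d₁ := Nat.mul_le_mul le_rfl hd₁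
    have hr5 : (r + 1) * (r + 1) * 1 ≤ (r + 1) * (r + 1) * d₁ := Nat.mul_le_mul le_rfl hd₁
    have hm := hP.m_pos
    refine ⟨by simp [h3, h₁']; omega, fun hq => ?_, fun hq => ?_⟩
    · have hq : (r + 1) * (r + 1) * d₁ < d₂ := by simpa [h3, h₁', h₂'] using hq
      have := hsq r hq
      have hr6 : (r + 2) * 1 ≤ (r + 2) * d₁ := Nat.mul_le_mul le_rfl hd₁
      refine wp_asg (r + 2) ?_ ⟨r + 1, by simp, by simp; omega, .inr hq⟩
      simp [h3]; omega
    · have hq : d₂ ≤ (r + 1) * (r + 1) * d₁ := by simpa [h3, h₁', h₂'] using hq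
      exact ⟨by simp; omega, by omega, by omega, by rwa [h3], by rwa [h3]⟩

theorem Rows.mem {Adj : ℕ → ℕ → Prop} (hK : Keys n M Y Adj) (h : Rows n M Y lo hi) {x y q : ℕ}
    (hxy : Adj x y) : lo x ≤ q ∧ q < hi x ↔ q < M ∧ Y q / n = x := by
  obtain ⟨p, hp, -, rfl, -⟩ := hK.exists_slot hxy
  constructor
  · rintro ⟨h1, h2⟩
    exact ⟨h2.trans_le (h.hi_le p hp), h.row p hp q h1 h2⟩
  · rintro ⟨h1, h2⟩
    rw [← h2]
    exact ⟨h.lo_le q h1, h.lt_hi q h1⟩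

theorem Rows.mono {Adj : ℕ → ℕ → Prop} (hK : Keys n M Y Adj) (h : Rows n M Y lo hi) {x y : ℕ}
    (hxy : Adj x y) {q r : ℕ} (hq : lo x ≤ q) (hqr : q < r) (hr : r < hi x) :
    Y q % n < Y r % n := by
  have h1 := (h.mem hK hxy).1 ⟨hq, hqr.trans hr⟩
  have h2 := (h.mem hK hxy).1 ⟨by omega, hr⟩
  have h3 := hK.mono q r hqr h2.1
  rw [Keys.eq_key n (Y q), Keys.eq_key n (Y r), h1.2, h2.2] at h3
  omega

theorem starRows_spec (hP : P.Fits Γ) (hE : Env P s σ) {Adj : ℕ → ℕ → Prop}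
    (hK : Keys P.n M Y Adj) (hR : Rows P.n M Y lo hi) (hI : IsIdent P.n M Y ident)
    (hM' : M ≤ 2 * P.m) (hY : σ.a .buf = Y) (hlo : σ.a .lo = lo) (hhi : σ.a .hi = hi)
    (hid : σ.a .ident = ident) {x y : ℕ} (hx : σ.v .x = x) (hy : σ.v .y = y) (hxy : Adj x y)
    (hd : hi x - lo x ≤ hi y - lo y) {w : ℕ}
    (hw : w = Nat.sqrt (4 * ((hi x - lo x) * (hi y - lo y)))) (hT : 300 * (w + 1) ≤ T) :
    wp Γ starRows (fun σ' T' => T ≤ T' + 300 * (w + 1) ∧ σ'.v .c ≤ w ∧ ∃ l : List (ℕ × ℕ),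
      Star (edgeIds P.n M Y) (triangles P.n M Y Adj) (edgeId P.n M Y x y) l ∧
      pre (σ'.a .tri₁) (σ'.v .c) = l.map Prod.fst ∧
      pre (σ'.a .tri₂) (σ'.v .c) = l.map Prod.snd) σ T := by
  have hlin := hP.lin
  have hN := hP.N
  have hnm := hP.n_le
  have hxn := hK.lt _ _ hxy
  have hyn := hK.lt' hxy
  have hlen : ∀ {x y}, Adj x y → lo x < hi x ∧ hi x ≤ 2 * P.m := by
    intro x y hxy
    obtain ⟨p, hp, -, rfl, -⟩ := hK.exists_slot hxy
    have h1 := hR.lo_le p hp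
    have h2 := hR.lt_hi p hp
    have h3 := hR.hi_le p hp
    omega
  have hlx := hlen hxy
  have hly := hlen (hK.symm _ _ hxy)
  refine wp_seq <| wp_asg (lo x) ?_ <| wp_seq <| wp_asg (hi x) ?_ <| wp_seq <|
    wp_asg (lo y) ?_ <| wp_seq <| wp_asg (hi y) ?_ <| wp_seq <|
    wp_mono (stepLength_spec hP (d₁ := hi x - lo x) (d₂ := hi y - lo y) (by simp) (by simp)
      (by omega) hd (by omega) (by simp; omega)) ?_
  any_goals simp [hlo, hhi, hx, hy]; omega
  rintro σ' T' hf ⟨h1, h2, h3, h4, h5⟩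
  rw [← hw] at h1 h5
  generalize hst : σ'.v .st = st at *
  have hE' : Env P s σ' := ((((hE.setV (by simp)).setV (by simp)).setV (by simp)).setV
    (by simp)).frame hf rfl
  refine wp_mono (intersect_spec hP hE' (Y := Y) (ident := ident) (a := lo x) (a' := hi x)
    (b := lo y) (b' := hi y) (st := st) ?_ ?_ ?_ ?_ ?_ ?_ hst hlx.1.le hly.1.le hlx.2 hly.2 h2 h3 h4
    (fun p q => hR.mono hK hxy) (fun p q => hR.mono hK (hK.symm _ _ hxy)) ?_) ?_
  · simpa [hY] using hf.a .buf rfl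
  · simpa [hid] using hf.a .ident rfl
  · simpa using hf.v .ix rfl
  · simpa using hf.v .hx rfl
  · simpa using hf.v .jy rfl
  · simpa using hf.v .hy rfl
  · simp at h1; omega
  · rintro σ'' T'' hf' ⟨h6, h7, l, h8, h9, h10, h11⟩
    refine ⟨by simp at h1; omega, by omega, _, hK.star_of_slots hI hxy h8 fun q r => ?_, ?_, ?_⟩
    · rw [h9, ← hR.mem hK hxy, ← hR.mem hK (hK.symm _ _ hxy)]
      tauto
    · rw [h10, List.map_map]; rfl
    · rw [h11, List.map_map]; rfl

theorem star_spec (hP : P.Fits Γ) (hE : Env P s σ) {Adj : ℕ → ℕ → Prop}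
    (hK : Keys P.n M Y Adj) (hR : Rows P.n M Y lo hi) (hI : IsIdent P.n M Y ident)
    (hM' : M ≤ 2 * P.m) (hY : σ.a .buf = Y) (hlo : σ.a .lo = lo) (hhi : σ.a .hi = hi)
    (hid : σ.a .ident = ident) {g : ℕ} (hg : σ.v .g = g) (hgE : g ∈ edgeIds P.n M Y)
    (hT : 400 * (weight P.n Y lo hi g + 1) ≤ T) :
    wp Γ star (fun σ' T' => T ≤ T' + 400 * (weight P.n Y lo hi g + 1) ∧
      σ'.v .c ≤ weight P.n Y lo hi g ∧ ∃ l : List (ℕ × ℕ),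
      Star (edgeIds P.n M Y) (triangles P.n M Y Adj) g l ∧
      pre (σ'.a .tri₁) (σ'.v .c) = l.map Prod.fst ∧
      pre (σ'.a .tri₂) (σ'.v .c) = l.map Prod.snd) σ T := by
  have hlin := hP.lin
  have hN := hP.N
  have hnm := hP.n_le
  have hgM : g < M := by
    rw [edgeIds, Finset.mem_filter, Finset.mem_range] at hgE; exact hgE.1
  have hxy := hK.adj hgM
  have hge := hK.edgeId_eq hgE
  have hxn := hK.lt _ _ hxy
  have hyn := hK.lt' hxy
  have hw : weight P.n Y lo hi g = Nat.sqrt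
    (4 * ((hi (Y g / P.n) - lo (Y g / P.n)) * (hi (Y g % P.n) - lo (Y g % P.n)))) := rfl
  generalize weight P.n Y lo hi g = w at *
  generalize hgx : Y g / P.n = x at *
  generalize hgy : Y g % P.n = y at *
  have hn0 : P.n ≠ 0 := by omega
  refine wp_seq <| wp_asg x ?_ <| wp_seq <| wp_asg y ?_ <| wp_seq <| wp_ite ?_
    (fun hq => wp_seq <| wp_asg x ?_ <| wp_seq <| wp_asg y ?_ <| wp_asg x ?_ ?_)
    (fun hq => wp_skip ?_ ?_)
  any_goals
    simp [hY, hlo, hhi, hg, hgx, hgy, hE.n] <;> omega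
  · have hq : hi y - lo y < hi x - lo x := by
      by_contra hc
      exact hq (by simp [hlo, hhi]; omega)
    refine wp_mono (starRows_spec hP (((((hE.setV (by simp)).setV (by simp)).setV (by simp)).setV
      (by simp)).setV (by simp)) hK hR hI hM' (by simpa using hY) (by simpa using hlo)
      (by simpa using hhi) (by simpa using hid) (x := y) (y := x) (by simp) (by simp)
      (hK.symm _ _ hxy) hq.le (w := w) (by rw [hw, mul_comm (hi y - _)]) (by simp; omega)) ?_
    rintro σ' T' hf ⟨h1, h2, l, h3, h4⟩
    refine ⟨by simp at h1; linarith, h2, l, ?_, h4⟩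
    rwa [edgeId_comm, hge] at h3
  · have hq : hi x - lo x ≤ hi y - lo y := by simpa [hlo, hhi] using hq
    refine wp_mono (starRows_spec hP ((hE.setV (by simp)).setV (by simp)) hK hR hI hM'
      (by simpa using hY) (by simpa using hlo)
      (by simpa using hhi) (by simpa using hid) (x := x) (y := y) (by simp) (by simp)
      hxy hq (w := w) hw (by simp; omega)) ?_
    rintro σ' T' hf ⟨h1, h2, l, h3, h4⟩
    refine ⟨by simp at h1; linarith, h2, l, ?_, h4⟩
    rwa [hge] at h3

end

/-! ### The peeling program -/

/-- Compute the supports of all edges, and put those edges into the queue that have too small a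
support; `f` counts the edges. -/
def peelInit : Cmd :=
  .asg .qt 0 ;; .asg .f 0 ;; .asg .e 0 ;;
  .whl (.lt §.e §.size) (
    .sto .flag §.e 0 ;;
    .ite (.eq (arr .ident §.e) §.e) (
      .asg .f (§.f + 1) ;; .asg .g §.e ;; star ;; .sto .sup §.e §.c ;;
      .ite (.lt §.c (§.k - 2))
        (.sto .flag §.e 1 ;; .sto .queue §.qt §.e ;; .asg .qt (§.qt + 1)) .skip)
      .skip ;;
    .asg .e (§.e + 1))

/-- Decrease the counter of the edge `z`, and put the edge into the queue if necessary.  For `k ≤ 2`,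
the truncated difference `k - 2` is `0`, and no edge is ever removed. -/
def decr : Cmd :=
  .sto .sup §.z (arr .sup §.z - 1) ;;
  .ite (.cond (.eq (arr .flag §.z) 0) (.lt (arr .sup §.z) (§.k - 2)) 0)
    (.sto .flag §.z 1 ;; .sto .queue §.qt §.z ;; .asg .qt (§.qt + 1)) .skip

/-- Remove the `j`-th triangle at the edge `g`, unless it has been removed before, that is, unless one
of its other edges has been removed completely.  An edge that merely waits in the queue does not
matter. -/
def dropTriangle : Cmd :=
  .asg .e₁ (arr .tri₁ §.j) ;; .asg .e₂ (arr .tri₂ §.j) ;;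
  .ite (.cond (.eq (arr .flag §.e₁) 2) 0 (.cond (.eq (arr .flag §.e₂) 2) 0 1))
    (.asg .z §.g ;; decr ;; .asg .z §.e₁ ;; decr ;; .asg .z §.e₂ ;; decr) .skip

/-- Remove all triangles at the edge `g`. -/
def dropTriangles : Cmd :=
  .asg .j 0 ;; .whl (.lt §.j §.c) (dropTriangle ;; .asg .j (§.j + 1))

/-- Remove the edges in the queue; in the end, `f` is the number of edges that are left. -/
def peelLoop : Cmd :=
  .asg .qh 0 ;;
  .whl (.lt §.qh §.qt) (
    .asg .g (arr .queue §.qh) ;; star ;;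
    dropTriangles ;;
    .sto .flag §.g 2 ;; .asg .qh (§.qh + 1)) ;;
  .asg .f (§.f - §.qt)

/-- The graph with adjacency `Adj`, stored as the increasing list `Y` of its `M` directed edges, with
the rows and the representatives of the undirected edges. -/
structure Table (P : Inst) (M : ℕ) (Y lo hi ident : ℕ → ℕ) (Adj : ℕ → ℕ → Prop) : Prop where
  keys : Keys P.n M Y Adj
  rows : Rows P.n M Y lo hi
  isIdent : IsIdent P.n M Y ident
  le : M ≤ 2 * P.m

/-- The data of a `Table` are in the store. -/
structure Holds (P : Inst) (s M : ℕ) (Y lo hi ident : ℕ → ℕ) (σ : Store) : Prop extends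
    Env P s σ where
  size : σ.v .size = M
  buf : σ.a .buf = Y
  lo : σ.a .lo = lo
  hi : σ.a .hi = hi
  ident : σ.a .ident = ident

section

variable {P : Inst} {Γ : Ctx} {s M T : ℕ} {σ σ' : Store} {Y ident lo hi : ℕ → ℕ}
  {Adj : ℕ → ℕ → Prop}

theorem Holds.frame {c : Cmd} (h : Holds P s M Y lo hi ident σ) (hf : Frame c σ σ')
    (hc : (c.modV .n || c.modV .m || c.modV .k || c.modV .b || c.modV .base) = false)
    (hs : c.modV .size = false)
    (ha : (c.modA .buf || c.modA .lo || c.modA .hi || c.modA .ident) = false) :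
    Holds P s M Y lo hi ident σ' := by
  simp only [Bool.or_eq_false_iff] at ha
  exact ⟨h.toEnv.frame hf hc, by rw [hf.v _ hs, h.size], by rw [hf.a _ ha.1.1.1, h.buf],
    by rw [hf.a _ ha.1.1.2, h.lo], by rw [hf.a _ ha.1.2, h.hi], by rw [hf.a _ ha.2, h.ident]⟩

theorem Holds.setV (h : Holds P s M Y lo hi ident σ) {x : Var} {z : ℕ}
    (hx : (x = .n ∨ x = .m ∨ x = .k ∨ x = .b ∨ x = .base) = False) (hs : (x = .size) = False) :
    Holds P s M Y lo hi ident (σ.setV x z) := by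
  simp only [eq_iff_iff, iff_false] at hs
  exact ⟨h.toEnv.setV hx, by rw [σ.setV_v_of_ne _ _ _ (Ne.symm hs), h.size], h.buf, h.lo, h.hi,
    h.ident⟩

theorem Holds.setA (h : Holds P s M Y lo hi ident σ) {x : Arr} {i z : ℕ}
    (hx : (x = .buf ∨ x = .lo ∨ x = .hi ∨ x = .ident) = False) :
    Holds P s M Y lo hi ident (σ.setA x i z) := by
  simp only [eq_iff_iff, iff_false, not_or] at hx
  exact ⟨h.toEnv.setA, h.size, by rw [σ.setA_a_of_ne _ _ _ _ (Ne.symm hx.1), h.buf],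
    by rw [σ.setA_a_of_ne _ _ _ _ (Ne.symm hx.2.1), h.lo],
    by rw [σ.setA_a_of_ne _ _ _ _ (Ne.symm hx.2.2.1), h.hi],
    by rw [σ.setA_a_of_ne _ _ _ _ (Ne.symm hx.2.2.2), h.ident]⟩

theorem mem_edgeIds_lt {n e : ℕ} (he : e ∈ edgeIds n M Y) : e < M := by
  rw [edgeIds, Finset.mem_filter, Finset.mem_range] at he
  exact he.1

theorem Table.weight_le (h : Table P M Y lo hi ident Adj) {e : ℕ} (he : e < M) :
    weight P.n Y lo hi e ≤ 4 * P.m := by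
  have hxy := h.keys.adj he
  have key : ∀ x y, Adj x y → hi x - lo x ≤ 2 * P.m := by
    intro x y hxy
    obtain ⟨p, hp, -, rfl, -⟩ := h.keys.exists_slot hxy
    have := h.rows.hi_le p hp
    have := h.le
    omega
  have h1 := key _ _ hxy
  have h2 := key _ _ (h.keys.symm _ _ hxy)
  rw [weight, show 4 * P.m = Nat.sqrt ((4 * P.m) * (4 * P.m)) from (Nat.sqrt_eq _).symm]
  refine Nat.sqrt_le_sqrt ?_
  calc _ ≤ 4 * (2 * P.m * (2 * P.m)) := Nat.mul_le_mul le_rfl (Nat.mul_le_mul h1 h2)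
    _ = _ := by ring

/-- The time for peeling, up to a constant factor. -/
def totalWeight (n M : ℕ) (Y lo hi : ℕ → ℕ) : ℕ := ∑ e ∈ Finset.range M, (weight n Y lo hi e + 1)

/-- The state of the peeling process is in the store. -/
structure Peeling (E : Finset ℕ) (𝒯 : Finset (Finset ℕ)) (k : ℕ) (𝒜 done : Finset (Finset ℕ))
    (D : Finset ℕ) (Q : List ℕ) (σ : Store) : Prop where
  peel : Peel E 𝒯 k 𝒜 done D (σ.a .sup) (σ.a .flag) Q
  qt : σ.v .qt = Q.length
  queue : pre (σ.a .queue) Q.length = Q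

theorem peelInit_spec (hP : P.Fits Γ) (h : Table P M Y lo hi ident Adj)
    (hσ : Holds P s M Y lo hi ident σ) (hT : 600 * (totalWeight P.n M Y lo hi + 1) ≤ T) :
    wp Γ peelInit (fun σ' T' => T ≤ T' + 600 * (totalWeight P.n M Y lo hi + 1) ∧
      σ'.v .f = (edgeIds P.n M Y).card ∧ ∃ Q,
      Peeling (edgeIds P.n M Y) (triangles P.n M Y Adj) P.k (triangles P.n M Y Adj) ∅ ∅ Q σ' ∧
      ∀ e ∈ Q, σ'.a .flag e = 1) σ T := by
  have hlin := hP.lin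
  have hN := hP.N
  have hMm := h.le
  refine wp_seq <| wp_asg 0 ?_ <| wp_seq <| wp_asg 0 ?_ <| wp_seq <| wp_asg 0 ?_ <|
    wp_whl (fun σ' T' => σ'.v .e ≤ M ∧
      T ≤ T' + 600 * (∑ e ∈ Finset.range (σ'.v .e), (weight P.n Y lo hi e + 1)) + 20 ∧
      σ'.v .f = ((edgeIds P.n M Y).filter (· < σ'.v .e)).card ∧
      σ'.v .qt ≤ σ'.v .e ∧
      ((pre (σ'.a .queue) (σ'.v .qt)).Nodup ∧
      (∀ e, e ∈ pre (σ'.a .queue) (σ'.v .qt) ↔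
        e ∈ edgeIds P.n M Y ∧ e < σ'.v .e ∧ σ'.a .flag e ≠ 0) ∧
      ∀ e ∈ edgeIds P.n M Y, e < σ'.v .e →
        σ'.a .sup e = ((triangles P.n M Y Adj).filter fun τ => e ∈ τ).card ∧
        σ'.a .flag e = if σ'.a .sup e < P.k - 2 then 1 else 0)) ?_ ?_
  · simp; omega
  · simp; omega
  · simp; omega
  · simp; omega
  · rintro σ' T' hf ⟨h1, h2, h3, h4, h5, h6, h7⟩
    have hσ' := (((hσ.setV (x := .qt) (z := 0) (by simp) (by simp)).setV (x := .f) (z := 0) (by simp)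
      (by simp)).setV (x := .e) (z := 0) (by simp) (by simp)).frame hf rfl rfl rfl
    generalize hge : σ'.v .e = e at *
    generalize hgf : σ'.v .f = f at *
    generalize hgq : σ'.v .qt = q at *
    have hsum : e < M → ∑ e ∈ Finset.range (e + 1), (weight P.n Y lo hi e + 1) ≤
        totalWeight P.n M Y lo hi := fun he => by
      rw [totalWeight]
      exact Finset.sum_le_sum_of_subset (Finset.range_mono he)
    rw [Finset.sum_range_succ] at hsum
    generalize hgS : ∑ e ∈ Finset.range e, (weight P.n Y lo hi e + 1) = S at *
    have hS : e = M → S = totalWeight P.n M Y lo hi := by rintro rfl; exact hgS.symm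
    have hS' : e < M ∨ e = M := by omega
    refine ⟨by simp; omega, fun hq => ?_, fun hq => ?_⟩
    · have he : e < M := by simpa [hge, hσ'.size] using hq
      have hsum := hsum he
      have hw := h.weight_le he
      have hfe : f ≤ e := by
        refine h3.le.trans ((Finset.card_le_card (t := Finset.range e) fun e' he' => ?_).trans_eq
          (Finset.card_range e))
        rw [Finset.mem_filter] at he'
        exact Finset.mem_range.2 he'.2
      generalize hgw : weight P.n Y lo hi e = w at *
      have hid := h.keys.ident_eq_self h.isIdent he
      have hno : ∀ z, (e ∈ edgeIds P.n M Y → False) → ∀ e', e' ∈ edgeIds P.n M Y →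
          (e' < e + 1 ↔ e' < e) ∧ update (σ'.a .flag) e z e' = σ'.a .flag e' := by
        intro z hno e' he'
        have : e' ≠ e := by rintro rfl; exact hno he'
        exact ⟨by omega, update_of_ne this _ _⟩
      refine wp_seq <| wp_sto e 0 ?_ <| wp_seq <| wp_ite ?_ (fun hq => ?_)
        (fun hq => wp_skip ?_ <| wp_asg (e + 1) ?_ ?_)
      · simp [hge]; omega
      · simp [hge, hσ'.ident]; omega
      · have hq : e ∈ edgeIds P.n M Y := by simpa [hge, hσ'.ident, hid] using hq
        have hst := ((hσ'.setA (x := .flag) (i := e) (z := 0) (by simp)).setV (x := .f) (z := f + 1)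
          (by simp) (by simp)).setV (x := .g) (z := e) (by simp) (by simp)
        refine wp_seq <| wp_asg (f + 1) ?_ <| wp_seq <| wp_asg e ?_ <| wp_seq <|
          wp_mono (star_spec hP hst.toEnv h.keys h.rows h.isIdent h.le hst.buf hst.lo hst.hi hst.ident
            (g := e) (by simp) hq ?_) ?_
        any_goals simp [hge, hgf, hgw]; omega
        rintro σ₁ T₁ hf₁ ⟨b1, b2, l, b3, b4⟩
        have hσ₁ := hst.frame hf₁ rfl rfl rfl
        have hf' : σ₁.v .f = f + 1 := by simpa using hf₁.v .f rfl
        have he' : σ₁.v .e = e := by simpa [hge] using hf₁.v .e rfl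
        have hq' : σ₁.v .qt = q := by simpa [hgq] using hf₁.v .qt rfl
        have hfl : σ₁.a .flag = update (σ'.a .flag) e 0 := by simpa using hf₁.a .flag rfl
        have hsu : σ₁.a .sup = σ'.a .sup := by simpa using hf₁.a .sup rfl
        have hqu : σ₁.a .queue = σ'.a .queue := by simpa using hf₁.a .queue rfl
        have hcard := b3.card
        have hc : σ₁.v .c = l.length := by
          have := congrArg List.length b4.1
          simpa using this
        rw [hgw] at b1 b2
        rw [hc] at b2
        simp at b1
        have hcount : f + 1 = ((edgeIds P.n M Y).filter (· < e + 1)).card := by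
          rw [h3, show (edgeIds P.n M Y).filter (· < e + 1) =
            insert e ((edgeIds P.n M Y).filter (· < e)) from ?_, Finset.card_insert_of_notMem]
          · simp
          · ext e'
            simp only [Finset.mem_filter, Finset.mem_insert]
            constructor
            · rintro ⟨a1, a2⟩
              by_cases a3 : e' = e
              · exact .inl a3
              · exact .inr ⟨a1, by omega⟩
            · rintro (rfl | ⟨a1, a2⟩)
              · exact ⟨hq, by omega⟩
              · exact ⟨a1, by omega⟩
        have hmem : e ∉ pre (σ'.a .queue) q := by rw [h6]; omega
        refine wp_seq <| wp_sto e l.length ?_ <| wp_ite ?_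
          (fun hlt => wp_seq <| wp_sto e 1 ?_ <| wp_seq <| wp_sto q e ?_ <| wp_asg (q + 1) ?_ <|
            wp_asg (e + 1) ?_ ?_)
          (fun hlt => wp_skip ?_ <| wp_asg (e + 1) ?_ ?_)
        any_goals simp [he', hq', hc, hσ₁.k]; omega
        · have hlt : l.length < P.k - 2 := by
            by_contra hc
            exact hlt (by simp [hc, hσ₁.k]; omega)
          simp only [Store.setV_v_self, ne_eq, reduceCtorEq, not_false_eq_true, Store.setV_v_of_ne,
            Store.setV_a, Store.setA_v, Store.setA_a_self, Store.setA_a_of_ne, hf', he', hfl, hsu,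
            hqu, pre_update_succ, update_idem]
          rw [Finset.sum_range_succ, hgS, hgw]
          refine ⟨by omega, by simp; omega, hcount, by omega, ?_, fun e' => ?_, fun e' he' hlt' => ?_⟩
          · rw [List.nodup_append]
            exact ⟨h5, by simp, by rintro a ha b hb rfl; simp at hb; exact hmem (hb ▸ ha)⟩
          · rw [List.mem_append, List.mem_singleton, h6]
            by_cases hee : e' = e
            · subst hee; simpa using hq
            · rw [update_of_ne hee, show e' < e + 1 ↔ e' < e by omega]
              simp [hee]
          · by_cases hee : e' = e
            · subst hee
              simp [hlt, hcard]
              omega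
            · rw [update_of_ne hee, update_of_ne hee]
              exact h7 e' he' (by omega)
        · have hlt : ¬ l.length < P.k - 2 := by
            intro hc
            simp [hc, hσ₁.k] at hlt
            omega
          simp only [Store.setV_v_self, ne_eq, reduceCtorEq, not_false_eq_true, Store.setV_v_of_ne,
            Store.setV_a, Store.setA_v, Store.setA_a_self, Store.setA_a_of_ne, hf', he', hfl, hsu,
            hqu, hq']
          rw [Finset.sum_range_succ, hgS, hgw]
          refine ⟨by omega, by simp; omega, hcount, by omega, h5, fun e' => ?_, fun e' he' hlt' => ?_⟩
          · rw [h6]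
            by_cases hee : e' = e
            · subst hee; simp
            · rw [update_of_ne hee, show e' < e + 1 ↔ e' < e by omega]
          · by_cases hee : e' = e
            · subst hee
              simp [hlt, hcard]
              omega
            · rw [update_of_ne hee, update_of_ne hee]
              exact h7 e' he' (by omega)
      · simp; omega
      · simp [hge]; omega
      · have hq : e ∈ edgeIds P.n M Y → False := by simpa [hge, hσ'.ident, hid] using hq
        simp only [Store.setV_v_self, ne_eq, reduceCtorEq, not_false_eq_true, Store.setV_v_of_ne,
          Store.setV_a, Store.setA_v, Store.setA_a_self, Store.setA_a_of_ne, hgq, hgf]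
        have := hno 0 hq
        rw [Finset.sum_range_succ, hgS, hgw]
        refine ⟨by omega, by simp; omega, ?_, by omega, h5, ?_, ?_⟩
        · rw [h3]
          congr 1
          refine Finset.filter_congr fun e' he' => ((this e' he').1).symm
        · intro e'
          rw [h6]
          constructor
          · rintro ⟨a1, a2, a3⟩
            rw [(this e' a1).1, (this e' a1).2]
            exact ⟨a1, a2, a3⟩
          · rintro ⟨a1, a2, a3⟩
            rw [(this e' a1).1] at a2
            rw [(this e' a1).2] at a3
            exact ⟨a1, a2, a3⟩
        · intro e' he' hlt
          rw [(this e' he').1] at hlt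
          rw [(this e' he').2]
          exact h7 e' he' hlt
    · have he : e = M := by
        have : ¬ e < M := by simpa [hge, hσ'.size] using hq
        omega
      subst he
      have hlt : ∀ e' ∈ edgeIds P.n e Y, e' < e := fun e' => mem_edgeIds_lt
      have hall : ∀ e' ∈ edgeIds P.n e Y,
          σ'.a .sup e' = ((triangles P.n e Y Adj).filter fun τ => e' ∈ τ).card ∧
          σ'.a .flag e' = if σ'.a .sup e' < P.k - 2 then 1 else 0 :=
        fun e' he' => h7 e' he' (hlt e' he')
      rw [hS rfl] at h2
      refine ⟨by simp; omega, ?_, _, ⟨⟨fun τ => ?_, fun e' he' _ => ?_, fun e' he' hfl => ?_,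
        fun B hB hd e' he' => ?_, h5, fun e' => ?_, by simp⟩, ?_, ?_⟩, fun e' he' => ?_⟩
      · rw [h3, Finset.filter_true_of_mem hlt]
      · refine ⟨fun hτ => ⟨hτ, fun e' he' => ?_, by simp⟩, fun hτ => hτ.1⟩
        rw [(hall e' (h.keys.triangles_subset hτ he')).2]
        split_ifs <;> omega
      · simp [(hall e' he').1]
      · rw [(hall e' he').2] at hfl
        split_ifs at hfl
        omega
      · have h8 := hall e' (hB he')
        have h9 := hd e' he'
        rw [h8.2, if_neg]
        have : ((triangles P.n e Y Adj).filter fun τ => τ ⊆ B ∧ e' ∈ τ).card ≤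
            ((triangles P.n e Y Adj).filter fun τ => e' ∈ τ).card :=
          Finset.card_le_card fun τ => by simp only [Finset.mem_filter]; tauto
        omega
      · rw [h6]
        exact ⟨fun h => ⟨h.1, h.2.2⟩, fun h => ⟨h.1, hlt _ h.1, h.2⟩⟩
      · simpa using hgq
      · simp
      · have h8 := (h6 e').1 he'
        have h9 := (hall e' h8.1).2
        split_ifs at h9
        · exact h9
        · exact absurd h9 h8.2.2

/-- The effect of the removal of triangles on the queue and on the flags. -/
structure Later (Q Q' : List ℕ) (flag flag' : ℕ → ℕ) : Prop where
  pre : Q <+: Q'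
  step : ∀ e, flag' e = flag e ∨ flag e = 0 ∧ flag' e = 1

theorem Later.refl (Q : List ℕ) (flag : ℕ → ℕ) : Later Q Q flag flag :=
  ⟨List.prefix_rfl, fun _ => .inl rfl⟩

theorem Later.trans {Q Q' Q'' : List ℕ} {flag flag' flag'' : ℕ → ℕ} (h : Later Q Q' flag flag')
    (h' : Later Q' Q'' flag' flag'') : Later Q Q'' flag flag'' :=
  ⟨h.pre.trans h'.pre, fun e => by have := h.step e; have := h'.step e; omega⟩

theorem Later.one {Q Q' : List ℕ} {flag flag' : ℕ → ℕ} (h : Later Q Q' flag flag') {e : ℕ}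
    (he : flag e = 1) : flag' e = 1 := by
  have := h.step e; omega

theorem Later.two {Q Q' : List ℕ} {flag flag' : ℕ → ℕ} (h : Later Q Q' flag flag') (e : ℕ) :
    flag' e = 2 ↔ flag e = 2 := by
  have := h.step e; omega

variable {E : Finset ℕ} {𝒯 𝒜 done : Finset (Finset ℕ)} {D : Finset ℕ} {Q : List ℕ}

theorem Peel.length_le {k : ℕ} {sup flag : ℕ → ℕ} (h : Peel E 𝒯 k 𝒜 done D sup flag Q) {M : ℕ}
    (hE : ∀ e ∈ E, e < M) : Q.length ≤ M := by
  rw [← List.toFinset_card_of_nodup h.nodup, ← Finset.card_range M]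
  refine Finset.card_le_card fun e he => Finset.mem_range.2 (hE e ?_)
  exact ((h.mem_queue e).1 (List.mem_toFinset.1 he)).1

theorem Peeling.setV {k : ℕ} (h : Peeling E 𝒯 k 𝒜 done D Q σ) {x : Var} {z : ℕ} (hx : x ≠ .qt) :
    Peeling E 𝒯 k 𝒜 done D Q (σ.setV x z) :=
  ⟨h.peel, by rw [σ.setV_v_of_ne _ _ _ (Ne.symm hx), h.qt], h.queue⟩

theorem Peeling.frame {k : ℕ} {c : Cmd} (h : Peeling E 𝒯 k 𝒜 done D Q σ) (hf : Frame c σ σ')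
    (hq : c.modV .qt = false) (ha : (c.modA .sup || c.modA .flag || c.modA .queue) = false) :
    Peeling E 𝒯 k 𝒜 done D Q σ' := by
  simp only [Bool.or_eq_false_iff] at ha
  exact ⟨by rw [hf.a _ ha.1.1, hf.a _ ha.1.2]; exact h.peel, by rw [hf.v _ hq, h.qt],
    by rw [hf.a _ ha.2, h.queue]⟩

theorem decr_spec (hP : P.Fits Γ) (hσ : Env P s σ) (hE : ∀ e ∈ E, e < 2 * P.m)
    (h : Peeling E 𝒯 P.k 𝒜 done D Q σ) {z : ℕ} (hz : σ.v .z = z) (hzD : z ∈ D) (hzE : z ∈ E)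
    (hf : σ.a .flag z ≠ 2) (hT : 100 ≤ T) :
    wp Γ decr (fun σ' T' => T ≤ T' + 100 ∧ ∃ Q', Peeling E 𝒯 P.k 𝒜 done (D.erase z) Q' σ' ∧
      Later Q Q' (σ.a .flag) (σ'.a .flag)) σ T := by
  have hlin := hP.lin
  have hN := hP.N
  have hzm := hE z hzE
  have hql := h.peel.length_le hE
  have hk := hσ.k
  have hqt := h.qt
  refine wp_seq <| wp_sto z (σ.a .sup z - 1) ?_ <| wp_ite ?_
    (fun hq => wp_seq <| wp_sto z 1 ?_ <| wp_seq <| wp_sto Q.length z ?_ <|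
      wp_asg (Q.length + 1) ?_ ?_)
    (fun hq => wp_skip ?_ ?_)
  any_goals simp [hz, hqt, hk]; omega
  · have hq : σ.a .flag z = 0 ∧ σ.a .sup z - 1 + 2 < P.k := by
      by_contra hc
      refine hq ?_
      simp [hz, hk]
      omega
    refine ⟨by simp; omega, Q ++ [z],
      ⟨by simpa using h.peel.decr_of_lt hzD hzE hq.1 hq.2, by simp, ?_⟩, ?_⟩
    · simp [pre_update_of_le, h.queue]
    · refine ⟨List.prefix_append _ _, fun e => ?_⟩
      by_cases hez : e = z
      · subst hez; simp [hq.1]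
      · simp [update_of_ne hez]
  · have hq : ¬ (σ.a .flag z = 0 ∧ σ.a .sup z - 1 + 2 < P.k) := by
      rintro ⟨h1, h2⟩
      simp [hz, hk, h1] at hq
      omega
    refine ⟨by simp; omega, Q, ⟨?_, by simpa using h.qt, by simpa using h.queue⟩,
      by simpa using Later.refl _ _⟩
    simpa using h.peel.decr_of_ok hzD hzE hf (by omega)

end

section

variable {P : Inst} {Γ : Ctx} {s M T : ℕ} {σ σ' : Store} {Y ident lo hi : ℕ → ℕ}
  {Adj : ℕ → ℕ → Prop} {E : Finset ℕ} {𝒯 𝒜 done : Finset (Finset ℕ)} {D : Finset ℕ} {Q : List ℕ}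

/-- A triangle that has lost an edge need not be looked at. -/
theorem Peel.skip {k : ℕ} {sup flag : ℕ → ℕ} (h : Peel E 𝒯 k 𝒜 done D sup flag Q) {τ : Finset ℕ}
    (hf : ∃ e ∈ τ, flag e = 2) : Peel E 𝒯 k 𝒜 (insert τ done) D sup flag Q where
  mem τ' := by
    rw [h.mem, Finset.mem_insert]
    constructor
    · rintro ⟨h1, h2, h3⟩
      refine ⟨h1, h2, ?_⟩
      rintro (rfl | h4)
      · obtain ⟨e, he, hfe⟩ := hf
        exact h2 e he hfe
      · exact h3 h4
    · rintro ⟨h1, h2, h3⟩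
      exact ⟨h1, h2, fun h4 => h3 (.inr h4)⟩
  sup_eq := h.sup_eq
  enough := h.enough
  dense := h.dense
  nodup := h.nodup
  mem_queue := h.mem_queue
  done_flag τ' hτ' := by
    rcases Finset.mem_insert.1 hτ' with rfl | hτ'
    · obtain ⟨e, he, hfe⟩ := hf
      exact ⟨e, he, by rw [hfe]; decide⟩
    · exact h.done_flag _ hτ'

theorem dropTriangle_spec (hP : P.Fits Γ) (hσ : Env P s σ) (hE : ∀ e ∈ E, e < 2 * P.m)
    (h : Peeling E 𝒯 P.k 𝒜 done ∅ Q σ) {g j : ℕ} {q : ℕ × ℕ} (hg : σ.v .g = g) (hj : σ.v .j = j)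
    (hjN : j < Γ.N)
    (hq₁ : σ.a .tri₁ j = q.1) (hq₂ : σ.a .tri₂ j = q.2) (hgE : g ∈ E) (hqE : q.1 ∈ E ∧ q.2 ∈ E)
    (hne : q.1 ≠ g ∧ q.2 ≠ g ∧ q.1 ≠ q.2) (hτ : tri g q ∈ 𝒯) (hd : tri g q ∉ done)
    (hgf : σ.a .flag g = 1) (hT : 450 ≤ T) :
    wp Γ dropTriangle (fun σ' T' => T ≤ T' + 450 ∧ ∃ 𝒜' Q',
      Peeling E 𝒯 P.k 𝒜' (insert (tri g q) done) ∅ Q' σ' ∧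
      Later Q Q' (σ.a .flag) (σ'.a .flag)) σ T := by
  have hlin := hP.lin
  have hN := hP.N
  have h₁m := hE _ hqE.1
  have h₂m := hE _ hqE.2
  obtain ⟨e₁, e₂⟩ := q
  simp only at hq₁ hq₂ hqE hne h₁m h₂m
  refine wp_seq <| wp_asg e₁ ?_ <| wp_seq <| wp_asg e₂ ?_ <| wp_ite ?_ (fun hq => ?_)
    (fun hq => wp_skip ?_ ⟨by simp; omega, 𝒜, Q, ?_, by simpa using .refl _ _⟩)
  any_goals simp [hj, hq₁, hq₂]; omega
  · have hq : σ.a .flag e₁ ≠ 2 ∧ σ.a .flag e₂ ≠ 2 := by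
      by_contra hc
      refine hq ?_
      simp
      tauto
    have h𝒜 : tri g (e₁, e₂) ∈ 𝒜 := by
      refine (h.peel.mem _).2 ⟨hτ, fun e he => ?_, hd⟩
      simp only [tri, Finset.mem_insert, Finset.mem_singleton] at he
      rcases he with rfl | rfl | rfl
      exacts [by rw [hgf]; decide, hq.1, hq.2]
    have hgτ : g ∈ tri g (e₁, e₂) := by simp [tri]
    have h0 : Peeling E 𝒯 P.k (𝒜.erase (tri g (e₁, e₂))) (insert (tri g (e₁, e₂)) done)
        (tri g (e₁, e₂)) Q (((σ.setV .e₁ e₁).setV .e₂ e₂).setV .z g) :=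
      ⟨by simpa using h.peel.erase h𝒜 ⟨g, hgτ, by rw [hgf]; decide⟩, by simpa using h.qt,
        by simpa using h.queue⟩
    have hE0 := ((hσ.setV (x := .e₁) (z := e₁) (by simp)).setV (x := .e₂) (z := e₂) (by simp)).setV
      (x := .z) (z := g) (by simp)
    refine wp_seq <| wp_asg g ?_ <| wp_seq <|
      wp_mono (decr_spec hP hE0 hE h0 (z := g) (by simp) hgτ hgE (by simp [hgf]) (by simp; omega)) ?_
    · simp [hg]; omega
    rintro σ₁ T₁ hf₁ ⟨hT₁, Q₁, h1, l1⟩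
    have a1 : σ₁.v .e₁ = e₁ := by simpa using hf₁.v .e₁ rfl
    have a2 : σ₁.v .e₂ = e₂ := by simpa using hf₁.v .e₂ rfl
    have hE1 := (hE0.frame hf₁ rfl).setV (x := .z) (z := e₁) (by simp)
    simp at hT₁ l1
    refine wp_seq <| wp_asg e₁ ?_ <| wp_seq <|
      wp_mono (decr_spec hP hE1 hE (h1.setV (x := .z) (z := e₁) (by simp)) (z := e₁) (by simp)
        (by simp [tri, hne]) hqE.1 (by simp [l1.two, hq]) (by simp; omega)) ?_
    · simp [a1]; omega
    rintro σ₂ T₂ hf₂ ⟨hT₂, Q₂, h2, l2⟩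
    have b2 : σ₂.v .e₂ = e₂ := by simpa [a2] using hf₂.v .e₂ rfl
    have hE2 := (hE1.frame hf₂ rfl).setV (x := .z) (z := e₂) (by simp)
    simp at hT₂ l2
    refine wp_seq <| wp_asg e₂ ?_ <|
      wp_mono (decr_spec hP hE2 hE (h2.setV (x := .z) (z := e₂) (by simp)) (z := e₂) (by simp)
        (by simp [tri, hne, hne.2.2.symm]) hqE.2 (by simp [l1.two, l2.two, hq]) (by simp; omega)) ?_
    · simp [b2]; omega
    rintro σ₃ T₃ hf₃ ⟨hT₃, Q₃, h3, l3⟩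
    simp at hT₃ l3
    refine ⟨by omega, 𝒜.erase (tri g (e₁, e₂)), Q₃, ?_, l1.trans (l2.trans l3)⟩
    convert h3
    ext e
    simp only [tri, Finset.notMem_empty, Finset.mem_erase, Finset.mem_insert,
      Finset.mem_singleton]
    tauto
  · have hq : σ.a .flag e₁ = 2 ∨ σ.a .flag e₂ = 2 := by
      simp at hq
      tauto
    refine ⟨?_, by simpa using h.qt, by simpa using h.queue⟩
    simp only [Store.setV_a]
    refine h.peel.skip ?_
    rcases hq with hq | hq
    exacts [⟨e₁, by simp [tri], hq⟩, ⟨e₂, by simp [tri], hq⟩]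

theorem Keys.card_triangles_le {n : ℕ} (h : Keys n M Y Adj) {e : ℕ} (he : e ∈ edgeIds n M Y) :
    ((triangles n M Y Adj).filter fun τ => e ∈ τ).card ≤ n := by
  classical
  have hxy := h.adj (mem_edgeIds_lt he)
  have key := h.edgeId_eq he
  generalize Y e / n = x at *
  generalize Y e % n = y at *
  subst key
  refine (Finset.card_le_card (t := (Finset.range n).image fun w =>
    {edgeId n M Y x y, edgeId n M Y x w, edgeId n M Y y w}) fun τ hτ => ?_).trans
    (Finset.card_image_le.trans_eq (Finset.card_range n))
  rw [Finset.mem_filter, h.mem_triangles_edge hxy] at hτ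
  obtain ⟨w, h1, -, rfl⟩ := hτ
  exact Finset.mem_image_of_mem _ (Finset.mem_range.2 (h.lt' h1))

theorem dropTriangles_spec (hP : P.Fits Γ) (hσ : Env P s σ) (hE : ∀ e ∈ E, e < 2 * P.m)
    (h : Peeling E 𝒯 P.k 𝒜 ∅ ∅ Q σ) {g : ℕ} {l : List (ℕ × ℕ)} (hl : Star E 𝒯 g l)
    (hg : σ.v .g = g) (hc : σ.v .c = l.length) (hlm : l.length ≤ 2 * P.m)
    (hl₁ : pre (σ.a .tri₁) (σ.v .c) = l.map Prod.fst)
    (hl₂ : pre (σ.a .tri₂) (σ.v .c) = l.map Prod.snd) (hgE : g ∈ E)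
    (hgf : σ.a .flag g = 1) (hT : 500 * (l.length + 1) ≤ T) :
    wp Γ dropTriangles (fun σ' T' => T ≤ T' + 500 * (l.length + 1) ∧ ∃ 𝒜' done Q',
      Peeling E 𝒯 P.k 𝒜' done ∅ Q' σ' ∧ (∀ τ, τ ∈ done ↔ τ ∈ 𝒯 ∧ g ∈ τ) ∧
      Later Q Q' (σ.a .flag) (σ'.a .flag)) σ T := by
  have hlin := hP.lin
  have hN := hP.N
  refine wp_seq <| wp_asg 0 ?_ <| wp_whl (fun σ' T' => T ≤ T' + 500 * σ'.v .j + 2 ∧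
    σ'.v .j ≤ l.length ∧ ∃ 𝒜' done Q', Peeling E 𝒯 P.k 𝒜' done ∅ Q' σ' ∧
    (∀ τ, τ ∈ done ↔ τ ∈ (l.take (σ'.v .j)).map (tri g)) ∧
    Later Q Q' (σ.a .flag) (σ'.a .flag)) ?_ ?_
  · simp; omega
  · exact ⟨by simp; omega, by simp, 𝒜, ∅, Q, h.setV (by simp), by simp, by simpa using .refl _ _⟩
  · rintro σ' T' hf ⟨h1, h2, 𝒜', done, Q', h3, h4, h5⟩
    have hσ' := (hσ.setV (x := .j) (z := 0) (by simp)).frame hf rfl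
    have hg' : σ'.v .g = g := by simpa [hg] using hf.v .g rfl
    have hc' : σ'.v .c = l.length := by simpa [hc] using hf.v .c rfl
    have ht₁ : σ'.a .tri₁ = σ.a .tri₁ := by simpa using hf.a .tri₁ rfl
    have ht₂ : σ'.a .tri₂ = σ.a .tri₂ := by simpa using hf.a .tri₂ rfl
    generalize hgj : σ'.v .j = j at *
    refine ⟨by simp; omega, fun hq => ?_, fun hq => ?_⟩
    · have hj : j < l.length := by simpa [hgj, hc'] using hq
      have e₁ : σ'.a .tri₁ j = (l[j]).1 := by
        have := List.getElem_of_eq hl₁ (i := j) (by simp [hc, hj])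
        simpa [pre, ht₁] using this
      have e₂ : σ'.a .tri₂ j = (l[j]).2 := by
        have := List.getElem_of_eq hl₂ (i := j) (by simp [hc, hj])
        simpa [pre, ht₂] using this
      have hm : l[j] ∈ l := List.getElem_mem hj
      have hτ := (hl.mem (tri g l[j])).2 ⟨_, hm, rfl⟩
      have htake : (l.take (j + 1)).map (tri g) = (l.take j).map (tri g) ++ [tri g l[j]] := by
        rw [List.take_add_one, List.getElem?_eq_getElem hj, List.map_append]
        rfl
      have hnot : tri g l[j] ∉ done := by
        rw [h4]
        have := hl.nodup.sublist ((List.take_sublist (j + 1) l).map (tri g))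
        rw [htake, List.nodup_append] at this
        intro hc
        exact this.2.2 _ hc _ (List.mem_singleton_self _) rfl
      refine wp_seq <| wp_mono (dropTriangle_spec hP hσ' hE h3 hg' hgj (by omega) e₁ e₂ hgE
        (hl.mem_edges _ hm) (hl.ne _ hm) hτ.1 hnot (h5.one hgf) (by simp; omega)) ?_
      rintro σ₁ T₁ hf₁ ⟨hT₁, 𝒜₁, Q₁, a1, a2⟩
      have hj₁ : σ₁.v .j = j := by simpa [hgj] using hf₁.v .j rfl
      simp at hT₁
      refine wp_asg (j + 1) ?_ ⟨?_, ?_, 𝒜₁, _, Q₁, a1.setV (by simp), fun τ => ?_, ?_⟩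
      · simp [hj₁]; omega
      · simp; omega
      · simpa using hj
      · simp only [Store.setV_v_self, htake, List.mem_append, ← h4, Finset.mem_insert,
          List.mem_singleton]
        exact or_comm
      · simpa using h5.trans a2
    · have hj : j = l.length := by
        have : ¬ j < l.length := by simpa [hgj, hc'] using hq
        omega
      refine ⟨by simp; omega, 𝒜', done, Q', h3, fun τ => ?_, h5⟩
      rw [h4, hj, List.take_length, hl.mem, List.mem_map]

/-- Every edge enters the queue at most once, so the time is bounded by the sum of the weights. -/
theorem peelLoop_spec (hP : P.Fits Γ) (h : Table P M Y lo hi ident Adj)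
    (hσ : Holds P s M Y lo hi ident σ)
    (hp : Peeling (edgeIds P.n M Y) (triangles P.n M Y Adj) P.k 𝒜 ∅ ∅ Q σ)
    (hQ : ∀ e ∈ Q, σ.a .flag e = 1) (hf : σ.v .f = (edgeIds P.n M Y).card)
    (hT : 1200 * (totalWeight P.n M Y lo hi + 1) ≤ T) :
    wp Γ peelLoop (fun σ' T' => T ≤ T' + 1200 * (totalWeight P.n M Y lo hi + 1) ∧
      ∃ B ⊆ edgeIds P.n M Y, IsDense (triangles P.n M Y Adj) P.k B ∧
      (∀ B' ⊆ edgeIds P.n M Y, IsDense (triangles P.n M Y Adj) P.k B' → B' ⊆ B) ∧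
      σ'.v .f = B.card) σ T := by
  have hlin := hP.lin
  have hN := hP.N
  have hMm := h.le
  have hnm := hP.n_le
  have hE : ∀ e ∈ edgeIds P.n M Y, e < 2 * P.m := fun e he => (mem_edgeIds_lt he).trans_le hMm
  refine wp_seq <| wp_asg 0 ?_ <| wp_seq <| wp_whl (fun σ' T' => ∃ 𝒜 Q,
    T ≤ T' + 1200 * (((Q.take (σ'.v .qh)).map fun e => weight P.n Y lo hi e + 1).sum) + 2 ∧
    σ'.v .qh ≤ Q.length ∧ (∀ e ∈ Q, (σ'.a .flag e = 1 ∨ σ'.a .flag e = 2) ∧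
      (σ'.a .flag e = 2 ↔ e ∈ Q.take (σ'.v .qh))) ∧
    Peeling (edgeIds P.n M Y) (triangles P.n M Y Adj) P.k 𝒜 ∅ ∅ Q σ') ?_ ?_
  · simp; omega
  · refine ⟨𝒜, Q, by simp; omega, by simp, fun e he => ?_, hp.setV (by simp)⟩
    have := hQ e he
    simp [this]
  · rintro σ' T' hf' ⟨𝒜', Q', h1, h2, h3, h4⟩
    have hσ' := (hσ.setV (x := .qh) (z := 0) (by simp) (by simp)).frame hf' rfl rfl rfl
    have hf₁ : σ'.v .f = (edgeIds P.n M Y).card := by simpa [hf] using hf'.v .f rfl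
    have hqt := h4.qt
    have hlen := h4.peel.length_le hE
    generalize hgq : σ'.v .qh = q at *
    have hsub : ∀ q, ((Q'.take q).map fun e => weight P.n Y lo hi e + 1).sum ≤
        totalWeight P.n M Y lo hi := by
      intro q
      have hnd := h4.peel.nodup.sublist (List.take_sublist q Q')
      rw [← List.sum_toFinset _ hnd, totalWeight]
      refine Finset.sum_le_sum_of_subset fun e he => ?_
      rw [List.mem_toFinset] at he
      have := ((h4.peel.mem_queue e).1 (List.mem_of_mem_take he)).1
      exact Finset.mem_range.2 (mem_edgeIds_lt this)
    refine ⟨?_, fun hq => ?_, fun hq => ?_⟩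
    · have := hsub q
      simp; omega
    · have hq : q < Q'.length := by simpa [hgq, hqt] using hq
      have hmem : Q'[q] ∈ Q' := List.getElem_mem hq
      have hget : σ'.a .queue q = Q'[q] := by
        have := List.getElem_of_eq h4.queue (i := q) (by simpa using hq)
        simpa [pre] using this
      have htake : ∀ Q'', Q' <+: Q'' → Q''.take q = Q'.take q ∧
          Q''.take (q + 1) = Q'.take q ++ [Q'[q]] := by
        rintro _ ⟨r, rfl⟩
        rw [List.take_append_of_le_length hq.le, List.take_append_of_le_length hq, List.take_add_one,
          List.getElem?_eq_getElem hq]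
        exact ⟨rfl, rfl⟩
      have hnot : Q'[q] ∉ Q'.take q := by
        have := h4.peel.nodup.sublist (List.take_sublist (q + 1) Q')
        rw [(htake Q' List.prefix_rfl).2, List.nodup_append] at this
        exact fun hc => this.2.2 _ hc _ (List.mem_singleton_self _) rfl
      generalize hgg : Q'[q] = g at *
      have hgE : g ∈ edgeIds P.n M Y := ((h4.peel.mem_queue g).1 hmem).1
      have hgm := hE g hgE
      have hgf : σ'.a .flag g = 1 := by
        have := h3 g hmem
        tauto
      have hsum := hsub (q + 1)
      rw [(htake Q' List.prefix_rfl).2, List.map_append, List.sum_append] at hsum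
      simp only [List.map_cons, List.map_nil, List.sum_cons, List.sum_nil, add_zero] at hsum
      generalize hgS : ((Q'.take q).map fun e => weight P.n Y lo hi e + 1).sum = S at *
      have hst := hσ'.setV (x := .g) (z := g) (by simp) (by simp)
      refine wp_seq <| wp_asg g ?_ <| wp_seq <| wp_mono (star_spec hP hst.toEnv h.keys h.rows
        h.isIdent h.le hst.buf hst.lo hst.hi hst.ident (g := g) (by simp) hgE ?_) ?_
      · simp [hgq, hget]; omega
      · simp; omega
      generalize hgw : weight P.n Y lo hi g = w at *
      rintro σ₁ T₁ hf₁ ⟨b1, b2, l, b3, b4, b5⟩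
      have hp₁ := (h4.setV (x := .g) (z := g) (by simp)).frame hf₁ rfl rfl
      have hσ₁ := hst.frame hf₁ rfl rfl rfl
      have hc : σ₁.v .c = l.length := by
        have := congrArg List.length b4
        simpa using this
      have hlm := h.keys.card_triangles_le hgE
      rw [b3.card] at hlm
      rw [hc] at b2
      simp at b1
      have hfl₁ : σ₁.a .flag = σ'.a .flag := by simpa using hf₁.a .flag rfl
      have hg₁ : σ₁.v .g = g := by simpa using hf₁.v .g rfl
      have hq₁ : σ₁.v .qh = q := by simpa [hgq] using hf₁.v .qh rfl
      refine wp_seq <| wp_mono (dropTriangles_spec hP hσ₁.toEnv hE hp₁ b3 hg₁ hc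
        (by omega) b4 b5 hgE (by rw [hfl₁, hgf]) (by omega)) ?_
      rintro σ₂ T₂ hf₂ ⟨c1, 𝒜₂, done, Q₂, c2, c3, c4⟩
      have hg₂ : σ₂.v .g = g := by simpa [hg₁] using hf₂.v .g rfl
      have hq₂ : σ₂.v .qh = q := by simpa [hq₁] using hf₂.v .qh rfl
      rw [hfl₁] at c4
      have hfg := c4.one hgf
      have hgQ₂ : g ∈ Q₂ := c4.pre.subset hmem
      have hfin := c2.peel.finish hfg hgE (fun τ hτ => ((c3 τ).1 hτ).2) (fun τ hτ hgτ =>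
        ((c2.peel.mem τ).1 hτ).2.2 ((c3 τ).2 ⟨((c2.peel.mem τ).1 hτ).1, hgτ⟩))
      refine wp_seq <| wp_sto g 2 ?_ <| wp_asg (q + 1) ?_ ⟨𝒜₂, Q₂, ?_, ?_, fun e he => ?_,
        ⟨by simpa using hfin, by simpa using c2.qt, by simpa using c2.queue⟩⟩
      · simp [hg₂]; omega
      · simp [hq₂]; omega
      · simp only [Store.setV_v_self, (htake Q₂ c4.pre).2, List.map_append, List.sum_append,
          List.map_cons, List.map_nil, List.sum_cons, List.sum_nil, hgS, hgw]
        simp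
        omega
      · have := c4.pre.length_le
        simp; omega
      · simp only [Store.setV_a, Store.setA_a_self, Store.setV_v_self, (htake Q₂ c4.pre).2,
          List.mem_append, List.mem_singleton]
        by_cases heg : e = g
        · subst heg; simp
        · rw [update_of_ne heg]
          have d1 := ((c2.peel.mem_queue e).1 he)
          have d2 := c4.step e
          by_cases heQ : e ∈ Q'
          · have d3 := h3 e heQ
            have d4 := c4.two e
            rw [d4]
            refine ⟨by omega, ?_⟩
            rw [d3.2]
            simp [heg]
          · have d3 : σ'.a .flag e = 0 := by
              by_contra hc
              exact heQ ((h4.peel.mem_queue e).2 ⟨d1.1, hc⟩)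
            refine ⟨by omega, ?_⟩
            have : e ∉ Q'.take q := fun hc => heQ (List.mem_of_mem_take hc)
            simp only [this, heg, or_self, iff_false]
            omega
    · have hq : q = Q'.length := by
        have : ¬ q < Q'.length := by simpa [hgq, hqt] using hq
        omega
      have hcard := h4.peel.card_add_length
      have hS := hsub q
      refine wp_asg (Q'.length + ((edgeIds P.n M Y).filter fun e => σ'.a .flag e = 0).card -
        Q'.length) ?_ ⟨by simp; omega, _, Finset.filter_subset _ _,
        h4.peel.isDense (fun τ => h.keys.triangles_subset) fun e he => ?_, fun B hB hd e he => ?_, ?_⟩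
      · simp [hf₁, hqt]; omega
      · have := (h3 e he).2
        rw [this, hq, List.take_length]
        exact he
      · exact Finset.mem_filter.2 ⟨hB he, h4.peel.dense B hB hd e he⟩
      · simp

/-- Compute the number of edges of the largest dense set. -/
def peel : Cmd := peelInit ;; peelLoop

theorem peel_spec (hP : P.Fits Γ) (h : Table P M Y lo hi ident Adj)
    (hσ : Holds P s M Y lo hi ident σ) (hT : 1800 * (totalWeight P.n M Y lo hi + 1) ≤ T) :
    wp Γ peel (fun σ' T' => T ≤ T' + 1800 * (totalWeight P.n M Y lo hi + 1) ∧
      ∃ B ⊆ edgeIds P.n M Y, IsDense (triangles P.n M Y Adj) P.k B ∧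
      (∀ B' ⊆ edgeIds P.n M Y, IsDense (triangles P.n M Y Adj) P.k B' → B' ⊆ B) ∧
      σ'.v .f = B.card) σ T := by
  refine wp_seq <| wp_mono (peelInit_spec hP h hσ (by omega)) ?_
  rintro σ₁ T₁ hf₁ ⟨h1, h2, Q, h3, h4⟩
  refine wp_mono (peelLoop_spec hP h (hσ.frame hf₁ rfl rfl rfl) h3 h4 h2 (by omega)) ?_
  rintro σ₂ T₂ - ⟨h5, h6⟩
  exact ⟨by linarith, h6⟩

end

/-! ### The evaluation of a pair -/

section

variable {P : Inst} {Γ : Ctx} {s M T : ℕ} {σ σ' : Store} {Y ident lo hi : ℕ → ℕ}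
  {Adj : ℕ → ℕ → Prop}

/-- If every edge is charged with the product of the degrees of its ends, then the total is at most
the square of the number of directed edges, as the pairs of directed edges that start at the two
ends of an edge determine this edge. -/
theorem Table.sum_mul_le (h : Table P M Y lo hi ident Adj) :
    ∑ p ∈ Finset.range M, (hi (Y p / P.n) - lo (Y p / P.n)) * (hi (Y p % P.n) - lo (Y p % P.n)) ≤
      M * M := by
  classical
  let A : ℕ → Finset ℕ := fun x => (Finset.range M).filter fun q => Y q / P.n = x
  have key : ∀ x y, Adj x y → hi x - lo x ≤ (A x).card := by
    intro x y hxy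
    rw [← Nat.card_Ico]
    refine Finset.card_le_card fun q hq => ?_
    rw [Finset.mem_filter, Finset.mem_range, ← h.rows.mem h.keys hxy]
    exact Finset.mem_Ico.1 hq
  calc _ ≤ ∑ p ∈ Finset.range M, (A (Y p / P.n) ×ˢ A (Y p % P.n)).card := by
        refine Finset.sum_le_sum fun p hp => ?_
        have hadj := h.keys.adj (Finset.mem_range.1 hp)
        rw [Finset.card_product]
        exact Nat.mul_le_mul (key _ _ hadj) (key _ _ (h.keys.symm _ _ hadj))
    _ = ((Finset.range M).biUnion fun p => A (Y p / P.n) ×ˢ A (Y p % P.n)).card := by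
        refine (Finset.card_biUnion fun p hp p' hp' hne => ?_).symm
        rw [Function.onFun, Finset.disjoint_left]
        rintro ⟨q, r⟩ hqr hqr'
        simp only [A, Finset.mem_product, Finset.mem_filter] at hqr hqr'
        refine hne (h.keys.inj (Finset.mem_range.1 hp) (Finset.mem_range.1 hp') ?_)
        rw [Keys.eq_key P.n (Y p), Keys.eq_key P.n (Y p'), ← hqr.1.2, ← hqr.2.2, hqr'.1.2, hqr'.2.2]
    _ ≤ (Finset.range M ×ˢ Finset.range M).card := by
        refine Finset.card_le_card fun qr hqr => ?_
        simp only [A, Finset.mem_biUnion, Finset.mem_product, Finset.mem_filter] at hqr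
        obtain ⟨_, _, h1, h2⟩ := hqr
        exact Finset.mem_product.2 ⟨h1.1, h2.1⟩
    _ = M * M := by simp

/-- A bound `a ^ 2 ≤ c * m ^ 3` yields a bound by a multiple of the integer part `q` of `m ^ (3 / 2)`;
rounding costs a factor of at most two, as `q + 1 ≤ 2 * q`. -/
theorem le_mul_of_sq_le {a c d q m : ℕ} (hq : q = Nat.sqrt (m ^ 3)) (hm : 1 ≤ m)
    (h : a * a ≤ c * m ^ 3) (hc : 4 * c < (d + 1) * (d + 1)) : a ≤ (d + 1) * q := by
  have h1 : m ^ 3 < (q + 1) * (q + 1) := hq ▸ Nat.sqrt_lt.1 (Nat.lt_succ_self _)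
  have h2 : 1 ≤ q := by
    rw [hq, Nat.le_sqrt]
    exact Nat.one_le_pow _ _ hm
  by_contra hlt
  have h3 : ((d + 1) * q) * ((d + 1) * q) ≤ a * a := Nat.mul_le_mul (by omega) (by omega)
  have h4 : (q + 1) * (q + 1) ≤ 4 * (q * q) := by nlinarith
  have h5 : c * m ^ 3 ≤ c * (4 * (q * q)) := Nat.mul_le_mul le_rfl (by omega)
  have h6 : 4 * c * (q * q) < (d + 1) * (d + 1) * (q * q) :=
    Nat.mul_lt_mul_of_pos_right hc (by positivity)
  nlinarith

theorem le_sqrt_cube {m : ℕ} (hm : 1 ≤ m) : m ≤ Nat.sqrt (m ^ 3) := by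
  rw [Nat.le_sqrt]
  calc m * m = m * m * 1 := by ring
    _ ≤ m * m * m := Nat.mul_le_mul le_rfl hm
    _ = m ^ 3 := by ring

/-- By the inequality of Cauchy and Schwarz, the time for peeling is of order `m ^ (3 / 2)`. -/
theorem Table.totalWeight_le (h : Table P M Y lo hi ident Adj) (hm : 1 ≤ P.m) :
    totalWeight P.n M Y lo hi ≤ 14 * Nat.sqrt (P.m ^ 3) := by
  have h0 := le_sqrt_cube hm
  have hM := h.le
  rw [totalWeight, Finset.sum_add_distrib, Finset.sum_const, Finset.card_range]
  have h1 : ∑ p ∈ Finset.range M, weight P.n Y lo hi p ≤ (11 + 1) * Nat.sqrt (P.m ^ 3) := by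
    refine le_mul_of_sq_le rfl hm (c := 32) ?_ (by norm_num)
    calc _ = (∑ p ∈ Finset.range M, weight P.n Y lo hi p) ^ 2 := by ring
      _ ≤ (Finset.range M).card * ∑ p ∈ Finset.range M, weight P.n Y lo hi p ^ 2 :=
        sq_sum_le_card_mul_sum_sq
      _ ≤ M * ∑ p ∈ Finset.range M, 4 * ((hi (Y p / P.n) - lo (Y p / P.n)) *
            (hi (Y p % P.n) - lo (Y p % P.n))) := by
        rw [Finset.card_range]
        refine Nat.mul_le_mul le_rfl (Finset.sum_le_sum fun p _ => ?_)
        rw [sq]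
        exact Nat.sqrt_le _
      _ ≤ M * (4 * (M * M)) := by
        rw [← Finset.mul_sum]
        exact Nat.mul_le_mul le_rfl (Nat.mul_le_mul le_rfl h.sum_mul_le)
      _ ≤ (2 * P.m) * (4 * ((2 * P.m) * (2 * P.m))) := by gcongr
      _ = 32 * P.m ^ 3 := by ring
  simp only [smul_eq_mul, mul_one]
  omega

/-- Compute the number `f` of edges of the truss after the merger of `v` into `u`. -/
def evalPair : Cmd := gen ;; radixSort ;; dedupe ;; findRows ;; identify ;; peel

/-- `s` is a number of order `n ^ (1 / 2)`, used as radix. -/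
structure IsBase (n s : ℕ) : Prop where
  le_mul : n ≤ s * s
  lt : (s - 1) * (s - 1) < n

/-- The time for sorting is of order `m * s`, and `s ^ 2` is of order `n ≤ 2 * m`, so that it is of order
`m ^ (3 / 2)`, as is the time for peeling. -/
theorem evalPair_spec (hP : P.Fits Γ) (hE : Env P s σ) (hs : IsBase P.n s) {r : ℕ → ℕ} {u v : ℕ}
    (hr : σ.a .root = r) (hu : σ.v .u = u) (hv : σ.v .v = v) (hR : ∀ z < P.n, r z < P.n)
    (hun : u < P.n) (hT : 40000 * Nat.sqrt (P.m ^ 3) ≤ T) :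
    wp Γ evalPair (fun σ' T' => T ≤ T' + 40000 * Nat.sqrt (P.m ^ 3) ∧
      ∃ M Y, M ≤ 2 * P.m ∧ Keys P.n M Y (P.Rel (mergeRoot r u v)) ∧ ∃ B ⊆ edgeIds P.n M Y,
      IsDense (triangles P.n M Y (P.Rel (mergeRoot r u v))) P.k B ∧
      (∀ B' ⊆ edgeIds P.n M Y, IsDense (triangles P.n M Y (P.Rel (mergeRoot r u v))) P.k B' →
        B' ⊆ B) ∧
      σ'.v .f = B.card) σ T := by
  have hm := hP.m_pos
  have hnm := hP.n_le
  have hq := le_sqrt_cube hm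
  have hs0 : 1 ≤ s := by
    rcases s with _ | s
    · have := hs.le_mul; omega
    · omega
  have hsn : s ≤ P.n := by
    have h1 := hs.lt
    have h2 : (s - 1) * 1 ≤ (s - 1) * (s - 1) ∨ s - 1 = 0 := by
      rcases s with _ | _ | s
      · right; rfl
      · right; rfl
      · left; exact Nat.mul_le_mul le_rfl (by omega)
    omega
  have hms : P.m * (s + 1) ≤ 6 * Nat.sqrt (P.m ^ 3) := by
    have h1 : P.m * (s - 1) ≤ (2 + 1) * Nat.sqrt (P.m ^ 3) := by
      refine le_mul_of_sq_le rfl hm (c := 2) ?_ (by norm_num)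
      calc P.m * (s - 1) * (P.m * (s - 1)) = P.m * P.m * ((s - 1) * (s - 1)) := by ring
        _ ≤ P.m * P.m * (2 * P.m) := Nat.mul_le_mul le_rfl (hs.lt.le.trans hnm)
        _ = 2 * P.m ^ 3 := by ring
    have h2 : P.m * (s + 1) = P.m * (s - 1) + 2 * P.m := by
      rw [show s + 1 = (s - 1) + 2 by omega]; ring
    omega
  have hsort : ∀ c ≤ 2 * P.m, 500 * (c + 1) * (s + 1) ≤ 9000 * Nat.sqrt (P.m ^ 3) := by
    intro c hc
    calc 500 * (c + 1) * (s + 1) ≤ 500 * (3 * P.m) * (s + 1) := by gcongr; omega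
      _ = 1500 * (P.m * (s + 1)) := by ring
      _ ≤ 1500 * (6 * Nat.sqrt (P.m ^ 3)) := by gcongr
      _ = 9000 * Nat.sqrt (P.m ^ 3) := by ring
  have hweight : ∀ {M Y lo hi ident Adj}, Table P M Y lo hi ident Adj →
    totalWeight P.n M Y lo hi ≤ 14 * Nat.sqrt (P.m ^ 3) := fun h => h.totalWeight_le hm
  generalize Nat.sqrt (P.m ^ 3) = q at *
  have hlt : ∀ x y, P.Rel (mergeRoot r u v) x y → x < P.n ∧ y < P.n := by
    have hmr : ∀ z < P.n, mergeRoot r u v z < P.n := fun z hz => by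
      rw [mergeRoot]; split_ifs; exacts [hun, hR z hz]
    rintro x y ⟨-, e, he, ⟨rfl, rfl⟩ | ⟨rfl, rfl⟩⟩
    · exact ⟨hmr _ (hP.pa_lt e he), hmr _ (hP.pb_lt e he)⟩
    · exact ⟨hmr _ (hP.pb_lt e he), hmr _ (hP.pa_lt e he)⟩
  refine wp_seq <| wp_mono (gen_spec hP hE hr hu hv hR hun (by omega)) ?_
  rintro σ₁ T₁ hf₁ ⟨h1, h2, h3⟩
  have hE₁ := hE.frame hf₁ rfl
  have hsort₁ := hsort _ h2
  refine wp_seq <| wp_mono (radixSort_spec hP hE₁ rfl h2 hs0 hsn hs.le_mul (fun z hz => ?_)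
    (by omega)) ?_
  · obtain ⟨x, y, rfl, hxy⟩ := (h3 z).1 hz
    have h4 := hlt x y hxy
    calc x * P.n + y < x * P.n + P.n := by omega
      _ = (x + 1) * P.n := by ring
      _ ≤ P.n * P.n := Nat.mul_le_mul h4.1 le_rfl
  rintro σ₂ T₂ hf₂ ⟨h4, h5, h6⟩
  have hE₂ := hE₁.frame hf₂ rfl
  have hc₂ : σ₂.v .cnt = σ₁.v .cnt := hf₂.v .cnt rfl
  refine wp_seq <| wp_mono (dedupe_spec hP hc₂ h2 rfl h5 (by omega)) ?_
  rintro σ₃ T₃ hf₃ ⟨h7, h8, h9, h10⟩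
  have hE₃ := hE₂.frame hf₃ rfl
  have hK : Keys P.n (σ₃.v .size) (σ₃.a .buf) (P.Rel (mergeRoot r u v)) := by
    refine ⟨h9, fun z => by rw [h10, h6, h3], ?_, fun x hx => hx.1 rfl, fun x y hxy => (hlt x y hxy).1⟩
    rintro x y ⟨hne, e, he, h⟩
    exact ⟨hne.symm, e, he, h.symm⟩
  have hM : σ₃.v .size ≤ 2 * P.m := h8.trans h2
  generalize hgM : σ₃.v .size = M at *
  generalize hgY : σ₃.a .buf = Y at *
  refine wp_seq <| wp_mono (findRows_spec hP hE₃ hK hgM hM hgY (by omega)) ?_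
  rintro σ₄ T₄ hf₄ ⟨h11, h12, h13⟩
  have hE₄ := hE₃.frame hf₄ rfl
  have hM₄ : σ₄.v .size = M := by rw [hf₄.v .size rfl, hgM]
  have hY₄ : σ₄.a .buf = Y := by rw [hf₄.a .buf rfl, hgY]
  refine wp_seq <| wp_mono (identify_spec hP hE₄ hK h12 hM₄ hM hY₄ h13 (by omega)) ?_
  rintro σ₅ T₅ hf₅ ⟨h14, h15⟩
  have hE₅ := hE₄.frame hf₅ rfl
  have hM₅ : σ₅.v .size = M := by rw [hf₅.v .size rfl, hM₄]
  have hY₅ : σ₅.a .buf = Y := by rw [hf₅.a .buf rfl, hY₄]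
  have htab : Table P M Y (σ₄.a .lo) (σ₄.a .hi) (σ₅.a .ident) (P.Rel (mergeRoot r u v)) :=
    ⟨hK, h12, h15, hM⟩
  have hw := hweight htab
  refine wp_mono (peel_spec hP htab ⟨hE₅, hM₅, hY₅, hf₅.a .lo rfl, hf₅.a .hi rfl, rfl⟩
    (by linarith)) ?_
  rintro σ₆ T₆ hf₆ ⟨h16, h17⟩
  exact ⟨by linarith, M, Y, hM, hK, h17⟩

end

/-! ### The truss as the largest dense set -/

section truss

variable {n M k : ℕ} {Y : ℕ → ℕ} {A : ℕ → ℕ → Prop} {H : NodeGraph (Fin n)}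

/-- The subgraph whose edges are represented by the elements of `B`. -/
def subgraphOf (H : NodeGraph (Fin n)) (M : ℕ) (Y : ℕ → ℕ) (B : Finset ℕ) : NodeGraph (Fin n) where
  verts := H.verts
  Adj x y := H.Adj x y ∧ edgeId n M Y x y ∈ B
  adj_sub h := h.1.adj_sub
  edge_vert h := h.1.fst_mem
  symm := ⟨fun _ _ h => ⟨h.1.symm, by rw [edgeId_comm]; exact h.2⟩⟩

theorem hasTrussProperty_subgraphOf (hK : Keys n M Y A) (hA : ∀ x y : Fin n, H.Adj x y ↔ A x y)
    {B : Finset ℕ} (hB : IsDense (triangles n M Y A) k B) :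
    (subgraphOf H M Y B).HasTrussProperty k := by
  classical
  rintro x y ⟨hxy, he⟩
  refine (hB _ he).trans (Nat.add_le_add_right ?_ 2)
  rw [NodeGraph.support, ← Set.ncard_coe_finset]
  refine le_trans (Set.ncard_le_ncard ?_ (Set.toFinite _)) (Set.ncard_image_le
    (f := fun w : Fin n => ({edgeId n M Y x y, edgeId n M Y x w, edgeId n M Y y w} : Finset ℕ))
    (Set.toFinite _))
  intro τ hτ
  rw [Finset.mem_coe, Finset.mem_filter] at hτ
  obtain ⟨hτ, hτB, heτ⟩ := hτ
  obtain ⟨w, h1, h2, rfl⟩ := (hK.mem_triangles_edge ((hA x y).1 hxy)).1 ⟨hτ, heτ⟩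
  have hw := hK.lt' h1
  refine ⟨⟨w, hw⟩, ⟨⟨(hA _ _).2 h1, hτB ?_⟩, ⟨(hA _ _).2 h2, hτB ?_⟩⟩, rfl⟩ <;> simp

open Classical in
/-- The slots that represent the edges of `K`. -/
noncomputable def idsOf (K : NodeGraph (Fin n)) (M : ℕ) (Y : ℕ → ℕ) : Finset ℕ :=
  ((Finset.univ : Finset (Fin n × Fin n)).filter fun p => K.Adj p.1 p.2).image fun p =>
    edgeId n M Y p.1 p.2

theorem mem_idsOf {K : NodeGraph (Fin n)} {e : ℕ} :
    e ∈ idsOf K M Y ↔ ∃ x y : Fin n, K.Adj x y ∧ edgeId n M Y x y = e := by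
  simp [idsOf]

theorem isDense_idsOf (hK : Keys n M Y A) {K : NodeGraph (Fin n)}
    (hA : ∀ x y : Fin n, K.Adj x y → A x y) (ht : K.HasTrussProperty k) :
    IsDense (triangles n M Y A) k (idsOf K M Y) := by
  classical
  intro e he
  obtain ⟨x, y, hxy, rfl⟩ := mem_idsOf.1 he
  refine (ht x y hxy).trans (Nat.add_le_add_right ?_ 2)
  rw [NodeGraph.support, ← Set.ncard_coe_finset]
  refine Set.ncard_le_ncard_of_injOn
    (fun w : Fin n => ({edgeId n M Y x y, edgeId n M Y x w, edgeId n M Y y w} : Finset ℕ))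
    ?_ ?_ (Set.toFinite _)
  · rintro w ⟨h1, h2⟩
    rw [Finset.mem_coe, Finset.mem_filter]
    have h3 := (hK.mem_triangles_edge (hA _ _ hxy)).2 ⟨w, hA _ _ h1, hA _ _ h2, rfl⟩
    refine ⟨h3.1, fun e he => ?_, h3.2⟩
    simp only [Finset.mem_insert, Finset.mem_singleton] at he
    rcases he with rfl | rfl | rfl
    exacts [mem_idsOf.2 ⟨_, _, hxy, rfl⟩, mem_idsOf.2 ⟨_, _, h1, rfl⟩, mem_idsOf.2 ⟨_, _, h2, rfl⟩]
  · rintro w ⟨h1, h2⟩ w' ⟨h3, h4⟩ heq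
    exact Fin.ext (hK.triangle_inj (hA _ _ hxy) (hA _ _ h1) (hA _ _ h2) (hA _ _ h3) (hA _ _ h4) heq)

/-- Dense sets of edges correspond to subgraphs with the truss property, so the largest dense set is the
edge set of the truss. -/
theorem ncard_edgeSet_kTruss (hK : Keys n M Y A) (hA : ∀ x y : Fin n, H.Adj x y ↔ A x y)
    {B : Finset ℕ} (hBE : B ⊆ edgeIds n M Y) (hB : IsDense (triangles n M Y A) k B)
    (hmax : ∀ B' ⊆ edgeIds n M Y, IsDense (triangles n M Y A) k B' → B' ⊆ B) :
    (NodeGraph.kTruss k H).edgeSet.ncard = B.card := by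
  obtain ⟨⟨hle, ht⟩, hub⟩ := NodeGraph.kTruss_isGreatest k H
  have hA' : ∀ x y : Fin n, (NodeGraph.kTruss k H).Adj x y → A x y := fun x y h =>
    (hA x y).1 (hle.2 h)
  have h1 : subgraphOf H M Y B ≤ NodeGraph.kTruss k H :=
    hub ⟨⟨le_rfl, fun _ _ h => h.1⟩, hasTrussProperty_subgraphOf hK hA hB⟩
  have h2 : idsOf (NodeGraph.kTruss k H) M Y ⊆ B := by
    refine hmax _ (fun e he => ?_) (isDense_idsOf hK hA' ht)
    obtain ⟨x, y, hxy, rfl⟩ := mem_idsOf.1 he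
    exact hK.edgeId_mem (hA' _ _ hxy)
  let φ : Sym2 (Fin n) → ℕ :=
    Sym2.lift ⟨fun x y => edgeId n M Y x y, fun x y => edgeId_comm n M Y x y⟩
  have h3 : (B : Set ℕ) = φ '' (NodeGraph.kTruss k H).edgeSet := by
    ext e
    constructor
    · intro he
      have heE := hBE he
      have hadj := hK.adj (mem_edgeIds_lt heE)
      have hid := hK.edgeId_eq heE
      have hx := hK.lt _ _ hadj
      have hy := hK.lt' hadj
      refine ⟨s(⟨_, hx⟩, ⟨_, hy⟩), ?_, hid⟩
      rw [SimpleGraph.Subgraph.mem_edgeSet]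
      refine h1.2 ⟨(hA _ _).2 hadj, ?_⟩
      rw [hid]
      exact he
    · rintro ⟨z, hz, rfl⟩
      induction z with
      | _ x y =>
        rw [SimpleGraph.Subgraph.mem_edgeSet] at hz
        exact h2 (mem_idsOf.2 ⟨x, y, hz, rfl⟩)
  rw [← Set.ncard_coe_finset, h3, Set.InjOn.ncard_image]
  intro z hz z' hz' heq
  induction z with
  | _ x y =>
    induction z' with
    | _ x' y' =>
      rw [SimpleGraph.Subgraph.mem_edgeSet] at hz hz'
      rw [Sym2.eq_iff]
      rcases hK.edgeId_inj (hA' _ _ hz) (hA' _ _ hz') heq with ⟨h4, h5⟩ | ⟨h4, h5⟩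
      · exact .inl ⟨Fin.ext h4, Fin.ext h5⟩
      · exact .inr ⟨Fin.ext h4, Fin.ext h5⟩

end truss

/-! ### Mergers and root maps -/

/-- The root map `r` describes the graph `H`, which results from the listed edges by mergers: its
nodes are the roots, and its edges are those between different roots of the ends of a listed
edge. -/
structure Describes {n : ℕ} (P : Inst) (r : ℕ → ℕ) (H : NodeGraph (Fin n)) : Prop where
  ends : ∀ e < P.m, P.pa e < n ∧ P.pb e < n
  lt : ∀ z < n, r z < n
  idem : ∀ z < n, r (r z) = r z
  verts : ∀ x : Fin n, x ∈ H.verts ↔ r x = x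
  adj : ∀ x y : Fin n, H.Adj x y ↔ P.Rel r x y

/-- The adjacency after a merger arises by renaming `v` to `u` and dropping loops. -/
theorem rel_mergeRoot {P : Inst} {r : ℕ → ℕ} {u v x y : ℕ} :
    P.Rel (mergeRoot r u v) x y ↔ x ≠ y ∧ ∃ x' y', P.Rel r x' y' ∧
      (if x' = v then u else x') = x ∧ (if y' = v then u else y') = y := by
  constructor
  · rintro ⟨hne, e, he, ⟨rfl, rfl⟩ | ⟨rfl, rfl⟩⟩
    · refine ⟨hne, _, _, ⟨fun h => hne ?_, e, he, .inl ⟨rfl, rfl⟩⟩, rfl, rfl⟩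
      rw [mergeRoot, mergeRoot, h]
    · refine ⟨hne, _, _, ⟨fun h => hne ?_, e, he, .inr ⟨rfl, rfl⟩⟩, rfl, rfl⟩
      rw [mergeRoot, mergeRoot, h]
  · rintro ⟨hne, _, _, ⟨-, e, he, ⟨rfl, rfl⟩ | ⟨rfl, rfl⟩⟩, rfl, rfl⟩
    · exact ⟨hne, e, he, .inl ⟨rfl, rfl⟩⟩
    · exact ⟨hne, e, he, .inr ⟨rfl, rfl⟩⟩

theorem Describes.merge {n : ℕ} {P : Inst} {r : ℕ → ℕ} {H : NodeGraph (Fin n)}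
    (h : Describes P r H) {u v : Fin n} (hu : u ∈ H.verts) (hv : v ∈ H.verts) (huv : u ≠ v) :
    Describes P (mergeRoot r u v) (NodeGraph.merge u v H) := by
  have hu' := (h.verts u).1 hu
  have hv' := (h.verts v).1 hv
  have huv' : (u : ℕ) ≠ v := fun h => huv (Fin.ext h)
  have hverts : ∀ x : Fin n, x ∈ (NodeGraph.merge u v H).verts ↔ mergeRoot r u v x = x := by
    intro x
    rw [show x ∈ (NodeGraph.merge u v H).verts ↔ x ∈ H.verts ∧ x ≠ v from Iff.rfl, h.verts, mergeRoot,
      ne_eq, Fin.ext_iff]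
    split_ifs with h1
    · constructor
      · rintro ⟨h2, h3⟩
        omega
      · intro h2
        rw [← h2, hu'] at h1
        omega
    · constructor
      · exact fun h => h.1
      · exact fun h2 => ⟨h2, fun h3 => h1 (h2.trans h3)⟩
  refine ⟨h.ends, fun z hz => ?_, fun z hz => ?_, hverts, fun x y => ?_⟩
  · rw [mergeRoot]
    split_ifs
    exacts [u.2, h.lt z hz]
  · simp only [mergeRoot]
    by_cases h1 : r z = v
    · simp [h1, hu', huv']
    · simp [h1, h.idem z hz]
  · rw [rel_mergeRoot]
    constructor
    · rintro ⟨hx, hy, hadj⟩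
      have hx2 : (x : ℕ) ≠ v := fun hc => hx.2 (Fin.ext hc)
      have hy2 : (y : ℕ) ≠ v := fun hc => hy.2 (Fin.ext hc)
      rcases hadj with hadj | ⟨rfl, h1, hadj⟩ | ⟨rfl, h1, hadj⟩
      · have h2 := (h.adj _ _).1 hadj
        exact ⟨h2.1, x, y, h2, if_neg hx2, if_neg hy2⟩
      · exact ⟨fun hc => h1 (Fin.ext hc.symm), v, y, (h.adj _ _).1 hadj, if_pos rfl, if_neg hy2⟩
      · exact ⟨fun hc => h1 (Fin.ext hc), x, v, (h.adj _ _).1 hadj.symm, if_neg hx2, if_pos rfl⟩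
    · rintro ⟨hne, x', y', hadj, hx, hy⟩
      have hlt : x' < n ∧ y' < n := by
        obtain ⟨-, e, he, ⟨rfl, rfl⟩ | ⟨rfl, rfl⟩⟩ := hadj
        · exact ⟨h.lt _ (h.ends e he).1, h.lt _ (h.ends e he).2⟩
        · exact ⟨h.lt _ (h.ends e he).2, h.lt _ (h.ends e he).1⟩
      obtain ⟨hx', hy'⟩ := hlt
      have hH : H.Adj ⟨x', hx'⟩ ⟨y', hy'⟩ := (h.adj _ _).2 hadj
      have hxv : x ∈ H.verts \ {v} := by
        split_ifs at hx with h1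
        · obtain rfl := Fin.ext hx
          exact ⟨hu, huv⟩
        · have : x = ⟨x', hx'⟩ := Fin.ext hx.symm
          subst this
          exact ⟨hH.fst_mem, fun hc => h1 (congrArg Fin.val hc)⟩
      have hyv : y ∈ H.verts \ {v} := by
        split_ifs at hy with h1
        · obtain rfl := Fin.ext hy
          exact ⟨hu, huv⟩
        · have : y = ⟨y', hy'⟩ := Fin.ext hy.symm
          subst this
          exact ⟨hH.snd_mem, fun hc => h1 (congrArg Fin.val hc)⟩
      refine ⟨hxv, hyv, ?_⟩
      split_ifs at hx hy with h1 h2 h2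
      · omega
      · subst h1
        obtain rfl := Fin.ext hx
        have : y = ⟨y', hy'⟩ := Fin.ext hy.symm
        subst this
        exact .inr (.inl ⟨rfl, fun hc => hne (congrArg Fin.val hc).symm, hH⟩)
      · subst h2
        obtain rfl := Fin.ext hy
        have : x = ⟨x', hx'⟩ := Fin.ext hx.symm
        subst this
        exact .inr (.inr ⟨rfl, fun hc => hne (congrArg Fin.val hc), hH.symm⟩)
      · left
        have h3 : x = ⟨x', hx'⟩ := Fin.ext hx.symm
        have h4 : y = ⟨y', hy'⟩ := Fin.ext hy.symm
        rw [h3, h4]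
        exact hH

/-! ### The evaluation of all pairs -/

/-- Evaluate all pairs of roots, and report their values; `bu`, `bv` is the first pair of largest
value, and `bf` is this value plus one, or `0` as long as no pair has been evaluated. -/
def evalPairs : Cmd :=
  .asg .bf 0 ;; .asg .u 0 ;; .whl (.lt §.u §.n) (
    .ite (.eq (arr .root §.u) §.u) (
      .asg .v (§.u + 1) ;; .whl (.lt §.v §.n) (
        .ite (.eq (arr .root §.v) §.v) (
          evalPair ;; .emit §.u ;; .emit §.v ;; .emit §.f ;;
          .ite (.lt §.bf (§.f + 1)) (.asg .bu §.u ;; .asg .bv §.v ;; .asg .bf (§.f + 1)) .skip)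
          .skip ;;
        .asg .v (§.v + 1)))
      .skip ;;
    .asg .u (§.u + 1))

section

variable {n : ℕ} {P : Inst} {Γ : Ctx} {s T : ℕ} {σ σ' : Store} {r : ℕ → ℕ} {H : NodeGraph (Fin n)}

theorem evalPair_graph (hP : P.Fits Γ) (hE : Env P s σ) (hs : IsBase P.n s) (hn : P.n = n)
    (hD : Describes P r H) {u v : Fin n} (hu : u ∈ H.verts) (hv : v ∈ H.verts) (huv : u ≠ v)
    (hr : σ.a .root = r) (hu' : σ.v .u = u) (hv' : σ.v .v = v)
    (hT : 40000 * Nat.sqrt (P.m ^ 3) ≤ T) :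
    wp Γ evalPair (fun σ' T' => T ≤ T' + 40000 * Nat.sqrt (P.m ^ 3) ∧
      σ'.v .f = H.trussSizeAfter P.k (u, v) ∧ σ'.v .f ≤ 2 * P.m) σ T := by
  subst hn
  refine wp_mono (evalPair_spec hP hE hs hr hu' hv' hD.lt u.2 hT) ?_
  rintro σ' T' - ⟨h1, M, Y, hM, hK, B, h2, h3, h4, h5⟩
  refine ⟨h1, ?_, ?_⟩
  · rw [h5, NodeGraph.trussSizeAfter]
    exact (ncard_edgeSet_kTruss hK (hD.merge hu hv huv).adj h2 h3 h4).symm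
  · rw [h5]
    refine (Finset.card_le_card h2).trans ((Finset.card_filter_le _ _).trans ?_)
    rwa [Finset.card_range]

/-- The report on the values of the pairs `qs`. -/
def reportOf (F : Fin n × Fin n → ℕ) (qs : List (Fin n × Fin n)) : List ℕ :=
  qs.flatMap fun q => [(q.1 : ℕ), (q.2 : ℕ), F q]

/-- The pairs before the pair `u`, `v` have been evaluated. -/
structure Scanned (H : NodeGraph (Fin n)) (F : Fin n × Fin n → ℕ) (o : List ℕ)
    (u v bu bv bf : ℕ) (out : List ℕ) : Prop where
  intro ::
  ex : ∃ qs : List (Fin n × Fin n), qs.Nodup ∧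
    (∀ q, q ∈ qs ↔ q ∈ H.nodePairs ∧ ((q.1 : ℕ) < u ∨ (q.1 : ℕ) = u ∧ (q.2 : ℕ) < v)) ∧
    out = o ++ reportOf F qs ∧
    (qs = [] ∧ bf = 0 ∨
      ∃ p ∈ qs, bu = p.1 ∧ bv = p.2 ∧ bf = F p + 1 ∧ ∀ q ∈ qs, F q ≤ F p)

theorem Scanned.congr {F : Fin n × Fin n → ℕ} {o out : List ℕ} {u v u' v' bu bv bf : ℕ}
    (h : Scanned H F o u v bu bv bf out)
    (hq : ∀ q ∈ H.nodePairs, ((q.1 : ℕ) < u ∨ (q.1 : ℕ) = u ∧ (q.2 : ℕ) < v) ↔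
      ((q.1 : ℕ) < u' ∨ (q.1 : ℕ) = u' ∧ (q.2 : ℕ) < v')) :
    Scanned H F o u' v' bu bv bf out := by
  obtain ⟨qs, h1, h2, h3⟩ := h
  refine ⟨qs, h1, fun q => ?_, h3⟩
  rw [h2]
  exact and_congr_right (hq q)

/-- The step from one pair to the next: the pair is reported, and replaces the best one if its value is
larger. -/
theorem Scanned.snoc {F : Fin n × Fin n → ℕ} {o out : List ℕ} {bu bv bf f : ℕ} {u v : Fin n}
    (h : Scanned H F o u v bu bv bf out) (hu : u ∈ H.verts) (hv : v ∈ H.verts) (huv : u < v)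
    (hf : f = F (u, v)) :
    Scanned H F o u (v + 1) (if bf < f + 1 then u else bu) (if bf < f + 1 then v else bv)
      (if bf < f + 1 then f + 1 else bf) (out ++ [(u : ℕ), (v : ℕ), f]) := by
  obtain ⟨qs, h1, h2, h3, h4⟩ := h
  refine ⟨qs ++ [(u, v)], ?_, fun q => ?_, ?_, ?_⟩
  · rw [List.nodup_append]
    refine ⟨h1, by simp, ?_⟩
    rintro q hq q' hq' rfl
    rw [List.mem_singleton] at hq'
    subst hq'
    have := ((h2 _).1 hq).2
    simp at this
  · rw [List.mem_append, h2, List.mem_singleton]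
    obtain ⟨x, y⟩ := q
    simp only [Prod.mk.injEq, Fin.ext_iff]
    constructor
    · rintro (⟨h5, h6⟩ | ⟨h5, h6⟩)
      · exact ⟨h5, by omega⟩
      · obtain rfl := Fin.ext h5
        obtain rfl := Fin.ext h6
        exact ⟨⟨hu, hv, huv⟩, by omega⟩
    · rintro ⟨h5, h6⟩
      by_cases h7 : (x : ℕ) = u ∧ (y : ℕ) = v
      · exact .inr h7
      · exact .inl ⟨h5, by omega⟩
  · rw [h3, reportOf, reportOf, List.flatMap_append, hf]
    simp
  · right
    subst hf
    rcases h4 with ⟨rfl, rfl⟩ | ⟨p, hp, rfl, rfl, rfl, h5⟩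
    · exact ⟨(u, v), by simp, by simp, by simp, by simp, by simp⟩
    · by_cases hlt : F p + 1 < F (u, v) + 1
      · simp only [hlt, if_true]
        refine ⟨(u, v), by simp, rfl, rfl, rfl, fun q hq => ?_⟩
        rw [List.mem_append, List.mem_singleton] at hq
        rcases hq with hq | rfl
        · have := h5 q hq; omega
        · exact le_rfl
      · simp only [hlt, if_false]
        refine ⟨p, by simp [hp], rfl, rfl, rfl, fun q hq => ?_⟩
        rw [List.mem_append, List.mem_singleton] at hq
        rcases hq with hq | rfl
        · exact h5 q hq
        · omega

theorem evalPairs_spec (hP : P.Fits Γ) (hE : Env P s σ) (hs : IsBase P.n s) (hn : P.n = n)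
    (hD : Describes P r H) (hr : σ.a .root = r)
    (hT : 42000 * (n * n * Nat.sqrt (P.m ^ 3)) ≤ T) :
    wp Γ evalPairs (fun σ' T' => T ≤ T' + 42000 * (n * n * Nat.sqrt (P.m ^ 3)) ∧
      Scanned H (H.trussSizeAfter P.k) σ.out n 0 (σ'.v .bu) (σ'.v .bv) (σ'.v .bf) σ'.out) σ T := by
  have hlin := hP.lin
  have hN := hP.N
  have hnm := hP.n_le
  have hbn := hP.b_lt
  have hq1 : 1 ≤ Nat.sqrt (P.m ^ 3) := hP.m_pos.trans (le_sqrt_cube hP.m_pos)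
  have hev := fun (σ : Store) (T : ℕ) (hE : Env P s σ) (u v : Fin n) =>
    evalPair_graph (σ := σ) (T := T) (u := u) (v := v) hP hE hs hn hD
  generalize Nat.sqrt (P.m ^ 3) = q at *
  obtain ⟨K, hK⟩ : ∃ K, K = 40000 * q + 300 := ⟨_, rfl⟩
  obtain ⟨L, hL⟩ : ∃ L, L = K * n + 100 := ⟨_, rfl⟩
  have hLn : L * n + 20 ≤ 42000 * (n * n * q) := by
    have h1 : 1 * n ≤ n * n := Nat.mul_le_mul (by omega) le_rfl
    have h2 : n * n * 1 ≤ n * n * q := Nat.mul_le_mul le_rfl hq1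
    have h3 : L * n = 40000 * (n * n * q) + 300 * (n * n) + 100 * n := by rw [hL, hK]; ring
    have h4 : 1 ≤ n := by omega
    omega
  have hLu : ∀ u, u + 1 ≤ n → L * u + L ≤ L * n := fun u hu => by
    rw [← Nat.mul_succ]; exact Nat.mul_le_mul le_rfl hu
  have hKv : ∀ v, v + 1 ≤ n → K * v + K ≤ K * n := fun v hv => by
    rw [← Nat.mul_succ]; exact Nat.mul_le_mul le_rfl hv
  refine wp_seq <| wp_asg 0 ?_ <| wp_seq <| wp_asg 0 ?_ <| wp_whl (fun σ' T' =>
    T ≤ T' + L * σ'.v .u + 10 ∧ σ'.v .u ≤ n ∧ Scanned H (H.trussSizeAfter P.k) σ.out (σ'.v .u) 0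
      (σ'.v .bu) (σ'.v .bv) (σ'.v .bf) σ'.out) ?_ ?_
  · simp; omega
  · simp; omega
  · refine ⟨by simp; omega, by simp, [], by simp, fun q => ?_, by simp [reportOf], by simp⟩
    simp
  · rintro σ' T' hf ⟨h1, h2, h3⟩
    have hE' : Env P s σ' := ((hE.setV (by simp)).setV (by simp)).frame hf rfl
    have hr' : σ'.a .root = r := by simpa [hr] using hf.a .root rfl
    generalize hgu : σ'.v .u = u at *
    have hLu0 := Nat.mul_le_mul (le_refl L) h2
    refine ⟨by simp; omega, fun hq => ?_, fun hq => ?_⟩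
    · have hu : u < n := by simpa [hgu, hE'.n, hn] using hq
      have hLu' := hLu u hu
      refine wp_seq <| wp_ite ?_ (fun hq => wp_seq <| wp_asg (u + 1) ?_ <| wp_whl (fun σ₁ T₁ =>
        T' ≤ T₁ + K * (σ₁.v .v) + 60 ∧ u < σ₁.v .v ∧ σ₁.v .v ≤ n ∧
        Scanned H (H.trussSizeAfter P.k) σ.out u (σ₁.v .v) (σ₁.v .bu) (σ₁.v .bv) (σ₁.v .bf) σ₁.out)
        ?_ ?_) (fun hq => wp_skip ?_ <| wp_asg (u + 1) ?_ ⟨?_, ?_, ?_⟩)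
      · simp [hgu]; omega
      · simp [hgu]; omega
      · refine ⟨by simp; omega, by simp, by simp; omega, ?_⟩
        simp
        refine h3.congr fun q hq => ?_
        have := hq.2.2
        rw [Fin.lt_def] at this
        omega
      · rintro σ₁ T₁ hf₁ ⟨a1, a2, a3, a4⟩
        have hE₁ : Env P s σ₁ := (hE'.setV (by simp)).frame hf₁ rfl
        have hr₁ : σ₁.a .root = r := by simpa [hr'] using hf₁.a .root rfl
        have hu₁ : σ₁.v .u = u := by simpa [hgu] using hf₁.v .u rfl
        generalize hgv : σ₁.v .v = v at *
        refine ⟨?_, fun hq₁ => ?_, fun hq₁ => ?_⟩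
        · have := Nat.mul_le_mul (le_refl K) a3
          simp; omega
        · have hv : v < n := by simpa [hgv, hE₁.n, hn] using hq₁
          have hKv' := hKv v hv
          refine wp_seq <| wp_ite ?_ (fun hq₂ => ?_)
            (fun hq₂ => wp_skip ?_ <| wp_asg (v + 1) ?_ ⟨?_, ?_, ?_, ?_⟩)
          · simp [hgv]; omega
          · have hu' : (⟨u, hu⟩ : Fin n) ∈ H.verts := (hD.verts _).2 (by simpa [hgu, hr'] using hq)
            have hv' : (⟨v, hv⟩ : Fin n) ∈ H.verts := (hD.verts _).2 (by simpa [hgv, hr₁] using hq₂)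
            refine wp_seq <| wp_mono (hev σ₁ _ hE₁ ⟨u, hu⟩ ⟨v, hv⟩ hu' hv'
              (fun hc => a2.ne (congrArg Fin.val hc)) hr₁ hu₁ hgv (by simp; omega)) ?_
            rintro σ₂ T₂ hf₂ ⟨b1, b2, b3⟩
            have hu₂ : σ₂.v .u = u := by simpa [hu₁] using hf₂.v .u rfl
            have hv₂ : σ₂.v .v = v := by simpa [hgv] using hf₂.v .v rfl
            have hbu := hf₂.v .bu rfl
            have hbv := hf₂.v .bv rfl
            have hbf := hf₂.v .bf rfl
            have hout := hf₂.out rfl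
            generalize hgf : σ₂.v .f = f at *
            have hnew := a4.snoc (u := ⟨u, hu⟩) (v := ⟨v, hv⟩) hu' hv' a2 b2
            rw [← hbu, ← hbv, ← hbf, ← hout] at hnew
            simp at b1
            refine wp_seq <| wp_emit u ?_ <| wp_seq <| wp_emit v ?_ <| wp_seq <| wp_emit f ?_ <|
              wp_ite ?_ (fun hq₃ => wp_seq <| wp_asg u ?_ <| wp_seq <| wp_asg v ?_ <|
                wp_asg (f + 1) ?_ <| wp_asg (v + 1) ?_ ⟨?_, ?_, ?_, ?_⟩)
              (fun hq₃ => wp_skip ?_ <| wp_asg (v + 1) ?_ ⟨?_, ?_, ?_, ?_⟩)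
            any_goals simp [hu₂, hv₂, hgf]; omega
            · simp [Nat.mul_succ]; omega
            · have hq₃ : σ₂.v .bf < f + 1 := by simpa [hgf] using hq₃
              simpa [hq₃] using hnew
            · simp [Nat.mul_succ]; omega
            · have hq₃ : ¬ σ₂.v .bf < f + 1 := by simpa [hgf] using hq₃
              simp only [hq₃, if_false] at hnew
              simpa using hnew
          · simp; omega
          · simp [hgv]; omega
          · simp [Nat.mul_succ]; omega
          · simp; omega
          · simpa using hv
          · have hv' : (⟨v, hv⟩ : Fin n) ∉ H.verts := fun hc => by
              have := (hD.verts _).1 hc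
              simp [hgv, hr₁] at hq₂
              exact hq₂ this
            simp
            refine a4.congr fun q hq => ?_
            have : (q.2 : ℕ) ≠ v := by
              rintro rfl
              exact hv' hq.2.1
            omega
        · have hv : v = n := by
            have : ¬ v < n := by simpa [hgv, hE₁.n, hn] using hq₁
            omega
          subst hv
          refine wp_asg (u + 1) ?_ ⟨?_, ?_, ?_⟩
          · simp [hu₁]; omega
          · simp [Nat.mul_succ]; omega
          · simpa using hu
          · simp
            refine a4.congr fun q hq => ?_
            have := q.2.2
            omega
      · simp; omega
      · simp [hgu]; omega
      · simp [Nat.mul_succ]; omega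
      · simpa using hu
      · have hu' : (⟨u, hu⟩ : Fin n) ∉ H.verts := fun hc => by
          have := (hD.verts _).1 hc
          simp [hgu, hr'] at hq
          exact hq this
        simp
        refine h3.congr fun q hq => ?_
        have : (q.1 : ℕ) ≠ u := by
          rintro rfl
          exact hu' hq.1
        omega
    · have hu : u = n := by
        have : ¬ u < n := by simpa [hgu, hE'.n, hn] using hq
        omega
      subst hu
      exact ⟨by simp; omega, h3⟩

end

/-! ### The greedy algorithm -/

/-- Read the parameters, compute the radix, and initialize the root map. -/
def setup : Cmd :=
  .asg .n (inp 0) ;; .asg .m (inp 1) ;; .asg .k (inp 2) ;; .asg .b (inp 3) ;;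
  .asg .base 0 ;; .whl (.lt (§.base * §.base) §.n) (.asg .base (§.base + 1)) ;;
  .asg .x 0 ;; .whl (.lt §.x §.n) (.sto .root §.x §.x ;; .asg .x (§.x + 1))

/-- Merge the node `bv` into the node `bu`. -/
def mergeBest : Cmd :=
  .asg .x 0 ;; .whl (.lt §.x §.n) (
    .ite (.eq (arr .root §.x) §.bv) (.sto .root §.x §.bu) .skip ;;
    .asg .x (§.x + 1))

/-- One iteration of the greedy algorithm. -/
def greedyRound : Cmd :=
  evalPairs ;; .emit §.bu ;; .emit §.bv ;; .sto .fst §.it §.bu ;; .sto .snd §.it §.bv ;;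
  mergeBest ;; .asg .it (§.it + 1)

/-- The greedy algorithm. -/
def greedy : Cmd :=
  setup ;; .asg .it 0 ;; .whl (.lt §.it §.b) greedyRound ;;
  .asg .i 0 ;; .whl (.lt §.i §.b)
    (.emit (arr .fst §.i) ;; .emit (arr .snd §.i) ;; .asg .i (§.i + 1))

section

variable {n : ℕ} {P : Inst} {Γ : Ctx} {s T : ℕ} {σ σ' : Store} {r : ℕ → ℕ} {H : NodeGraph (Fin n)}

theorem setup_spec (hP : P.Fits Γ) (hT : 100 * (P.n + 1) ≤ T) :
    wp Γ setup (fun σ' T' => T ≤ T' + 100 * (P.n + 1) ∧ (∃ s, IsBase P.n s ∧ Env P s σ') ∧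
      (∀ z < P.n, σ'.a .root z = z)) σ T := by
  have hlin := hP.lin
  have hN := hP.N
  have hnm := hP.n_le
  have hlen := hP.len
  have hbn := hP.b_lt
  refine wp_seq <| wp_asg P.n ?_ <| wp_seq <| wp_asg P.m ?_ <| wp_seq <| wp_asg P.k ?_ <|
    wp_seq <| wp_asg P.b ?_ <| wp_seq <| wp_asg 0 ?_ <| wp_seq <|
    wp_whl (fun σ' T' => T ≤ T' + 30 * σ'.v .base + 30 ∧
      (σ'.v .base - 1) * (σ'.v .base - 1) < P.n) ?_ ?_
  · simp [hP.inp_n]; omega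
  · simp [hP.inp_m]; omega
  · simp [hP.inp_k]; omega
  · simp [hP.inp_b]; omega
  · simp; omega
  · refine ⟨by simp; omega, by simp; omega⟩
  · rintro σ₁ T₁ hf ⟨h1, h2⟩
    have hn : σ₁.v .n = P.n := by simpa using hf.v .n rfl
    have hm : σ₁.v .m = P.m := by simpa using hf.v .m rfl
    have hk : σ₁.v .k = P.k := by simpa using hf.v .k rfl
    have hb : σ₁.v .b = P.b := by simpa using hf.v .b rfl
    generalize hgs : σ₁.v .base = s at *
    have hsn : s ≤ P.n := by
      have h3 : (s - 1) * 1 ≤ (s - 1) * (s - 1) ∨ s - 1 = 0 := by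
        rcases s with _ | _ | s
        · right; rfl
        · right; rfl
        · left; exact Nat.mul_le_mul le_rfl (by omega)
      omega
    have hmul := hP.mul_lt (x := s) (y := s) (by omega) (by omega)
    refine ⟨by simp [hgs]; omega, fun hq => ?_, fun hq => ?_⟩
    · have hq : s * s < P.n := by simpa [hgs, hn] using hq
      refine wp_asg (s + 1) ?_ ⟨?_, ?_⟩
      · simp [hgs]; omega
      · simp; omega
      · simpa using hq
    · have hq : P.n ≤ s * s := by simpa [hgs, hn] using hq
      have hE : Env P s σ₁ := ⟨hn, hm, hk, hb, hgs⟩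
      refine wp_seq <| wp_asg 0 ?_ <| wp_whl (fun σ₂ T₂ => T₁ ≤ T₂ + 30 * σ₂.v .x + 20 ∧
        σ₂.v .x ≤ P.n ∧ ∀ z < σ₂.v .x, σ₂.a .root z = z) ?_ ?_
      · simp; omega
      · simp; omega
      · rintro σ₂ T₂ hf₂ ⟨h3, h4, h5⟩
        have hE₂ : Env P s σ₂ := (hE.setV (by simp)).frame hf₂ rfl
        generalize hgx : σ₂.v .x = x at *
        refine ⟨by simp; omega, fun hq₂ => ?_, fun hq₂ => ?_⟩
        · have hx : x < P.n := by simpa [hgx, hE₂.n] using hq₂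
          refine wp_seq <| wp_sto x x ?_ <| wp_asg (x + 1) ?_ ⟨?_, ?_, ?_⟩
          · simp [hgx]; omega
          · simp [hgx]; omega
          · simp; omega
          · simpa using hx
          · intro z hz
            simp at hz ⊢
            by_cases hzx : z = x
            · subst hzx; simp
            · rw [update_of_ne hzx]
              exact h5 z (by omega)
        · have hx : x = P.n := by
            have : ¬ x < P.n := by simpa [hgx, hE₂.n] using hq₂
            omega
          subst hx
          exact ⟨by simp; omega, ⟨s, ⟨hq, h2⟩, hE₂⟩, h5⟩

theorem mergeBest_spec (hP : P.Fits Γ) (hE : Env P s σ) {u v : ℕ} (hr : σ.a .root = r)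
    (hu : σ.v .bu = u) (hv : σ.v .bv = v) (hT : 60 * (P.n + 1) ≤ T) :
    wp Γ mergeBest (fun σ' T' => T ≤ T' + 60 * (P.n + 1) ∧
      ∀ z < P.n, σ'.a .root z = mergeRoot r u v z) σ T := by
  have hlin := hP.lin
  have hN := hP.N
  have hnm := hP.n_le
  refine wp_seq <| wp_asg 0 ?_ <| wp_whl (fun σ' T' => T ≤ T' + 50 * σ'.v .x + 10 ∧ σ'.v .x ≤ P.n ∧
    ∀ z, σ'.a .root z = if z < σ'.v .x then mergeRoot r u v z else r z) ?_ ?_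
  · simp; omega
  · simp [hr]; omega
  · rintro σ' T' hf ⟨h1, h2, h3⟩
    have hE' : Env P s σ' := (hE.setV (by simp)).frame hf rfl
    have hu' : σ'.v .bu = u := by simpa [hu] using hf.v .bu rfl
    have hv' : σ'.v .bv = v := by simpa [hv] using hf.v .bv rfl
    generalize hgx : σ'.v .x = x at *
    refine ⟨by simp; omega, fun hq => ?_, fun hq => ?_⟩
    · have hx : x < P.n := by simpa [hgx, hE'.n] using hq
      have hrx : σ'.a .root x = r x := by rw [h3, if_neg (lt_irrefl x)]
      refine wp_seq <| wp_ite ?_ (fun hq => wp_sto x u ?_ <| wp_asg (x + 1) ?_ ⟨?_, ?_, ?_⟩)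
        (fun hq => wp_skip ?_ <| wp_asg (x + 1) ?_ ⟨?_, ?_, ?_⟩)
      any_goals simp [hgx, hu', hv', hrx]; omega
      · have hq : r x = v := by simpa [hgx, hrx, hv'] using hq
        intro z
        simp only [Store.setV_a, Store.setA_a_self, Store.setV_v_self]
        by_cases hzx : z = x
        · subst hzx
          simp [mergeRoot, hq]
        · rw [update_of_ne hzx, h3]
          congr 1
          simp; omega
      · have hq : r x ≠ v := by simpa [hgx, hrx, hv'] using hq
        intro z
        simp only [Store.setV_a, Store.setA_a_self, Store.setV_v_self]
        by_cases hzx : z = x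
        · subst hzx
          simp [mergeRoot, hq, hrx]
        · rw [h3]
          congr 1
          simp; omega
    · have hx : x = P.n := by
        have : ¬ x < P.n := by simpa [hgx, hE'.n] using hq
        omega
      subst hx
      exact ⟨by simp; omega, fun z hz => by rw [h3, if_pos hz]⟩

theorem Describes.congr {r' : ℕ → ℕ} (h : Describes P r H) (hr : ∀ z < n, r' z = r z) :
    Describes P r' H := by
  refine ⟨h.ends, fun z hz => by rw [hr z hz]; exact h.lt z hz, fun z hz => ?_, fun x => ?_,
    fun x y => ?_⟩
  · rw [hr z hz, hr _ (h.lt z hz), h.idem z hz]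
  · rw [h.verts, hr x x.2]
  · rw [h.adj, Inst.Rel, Inst.Rel]
    refine and_congr_right fun _ => exists_congr fun e => and_congr_right fun he => ?_
    rw [hr _ (h.ends e he).1, hr _ (h.ends e he).2]

/-- The greedy algorithm, started with the graph `G`, has selected the pairs `ps` so far, and goes on
with the graph `H`. -/
structure Progress (P : Inst) (G : NodeGraph (Fin n)) (ps : List (Fin n × Fin n))
    (H : NodeGraph (Fin n)) (σ : Store) : Prop where
  length : ps.length = σ.v .it
  nodup : ps.Nodup
  fst : pre (σ.a .fst) (σ.v .it) = ps.map fun p => (p.1 : ℕ)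
  snd : pre (σ.a .snd) (σ.v .it) = ps.map fun p => (p.2 : ℕ)
  run : ∀ trace R, NaiveGreedyLoop P.k P.b ps.toFinset H trace R →
    NaiveGreedyLoop P.k P.b ∅ G (σ.out ++ trace) R
  current : σ.v .it < P.b →
    Describes P (σ.a .root) H ∧ H.verts.ncard + σ.v .it = n ∧ ∀ p ∈ ps, p.2 ∉ H.verts

theorem nodePairs_nonempty (h : 1 < H.verts.ncard) : ∃ p, p ∈ H.nodePairs := by
  obtain ⟨x, y, hx, hy, hne⟩ := (Set.one_lt_ncard_iff (Set.toFinite _)).1 h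
  rcases lt_or_gt_of_ne hne with hlt | hlt
  exacts [⟨(x, y), hx, hy, hlt⟩, ⟨(y, x), hy, hx, hlt⟩]

theorem greedyRound_spec (hP : P.Fits Γ) (hE : Env P s σ) (hs : IsBase P.n s) (hn : P.n = n)
    {G : NodeGraph (Fin n)} {ps : List (Fin n × Fin n)} (h : Progress P G ps H σ)
    (hit : σ.v .it < P.b) (hT : 43000 * (n * n * Nat.sqrt (P.m ^ 3)) ≤ T) :
    wp Γ greedyRound (fun σ' T' => T ≤ T' + 43000 * (n * n * Nat.sqrt (P.m ^ 3)) ∧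
      σ'.v .it = σ.v .it + 1 ∧ ∃ ps' H', Progress P G ps' H' σ') σ T := by
  have hlin := hP.lin
  have hN := hP.N
  have hnm := hP.n_le
  have hbn := hP.b_lt
  obtain ⟨hD, hcard, hdel⟩ := h.current hit
  have hq1 : 1 ≤ Nat.sqrt (P.m ^ 3) := hP.m_pos.trans (le_sqrt_cube hP.m_pos)
  have hnq : 2 * n ≤ n * n * Nat.sqrt (P.m ^ 3) ∧ 4 ≤ n * n * Nat.sqrt (P.m ^ 3) := by
    have h1 : 2 * n ≤ n * n := Nat.mul_le_mul (by omega) le_rfl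
    have h2 : n * n * 1 ≤ n * n * Nat.sqrt (P.m ^ 3) := Nat.mul_le_mul le_rfl hq1
    omega
  refine wp_seq <| wp_mono (evalPairs_spec hP hE hs hn hD rfl (by omega)) ?_
  generalize n * n * Nat.sqrt (P.m ^ 3) = q at *
  rintro σ₁ T₁ hf₁ ⟨h1, qs, h2, h3, h4, h5⟩
  have hE₁ := hE.frame hf₁ rfl
  have hit₁ : σ₁.v .it = σ.v .it := hf₁.v .it rfl
  have hfst₁ : σ₁.a .fst = σ.a .fst := hf₁.a .fst rfl
  have hsnd₁ : σ₁.a .snd = σ.a .snd := hf₁.a .snd rfl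
  have hroot₁ : σ₁.a .root = σ.a .root := hf₁.a .root rfl
  have h3' : ∀ q, q ∈ qs ↔ q ∈ H.nodePairs := fun q => by
    rw [h3, and_iff_left]
    exact .inl q.1.2
  have hne : qs ≠ [] := by
    obtain ⟨p, hp⟩ := nodePairs_nonempty (H := H) (by omega)
    exact List.ne_nil_of_mem ((h3' p).2 hp)
  obtain ⟨p, hp, hbu, hbv, -, hmax⟩ := h5.resolve_left fun hc => hne hc.1
  have hpn := (h3' p).1 hp
  have hlen := h.length
  generalize hgi : σ.v .it = i at *
  -- The second node of a selected pair is deleted for good, so a pair is never selected twice and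
  -- every iteration enlarges the set of selected pairs.
  have hps : p ∉ ps := fun hc => hdel p hc hpn.2.1
  have hcard' : (insert p ps.toFinset).card = i + 1 := by
    rw [Finset.card_insert_of_notMem (by simpa using hps), List.toFinset_card_of_nodup h.nodup, hlen]
  have hE₂ : Env P s ((((σ₁.put p.1).put p.2).setA .fst i p.1).setA .snd i p.2) :=
    ⟨hE₁.n, hE₁.m, hE₁.k, hE₁.b, hE₁.base⟩
  refine wp_seq <| wp_emit (p.1 : ℕ) ?_ <| wp_seq <| wp_emit (p.2 : ℕ) ?_ <|
    wp_seq <| wp_sto i p.1 ?_ <| wp_seq <| wp_sto i p.2 ?_ <| wp_seq <|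
    wp_mono (mergeBest_spec hP hE₂ (r := σ.a .root) (u := p.1) (v := p.2) (by simpa using hroot₁)
      (by simpa using hbu) (by simpa using hbv) (by simp; omega)) ?_
  any_goals simp [hbu, hbv, hit₁]; omega
  rintro σ₂ T₂ hf₂ ⟨h6, h7⟩
  have hit₂ : σ₂.v .it = i := by simpa [hit₁] using hf₂.v .it rfl
  have hfst₂ : σ₂.a .fst = update (σ.a .fst) i p.1 := by simpa [hfst₁] using hf₂.a .fst rfl
  have hsnd₂ : σ₂.a .snd = update (σ.a .snd) i p.2 := by simpa [hsnd₁] using hf₂.a .snd rfl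
  have hout₂ : σ₂.out = σ.out ++ reportOf (H.trussSizeAfter P.k) qs ++ [(p.1 : ℕ), (p.2 : ℕ)] := by
    simpa [h4] using hf₂.out rfl
  simp at h6
  -- The root map is updated even in the last iteration, in which the algorithm keeps its graph; the
  -- map is not used any more then.
  refine wp_asg (i + 1) ?_ ⟨?_, ?_, ps ++ [p],
    if i + 1 < P.b then NodeGraph.merge p.1 p.2 H else H, ?_, ?_, ?_, ?_, ?_, ?_⟩
  · simp [hit₂]; omega
  · simp; omega
  · simp
  · simp [hlen]
  · rw [List.nodup_append]
    refine ⟨h.nodup, by simp, ?_⟩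
    rintro a ha b hb rfl
    rw [List.mem_singleton] at hb
    exact hps (hb ▸ ha)
  · have := h.fst
    rw [hgi] at this
    simp [hfst₂, this]
  · have := h.snd
    rw [hgi] at this
    simp [hsnd₂, this]
  · intro trace R hrun
    have := h.run _ R (.iterate ps.toFinset H ?_ qs h2 h3' p hp hmax _ rfl trace R ?_)
    · simpa [hout₂, reportOf] using this
    · rw [List.toFinset_card_of_nodup h.nodup, hlen]
      exact hit
    · rw [hcard']
      simpa [List.toFinset_append, Finset.union_comm] using hrun
  · intro hlt
    have hlt : i + 1 < P.b := by simpa using hlt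
    rw [if_pos hlt]
    refine ⟨(hD.merge hpn.1 hpn.2.1 hpn.2.2.ne).congr fun z hz => ?_, ?_, fun p' hp' => ?_⟩
    · simpa using h7 z (hn ▸ hz)
    · have := Set.ncard_sdiff_singleton_add_one hpn.2.1 (Set.toFinite _)
      have hv : (NodeGraph.merge p.1 p.2 H).verts = H.verts \ {p.2} := rfl
      rw [hv]
      simp; omega
    · rw [List.mem_append, List.mem_singleton] at hp'
      rintro ⟨h8, h9⟩
      rcases hp' with hp' | rfl
      · exact hdel p' hp' h8
      · exact h9 rfl

theorem greedy_spec (hP : P.Fits Γ) (hn : P.n = n) {G : SimpleGraph (Fin n)}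
    (hG : Describes P id (NodeGraph.ofSimpleGraph G)) (hb : 1 ≤ P.b) (hout : σ.out = [])
    (hT : 44000 * (P.b * (n * n * Nat.sqrt (P.m ^ 3))) ≤ T) :
    wp Γ greedy (fun σ' _ => IsNaiveGreedyReport G P.k P.b σ'.out) σ T := by
  have hlin := hP.lin
  have hN := hP.N
  have hnm := hP.n_le
  have hbn := hP.b_lt
  have hq1 : 1 ≤ Nat.sqrt (P.m ^ 3) := hP.m_pos.trans (le_sqrt_cube hP.m_pos)
  have hnq : 2 * n ≤ n * n * Nat.sqrt (P.m ^ 3) ∧ 4 ≤ n * n * Nat.sqrt (P.m ^ 3) := by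
    have h1 : 2 * n ≤ n * n := Nat.mul_le_mul (by omega) le_rfl
    have h2 : n * n * 1 ≤ n * n * Nat.sqrt (P.m ^ 3) := Nat.mul_le_mul le_rfl hq1
    omega
  have hround := fun (σ : Store) (T s : ℕ) (ps : List (Fin n × Fin n)) (H : NodeGraph (Fin n)) =>
    greedyRound_spec (σ := σ) (T := T) (s := s) (ps := ps) (H := H)
      (G := NodeGraph.ofSimpleGraph G) hP
  generalize n * n * Nat.sqrt (P.m ^ 3) = q at *
  have hbq : 1 * q ≤ P.b * q := Nat.mul_le_mul hb le_rfl
  have hbq' : P.b * 4 ≤ P.b * q := Nat.mul_le_mul le_rfl hnq.2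
  obtain ⟨K, hK⟩ : ∃ K, K = 43000 * q + 30 := ⟨_, rfl⟩
  have hKb : K * P.b = 43000 * (P.b * q) + 30 * P.b := by rw [hK]; ring
  refine wp_seq <| wp_mono (setup_spec hP (by omega)) ?_
  rintro σ₁ T₁ hf₁ ⟨h1, ⟨s, hs, hE⟩, h2⟩
  have hout₁ : σ₁.out = [] := by rw [hf₁.out rfl, hout]
  refine wp_seq <| wp_asg 0 ?_ <| wp_seq <| wp_whl (fun σ' T' => T₁ ≤ T' + K * σ'.v .it + 10 ∧
    σ'.v .it ≤ P.b ∧ ∃ ps H, Progress P (NodeGraph.ofSimpleGraph G) ps H σ') ?_ ?_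
  · simp; omega
  · refine ⟨by simp; omega, by simp, [], NodeGraph.ofSimpleGraph G, by simp, by simp, by simp,
      by simp, fun trace R h => ?_, fun _ => ⟨?_, ?_, by simp⟩⟩
    · simpa [hout₁] using h
    · exact hG.congr fun z hz => by simpa using h2 z (hn ▸ hz)
    · have : (NodeGraph.ofSimpleGraph G).verts = Set.univ := rfl
      rw [this, Set.ncard_univ]
      simp
  · rintro σ₂ T₂ hf₂ ⟨h3, h4, ps, H, h5⟩
    have hE₂ : Env P s σ₂ := (hE.setV (by simp)).frame hf₂ rfl
    have hKi := Nat.mul_le_mul (le_refl K) h4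
    refine ⟨by simp; omega, fun hq => ?_, fun hq => ?_⟩
    · have hq : σ₂.v .it < P.b := by simpa [hE₂.b] using hq
      have hKi' : K * σ₂.v .it + K ≤ K * P.b := by
        rw [← Nat.mul_succ]; exact Nat.mul_le_mul le_rfl hq
      refine wp_mono (hround σ₂ _ s ps H hE₂ hs hn h5 hq (by simp; omega)) ?_
      rintro σ₃ T₃ - ⟨h6, h7, h8⟩
      refine ⟨?_, by omega, h8⟩
      rw [h7, Nat.mul_succ]
      simp at h6
      omega
    · have hib : σ₂.v .it = P.b := by
        have : ¬ σ₂.v .it < P.b := by simpa [hE₂.b] using hq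
        omega
      have hrun := h5.run [] ps.toFinset (.exit _ _ (by
        rw [List.toFinset_card_of_nodup h5.nodup, h5.length, hib]; exact lt_irrefl _))
      rw [List.append_nil] at hrun
      have hlen := h5.length
      have hfst := h5.fst
      have hsnd := h5.snd
      rw [hib] at hfst hsnd hlen
      refine wp_seq <| wp_asg 0 ?_ <| wp_whl (fun σ' T' => 30 * P.b + 20 ≤ T' + 30 * σ'.v .i ∧
        σ'.v .i ≤ P.b ∧ σ'.out = σ₂.out ++
          (ps.take (σ'.v .i)).flatMap fun p => [(p.1 : ℕ), (p.2 : ℕ)]) ?_ ?_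
      · simp; omega
      · rw [hib] at h3
        simp; omega
      · rintro σ₃ T₃ hf₃ ⟨h6, h7, h8⟩
        have hE₃ : Env P s σ₃ := (hE₂.setV (by simp)).frame hf₃ rfl
        have hfst₃ : σ₃.a .fst = σ₂.a .fst := by simpa using hf₃.a .fst rfl
        have hsnd₃ : σ₃.a .snd = σ₂.a .snd := by simpa using hf₃.a .snd rfl
        generalize hgi : σ₃.v .i = i at *
        refine ⟨by simp; omega, fun hq => ?_, fun hq => ?_⟩
        · have hi : i < P.b := by simpa [hgi, hE₃.b] using hq
          have hi' : i < ps.length := by omega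
          have e₁ : σ₂.a .fst i = (ps[i].1 : ℕ) := by
            have := List.getElem_of_eq hfst (i := i) (by simpa using hi)
            simpa [pre] using this
          have e₂ : σ₂.a .snd i = (ps[i].2 : ℕ) := by
            have := List.getElem_of_eq hsnd (i := i) (by simpa using hi)
            simpa [pre] using this
          refine wp_seq <| wp_emit (ps[i].1 : ℕ) ?_ <| wp_seq <| wp_emit (ps[i].2 : ℕ) ?_ <|
            wp_asg (i + 1) ?_ ⟨?_, ?_, ?_⟩
          · simp [hgi, hfst₃, e₁]; omega
          · simp [hgi, hsnd₃, e₂]; omega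
          · simp [hgi]; omega
          · simp; omega
          · simpa using hi
          · have htake : ps.take (i + 1) = ps.take i ++ [ps[i]] := by
              rw [List.take_add_one, List.getElem?_eq_getElem hi']
              rfl
            simp only [Store.setV_v_self, htake, List.flatMap_append, ← List.append_assoc, ← h8]
            simp
        · have hi : i = ps.length := by
            have : ¬ i < P.b := by simpa [hgi, hE₃.b] using hq
            omega
          rw [hi, List.take_length] at h8
          exact ⟨_, _, ps, hrun, h5.nodup, rfl, h8⟩

end

/-! ### The program and its input -/

/-- The program of the word RAM: the arrays start behind the input, whose length is computed
first. -/
def prog : Prog :=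
  .seq (.load 1 (.imm 1)) (.seq (.set 0 .mul (.reg 1) (.imm 2))
    (.seq (.set 0 .add (.reg 0) (.imm 4)) greedy.comp))

section input

variable {n : ℕ} (k b : ℕ) (es : List (Fin n × Fin n))

theorem getD_flatMap_pair (e : ℕ) (he : e < es.length) :
    (es.flatMap fun e => [(e.1 : ℕ), (e.2 : ℕ)]).getD (2 * e) 0 = (es[e].1 : ℕ) ∧
    (es.flatMap fun e => [(e.1 : ℕ), (e.2 : ℕ)]).getD (2 * e + 1) 0 = (es[e].2 : ℕ) := by
  induction es generalizing e with
  | nil => simp at he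
  | cons a es ih =>
    rcases e with _ | e
    · simp
    · have := ih e (by simpa using he)
      simpa [Nat.mul_succ] using this

theorem length_graphInput : (graphInput n k b es).length = 4 + 2 * es.length := by
  simp [graphInput, List.length_flatMap, mul_comm]
  omega

/-- The instance that is given by an edge list. -/
def instOf : Inst where
  n := n
  m := es.length
  k := k
  b := b
  pa e := (graphInput n k b es).getD (4 + 2 * e) 0
  pb e := (graphInput n k b es).getD (5 + 2 * e) 0

/-- The context of a run on the edge list `es` with words below `W`. -/
def ctxOf (W : ℕ) : Ctx where
  W := W
  N := 2 * es.length + 2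
  len := 4 + 2 * es.length
  inp i := (graphInput n k b es).getD i 0

theorem pa_instOf {e : ℕ} (he : e < es.length) : (instOf k b es).pa e = (es[e].1 : ℕ) := by
  rw [← (getD_flatMap_pair es e he).1, instOf, graphInput]
  simp [add_comm 4]

theorem pb_instOf {e : ℕ} (he : e < es.length) : (instOf k b es).pb e = (es[e].2 : ℕ) := by
  rw [← (getD_flatMap_pair es e he).2, instOf, graphInput]
  simp [show 5 + 2 * e = 2 * e + 1 + 4 by omega]

theorem inp_ctxOf_le (hbn : b < n) (W : ℕ) {i : ℕ} (hi : i < 4 + 2 * es.length) :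
    (ctxOf k b es W).inp i ≤ n + es.length + k := by
  rw [ctxOf]
  simp only
  rw [List.getD_eq_getElem _ _ (by rw [length_graphInput]; exact hi)]
  have : (graphInput n k b es)[i]'(by rw [length_graphInput]; exact hi) ∈ graphInput n k b es :=
    List.getElem_mem _
  generalize (graphInput n k b es)[i]'(by rw [length_graphInput]; exact hi) = z at *
  simp only [graphInput, List.mem_append, List.mem_cons, List.not_mem_nil, or_false,
    List.mem_flatMap] at this
  rcases this with (rfl | rfl | rfl | rfl) | ⟨e, -, rfl | rfl⟩
  any_goals omega

end input

/-! ### Edge lists, and the bounds on time, space and words -/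

section

variable {n : ℕ} {G : SimpleGraph (Fin n)} {es : List (Fin n × Fin n)}

theorem length_eq_ncard (h : IsEdgeList G es) : es.length = G.edgeSet.ncard := by
  classical
  rw [← List.length_map (f := fun e : Fin n × Fin n => s(e.1, e.2)),
    ← List.toFinset_card_of_nodup h.1, ← Set.ncard_coe_finset]
  congr 1
  ext e
  simpa using h.2 e

theorem adj_iff (h : IsEdgeList G es) (x y : Fin n) :
    G.Adj x y ↔ ∃ e ∈ es, (e.1 = x ∧ e.2 = y) ∨ (e.1 = y ∧ e.2 = x) := by
  rw [← SimpleGraph.mem_edgeSet, ← h.2, List.mem_map]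
  refine exists_congr fun e => and_congr_right fun _ => ?_
  rw [Sym2.eq_iff]

/-- Every node is an end of a listed edge. -/
theorem le_two_mul_length (h : IsEdgeList G es) (hG : ∀ v, ∃ w, G.Adj v w) : n ≤ 2 * es.length := by
  classical
  have h1 : (Finset.univ : Finset (Fin n)) ⊆ (es.map Prod.fst ++ es.map Prod.snd).toFinset := by
    intro v _
    obtain ⟨w, hw⟩ := hG v
    obtain ⟨e, he, ⟨h1, -⟩ | ⟨-, h1⟩⟩ := (adj_iff h v w).1 hw
    · simp only [List.mem_toFinset, List.mem_append, List.mem_map]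
      exact .inl ⟨e, he, h1⟩
    · simp only [List.mem_toFinset, List.mem_append, List.mem_map]
      exact .inr ⟨e, he, h1⟩
  have h2 := (Finset.card_le_card h1).trans (List.toFinset_card_le _)
  simp at h2
  omega

theorem length_le_sq (h : IsEdgeList G es) : es.length ≤ n * n := by
  simpa using (List.Nodup.of_map _ h.1).length_le_card

theorem describes_instOf (h : IsEdgeList G es) (k b : ℕ) :
    Describes (instOf k b es) id (NodeGraph.ofSimpleGraph G) := by
  refine ⟨fun e he => ?_, fun z hz => hz, fun z hz => rfl, fun x => by
    simp [NodeGraph.ofSimpleGraph], fun x y => ?_⟩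
  · rw [pa_instOf k b es he, pb_instOf k b es he]
    exact ⟨es[e].1.2, es[e].2.2⟩
  · rw [show (NodeGraph.ofSimpleGraph G).Adj x y ↔ G.Adj x y from Iff.rfl]
    constructor
    · intro hxy
      refine ⟨fun hc => G.ne_of_adj hxy (Fin.ext hc), ?_⟩
      obtain ⟨e, he, h1⟩ := (adj_iff h x y).1 hxy
      obtain ⟨i, hi, rfl⟩ := List.getElem_of_mem he
      refine ⟨i, hi, ?_⟩
      rw [pa_instOf k b es hi, pb_instOf k b es hi]
      simpa [Fin.ext_iff] using h1
    · rintro ⟨-, i, hi, h1⟩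
      rw [pa_instOf k b es hi, pb_instOf k b es hi] at h1
      exact (adj_iff h x y).2 ⟨es[i], List.getElem_mem hi, by simpa [Fin.ext_iff] using h1⟩

/-- Words with values below `(n + k + 2) ^ 17` are large enough. -/
theorem word_bounds {n k m : ℕ} (hn : 2 ≤ n) (hm : m ≤ n * n) :
    (4 * m + k + 16) ^ 4 < (n + k + 2) ^ 17 ∧ 50000 * m ≤ (n + k + 2) ^ 17 := by
  have hX : 4 ≤ n + k + 2 := by omega
  have hm' : m ≤ (n + k + 2) * (n + k + 2) := hm.trans (Nat.mul_le_mul (by omega) (by omega))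
  have hk : k ≤ n + k + 2 := by omega
  generalize n + k + 2 = X at *
  have h2 : 4 * X ≤ X * X := Nat.mul_le_mul hX le_rfl
  have h3 : 4 * (X * X) ≤ X * (X * X) := Nat.mul_le_mul hX le_rfl
  have h4 : 4 * (X * (X * X)) ≤ X * (X * (X * X)) := Nat.mul_le_mul hX le_rfl
  have h5 : 4 * m + k + 16 ≤ X ^ 4 := by
    have : X ^ 4 = X * (X * (X * X)) := by ring
    omega
  constructor
  · calc (4 * m + k + 16) ^ 4 ≤ (X ^ 4) ^ 4 := Nat.pow_le_pow_left h5 4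
      _ = X ^ 16 := by ring
      _ < X ^ 17 := Nat.pow_lt_pow_right (by omega) (by omega)
  · calc 50000 * m ≤ 4 ^ 8 * (X * X) := Nat.mul_le_mul (by norm_num) hm'
      _ ≤ X ^ 8 * (X * X) := Nat.mul_le_mul (Nat.pow_le_pow_left hX 8) le_rfl
      _ = X ^ 10 := by ring
      _ ≤ X ^ 17 := Nat.pow_le_pow_right (by omega) (by omega)

theorem fits_instOf {k b : ℕ} (h : IsEdgeList G es) (hG : ∀ v, ∃ w, G.Adj v w) (hb : 1 ≤ b)
    (hbn : b < n) : (instOf k b es).Fits (ctxOf k b es ((n + k + 2) ^ 17)) := by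
  have hn := le_two_mul_length h hG
  refine ⟨fun e he => ?_, fun e he => ?_, ?_, hn, hbn, rfl, rfl, rfl, rfl, rfl, rfl, fun e he => rfl,
    fun e he => rfl, (word_bounds (by omega) (length_le_sq h)).1⟩
  · rw [pa_instOf k b es he]; exact es[e].1.2
  · rw [pb_instOf k b es he]; exact es[e].2.2
  · rw [instOf]; simp only; omega

/-- The input takes `2 * m + 4` cells and the arrays take `16 * (2 * m + 2)`. -/
theorem valid_ctxOf {k b : ℕ} (h : IsEdgeList G es) (hG : ∀ v, ∃ w, G.Adj v w) (hb : 1 ≤ b)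
    (hbn : b < n) : (ctxOf k b es ((n + k + 2) ^ 17)).Valid (50000 * es.length) := by
  have hn := le_two_mul_length h hG
  have hw := word_bounds (k := k) (show 2 ≤ n by omega) (length_le_sq h)
  refine ⟨?_, hw.2, ?_, fun i hi => ?_⟩
  · simp only [ctxOf]; omega
  · simp only [ctxOf]
    have := hw.2
    omega
  · refine (inp_ctxOf_le k b es hbn _ hi).trans_lt ?_
    simp only [ctxOf]
    have h1 : 4 * es.length + k + 16 ≤ (4 * es.length + k + 16) ^ 4 := Nat.le_self_pow (by norm_num) _
    have := hw.1
    omega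

/-- After the computation of the length of the input, the machine represents the store that is `0`
everywhere. -/
theorem exec_prog {Γ : Ctx} {S t : ℕ} {σ : Store} {k b : ℕ} (hΓ : Γ.Valid S)
    (hc : Γ = ctxOf k b es Γ.W)
    (h : Big Γ greedy ⟨fun _ => 0, fun _ _ => 0, []⟩ σ t) :
    ∃ s t', Exec Γ.W S prog (initial (graphInput n k b es)) s t' ∧ t' ≤ t + 3 ∧ s.out = σ.out := by
  have hlen : Γ.len = 4 + 2 * es.length := by rw [hc]; rfl
  have hN : Γ.N = 2 * es.length + 2 := by rw [hc]; rfl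
  have hsp := hΓ.space
  have hw := hΓ.word
  have hl := hΓ.lit
  have hmem1 : (initial (graphInput n k b es)).mem 1 = es.length := by simp [initial, graphInput]
  obtain ⟨s₁, hs₁⟩ : ∃ s₁ : State, s₁ = ⟨update (fun _ => 0) 1 es.length,
    (initial (graphInput n k b es)).mem, []⟩ := ⟨_, rfl⟩
  obtain ⟨s₂, hs₂⟩ : ∃ s₂ : State, s₂ = ⟨update s₁.reg 0 (es.length * 2), s₁.mem, []⟩ := ⟨_, rfl⟩
  obtain ⟨s₃, hs₃⟩ : ∃ s₃ : State, s₃ = ⟨update s₂.reg 0 (es.length * 2 + 4), s₂.mem, []⟩ := ⟨_, rfl⟩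
  have hrep : Rep Γ ⟨fun _ => 0, fun _ _ => 0, []⟩ s₃ := by
    refine ⟨?_, fun x => ?_, fun a i hi => ?_, fun i hi => ?_, ?_, fun x => ?_, fun a i hi => ?_⟩
    · simp [hs₃, hlen]; omega
    · have : Expr.regOf x ≠ 0 ∧ Expr.regOf x ≠ 1 := by rw [Expr.regOf]; omega
      simp [hs₃, hs₂, hs₁, this]
    · simp only [hs₃, hs₂, hs₁, initial]
      rw [List.getD_eq_default]
      rw [length_graphInput]
      omega
    · simp only [hs₃, hs₂, hs₁, initial]
      rw [hc]
      rfl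
    · simp [hs₃]
    · simp only; omega
    · simp only; omega
  obtain ⟨s', t', h1, h2, h3⟩ := h.exec hΓ s₃ hrep
  refine ⟨s', 1 + (1 + (1 + t')), ?_, by omega, h3.out⟩
  have e1 : Exec Γ.W S (.load 1 (.imm 1)) (initial (graphInput n k b es)) s₁ 1 := by
    have := Exec.load (W := Γ.W) (S := S) (initial (graphInput n k b es)) 1 (.imm 1)
      (by simp only [Arg.val]; omega)
    simp only [Arg.val, hmem1] at this
    rw [hs₁]
    exact this
  have e2 : Exec Γ.W S (.set 0 .mul (.reg 1) (.imm 2)) s₁ s₂ 1 := by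
    have := Exec.set (W := Γ.W) (S := S) s₁ 0 .mul (.reg 1) (.imm 2)
      (by simp [Arg.val, hs₁]; omega)
    rw [hs₂]
    convert this using 2 <;> simp [hs₁, Arg.val]
  have e3 : Exec Γ.W S (.set 0 .add (.reg 0) (.imm 4)) s₂ s₃ 1 := by
    have := Exec.set (W := Γ.W) (S := S) s₂ 0 .add (.reg 0) (.imm 4)
      (by simp [Arg.val, hs₂]; omega)
    rw [hs₃]
    convert this using 2 <;> simp [hs₂, Arg.val]
  exact .seq _ _ _ _ _ _ _ e1 (.seq _ _ _ _ _ _ _ e2 (.seq _ _ _ _ _ _ _ e3 h1))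

theorem sqrt_cube_le_rpow (m : ℕ) : (Nat.sqrt (m ^ 3) : ℝ) ≤ (m : ℝ) ^ (3 / 2 : ℝ) := by
  refine Real.nat_sqrt_le_real_sqrt.trans_eq ?_
  rw [Real.sqrt_eq_rpow, Nat.cast_pow, ← Real.rpow_natCast, ← Real.rpow_mul (Nat.cast_nonneg m)]
  norm_num

end

end Greedy

theorem theorem3 :
    ∃ (prog : RAM.Prog) (C c : ℕ), ∀ (n : ℕ) (G : SimpleGraph (Fin n)) (k b : ℕ)
      (es : List (Fin n × Fin n)),
      (∀ v, ∃ w, G.Adj v w) → 1 ≤ b → b < n → IsEdgeList G es →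
      ∃ (s : RAM.State) (t : ℕ),
        RAM.Exec ((n + k + 2) ^ c) (C * G.edgeSet.ncard) prog
          (RAM.initial (graphInput n k b es)) s t ∧
        (t : ℝ) ≤ C * ((b : ℝ) * (n : ℝ) ^ 2 * (G.edgeSet.ncard : ℝ) ^ (3 / 2 : ℝ)) ∧
        IsNaiveGreedyReport G k b s.out := by
  refine ⟨Greedy.prog, 50000, 17, fun n G k b es hG hb hbn hes => ?_⟩
  rw [← Greedy.length_eq_ncard hes]
  have hfit := Greedy.fits_instOf (k := k) hes hG hb hbn
  obtain ⟨σ, t, hbig, ht, hrep⟩ := Greedy.greedy_spec (σ := ⟨fun _ => 0, fun _ _ => 0, []⟩) hfit rfl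
    (Greedy.describes_instOf hes k b) hb rfl le_rfl
  obtain ⟨s, t', h1, h2, h3⟩ := Greedy.exec_prog (es := es) (k := k) (b := b)
    (Greedy.valid_ctxOf (k := k) hes hG hb hbn) rfl hbig
  refine ⟨s, t', h1, ?_, by rw [h3]; exact hrep⟩
  have hm : 1 ≤ es.length := hfit.m_pos
  have hq := hm.trans (Greedy.le_sqrt_cube hm)
  have hr := Greedy.sqrt_cube_le_rpow es.length
  have ht' : t' ≤ 50000 * (b * (n * n * Nat.sqrt (es.length ^ 3))) := by
    have h4 : 1 ≤ b * (n * n * Nat.sqrt (es.length ^ 3)) :=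
      Nat.mul_pos hb (Nat.mul_pos (Nat.mul_pos (by omega) (by omega)) hq)
    simp only [Greedy.instOf] at ht
    omega
  calc (t' : ℝ) ≤ ((50000 * (b * (n * n * Nat.sqrt (es.length ^ 3))) : ℕ) : ℝ) := by exact_mod_cast ht'
    _ = 50000 * ((b : ℝ) * (n : ℝ) ^ 2 * (Nat.sqrt (es.length ^ 3) : ℝ)) := by push_cast; ring
    _ ≤ 50000 * ((b : ℝ) * (n : ℝ) ^ 2 * (es.length : ℝ) ^ (3 / 2 : ℝ)) := by gcongr
    _ = _ := by norm_num
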